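/- Let $G$ be a finite group and let $X$ be a (Hausdorff) $G$-CW complex, with skeleta $X_n$. Write $C(X)$ for the cellular chain complex of $X$, $C_n(X)=H_n(X_n,X_{n-1};\mathbb Z)$, regarded as a chain complex of $\mathbb Z[G]$-modules. A $G$-coefficient system is a functor $\mathscr O_G^{\mathrm{op}}\to Ab$ on the orbit category of $G$, and $C_G(X)$ denotes the chain complex of coefficient systems $G/H\mapsto C(X^H)$. Let $\underline{\mathbb Z}$ be the constant Green functor with value $\mathbb Z$, that is, the fixed point Mackey functor $G/K \mapsto \mathbb Z^K$ of the trivial module $\mathbb Z$ with the multiplication of $\mathbb Z$. A $\underline{\mathbb Z}$-module is a Mackey functor $M$ for $G$ with a unital and associative action $M\,\Box\,\underline{\mathbb Z}\to M$. Every $\underline{\mathbb Z}$-module $M$ has an underlying coefficient system $UM$, given by the restriction maps of $M$. Let $C_{\underline{\mathbb Z}}(X)$ be the chain complex of $\underline{\mathbb Z}$-modules $G/K\mapsto C(X)^K$, where restrictions are inclusions of fixed points and corestrictions are sums over representatives of cosets. The inclusions $X^K\subseteq X$ induce homomorphisms $C(X^K)\to C(X)^K$, which form a morphism $\eta\colon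 C_G(X)\to U\,C_{\underline{\mathbb Z}}(X)$ of chain complexes of coefficient systems. Then $C_{\underline{\mathbb Z}}(X)$ is the universal complex of $\underline{\mathbb Z}$-modules on $C_G(X)$: for every (non-negatively graded) chain complex $D$ of $\underline{\mathbb Z}$-modules and every morphism $\varphi\colon C_G(X)\to UD$ of chain complexes of coefficient systems there is a unique morphism $\psi\colon C_{\underline{\mathbb Z}}(X)\to D$ of chain complexes of $\underline{\mathbb Z}$-modules such that $U(\psi)\circ\eta=\varphi$. -/

import Mathlib

open CategoryTheory Topology

universe u

noncomputable section

/-! ### Finite `G`-sets and the orbit category -/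

/-- A finite `G`-set. -/
structure FinGSet (G : Type u) [Group G] where
  carrier : Type u
  [mulAction : MulAction G carrier]
  [finite : Finite carrier]

namespace FinGSet

variable {G : Type u} [Group G]

instance : CoeSort (FinGSet G) (Type u) := ⟨FinGSet.carrier⟩

instance (S : FinGSet G) : MulAction G S := S.mulAction

instance (S : FinGSet G) : Finite S := S.finite

instance (S : FinGSet G) : Fintype S := Fintype.ofFinite S

/-- Morphisms of finite `G`-sets are the `G`-equivariant maps. -/
instance : Category (FinGSet G) where
  Hom S T := S.carrier →[G] T.carrier
  id S := MulActionHom.id G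
  comp f g := MulActionHom.comp g f

/-- The equivariant map underlying a morphism of finite `G`-sets. -/
abbrev fn {S T : FinGSet G} (f : S ⟶ T) : S.carrier →[G] T.carrier := f

@[simp] theorem fn_id (S : FinGSet G) (s : S) : fn (𝟙 S) s = s := rfl

@[simp] theorem fn_comp {S T U : FinGSet G} (f : S ⟶ T) (g : T ⟶ U) (s : S) :
    fn (f ≫ g) s = fn g (fn f s) := rfl

/-- The one-point `G`-set `G/G`. -/
def pt (G : Type u) [Group G] : FinGSet G where
  carrier := PUnit.{u + 1}

/-- The product of finite `G`-sets, with the diagonal action. -/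
def prod (S T : FinGSet G) : FinGSet G where
  carrier := S.carrier × T.carrier

/-- The disjoint union of finite `G`-sets. -/
def sum (S T : FinGSet G) : FinGSet G where
  carrier := S.carrier ⊕ T.carrier

/-- The product of two equivariant maps. -/
def prodMap {S S' T T' : FinGSet G} (f : S ⟶ S') (g : T ⟶ T') : prod S T ⟶ prod S' T' where
  toFun x := (fn f x.1, fn g x.2)
  map_smul' a x := Prod.ext (map_smul (fn f) a x.1) (map_smul (fn g) a x.2)

/-- The associativity map `(S × T) × U → S × (T × U)`. -/
def prodAssoc (S T U : FinGSet G) : prod (prod S T) U ⟶ prod S (prod T U) where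
  toFun x := (x.1.1, (x.1.2, x.2))
  map_smul' _ _ := rfl

/-- The first projection `S × T → S`. -/
def fst (S T : FinGSet G) : prod S T ⟶ S where
  toFun x := x.1
  map_smul' _ _ := rfl

/-- The second projection `S × T → T`. -/
def snd (S T : FinGSet G) : prod S T ⟶ T where
  toFun x := x.2
  map_smul' _ _ := rfl

/-- The symmetry `S × T → T × S`. -/
def swap (S T : FinGSet G) : prod S T ⟶ prod T S where
  toFun x := (x.2, x.1)
  map_smul' _ _ := rfl

/-- The inclusion `S → S ⨿ T`. -/
def inl (S T : FinGSet G) : S ⟶ sum S T where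
  toFun := Sum.inl
  map_smul' _ _ := rfl

/-- The inclusion `T → S ⨿ T`. -/
def inr (S T : FinGSet G) : T ⟶ sum S T where
  toFun := Sum.inr
  map_smul' _ _ := rfl

/-- The square with sides `p : P → S`, `q : P → T`, `f : S → U`, `g : T → U` is cartesian:
it commutes and `P` is identified with the fibre product of `f` and `g`. -/
structure IsCartesian {P S T U : FinGSet G} (p : P ⟶ S) (q : P ⟶ T) (f : S ⟶ U) (g : T ⟶ U) :
    Prop where
  comm : p ≫ f = q ≫ g
  existsUnique : ∀ (s : S) (t : T), fn f s = fn g t → ∃! x : P, fn p x = s ∧ fn q x = t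

end FinGSet

/-- The orbit category of `G`: its objects are the orbits `G/H` for subgroups `H` of `G`, and its
morphisms are the `G`-equivariant maps. -/
structure OrbitCat (G : Type u) [Group G] where
  sub : Subgroup G

namespace OrbitCat

variable {G : Type u} [Group G] [Finite G]

/-- The orbit `G/H` as a finite `G`-set. -/
def orbit (O : OrbitCat G) : FinGSet G where
  carrier := G ⧸ O.sub

/-- The base point `eH` of the orbit `G/H`. -/
def base (O : OrbitCat G) : O.orbit.carrier := (QuotientGroup.mk 1 : G ⧸ O.sub)

theorem smul_base_eq_mk (O : OrbitCat G) (g : G) :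
    g • O.base = (QuotientGroup.mk g : G ⧸ O.sub) :=
  congrArg (QuotientGroup.mk (s := O.sub)) (mul_one g)

theorem smul_base (O : OrbitCat G) {k : G} (hk : k ∈ O.sub) : k • O.base = O.base := by
  rw [smul_base_eq_mk]
  exact (QuotientGroup.eq (s := O.sub)).2 (by simpa using O.sub.inv_mem hk)

theorem exists_smul_base (O : OrbitCat G) (x : O.orbit.carrier) : ∃ g : G, g • O.base = x := by
  obtain ⟨g, rfl⟩ := QuotientGroup.mk_surjective (s := O.sub) x
  exact ⟨g, O.smul_base_eq_mk g⟩

theorem smul_base_eq_iff (O : OrbitCat G) (a b : G) :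
    a • O.base = b • O.base ↔ a⁻¹ * b ∈ O.sub := by
  rw [smul_base_eq_mk, smul_base_eq_mk]
  exact QuotientGroup.eq (s := O.sub)

/-- A representative in `G` of an element of `G/H`. -/
def rep (O : OrbitCat G) (x : O.orbit.carrier) : G := (O.exists_smul_base x).choose

theorem rep_smul_base (O : OrbitCat G) (x : O.orbit.carrier) : O.rep x • O.base = x :=
  (O.exists_smul_base x).choose_spec

theorem mul_rep_mem (O : OrbitCat G) (g : G) (x : O.orbit.carrier) :
    (g * O.rep x)⁻¹ * O.rep (g • x) ∈ O.sub := by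
  rw [← smul_base_eq_iff, mul_smul, rep_smul_base, rep_smul_base]

theorem rep_base_mem (O : OrbitCat G) : O.rep O.base ∈ O.sub := by
  have h := (O.smul_base_eq_iff 1 (O.rep O.base)).1 (by rw [one_smul, rep_smul_base])
  simpa using h

instance : Category (OrbitCat G) where
  Hom O P := O.orbit ⟶ P.orbit
  id O := 𝟙 O.orbit
  comp {O P Q} f g := CategoryStruct.comp (X := O.orbit) (Y := P.orbit) (Z := Q.orbit) f g

/-- The inclusion of the orbit category in finite `G`-sets. -/
def incl : OrbitCat G ⥤ FinGSet G where
  obj O := O.orbit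
  map f := f

end OrbitCat

/-- A `G`-coefficient system is a contravariant functor from the orbit category to abelian
groups. -/
abbrev CoeffSystem (G : Type u) [Group G] [Finite G] :=
  (OrbitCat G)ᵒᵖ ⥤ AddCommGrpCat.{u}

/-! ### Mackey functors, Green functors and their modules -/

/-- A Mackey functor: a contravariant functor (restrictions `res f`, that is `f^*`) and a covariant
functor (corestrictions `tr f`, that is `f_*`) on finite `G`-sets which agree on objects, which take
disjoint unions to direct sums, and which satisfy the base change formula for cartesian squares.
Equivalently, it is an additive functor on the Burnside category, where the span
`T ← S → U` with legs `a` and `b` acts by `tr b ∘ res a`. -/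
structure MackeyFunctor (G : Type u) [Group G] where
  obj : FinGSet G → Type u
  [addCommGroup : ∀ S, AddCommGroup (obj S)]
  res : ∀ {S T : FinGSet G}, (S ⟶ T) → (obj T →+ obj S)
  tr : ∀ {S T : FinGSet G}, (S ⟶ T) → (obj S →+ obj T)
  res_id : ∀ (S : FinGSet G) (m : obj S), res (𝟙 S) m = m
  res_comp : ∀ {S T U : FinGSet G} (f : S ⟶ T) (g : T ⟶ U) (m : obj U),
    res (f ≫ g) m = res f (res g m)
  tr_id : ∀ (S : FinGSet G) (m : obj S), tr (𝟙 S) m = m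
  tr_comp : ∀ {S T U : FinGSet G} (f : S ⟶ T) (g : T ⟶ U) (m : obj S),
    tr (f ≫ g) m = tr g (tr f m)
  baseChange : ∀ {P S T U : FinGSet G} (p : P ⟶ S) (q : P ⟶ T) (f : S ⟶ U) (g : T ⟶ U),
    FinGSet.IsCartesian p q f g → ∀ m : obj S, res g (tr f m) = tr q (res p m)
  additive : ∀ S T : FinGSet G, Function.Bijective
    (fun m : obj (FinGSet.sum S T) => (res (FinGSet.inl S T) m, res (FinGSet.inr S T) m))

attribute [instance] MackeyFunctor.addCommGroup

variable {G : Type u} [Group G]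

/-- A morphism of Mackey functors: a natural family of homomorphisms. -/
@[ext]
structure MackeyFunctor.Hom (M N : MackeyFunctor G) where
  app : ∀ S : FinGSet G, M.obj S →+ N.obj S
  app_res : ∀ {S T : FinGSet G} (f : S ⟶ T) (m : M.obj T), app S (M.res f m) = N.res f (app T m)
  app_tr : ∀ {S T : FinGSet G} (f : S ⟶ T) (m : M.obj S), app T (M.tr f m) = N.tr f (app S m)

/-- A pairing of Mackey functors: homomorphisms `M(S) ⊗ N(T) → P(S × T)`, natural in `S` and `T`
with respect to restrictions and corestrictions (that is, natural on the product of two copies of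
the Burnside category). By the universal property of the left Kan extension along the product,
this is the same as a morphism of Mackey functors `M □ N → P`. -/
structure MackeyPairing (M N P : MackeyFunctor G) where
  map : ∀ S T : FinGSet G, M.obj S →+ N.obj T →+ P.obj (FinGSet.prod S T)
  map_res : ∀ {S S' T T' : FinGSet G} (f : S ⟶ S') (g : T ⟶ T') (m : M.obj S') (n : N.obj T'),
    map S T (M.res f m) (N.res g n) = P.res (FinGSet.prodMap f g) (map S' T' m n)
  map_tr : ∀ {S S' T T' : FinGSet G} (f : S ⟶ S') (g : T ⟶ T') (m : M.obj S) (n : N.obj T),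
    map S' T' (M.tr f m) (N.tr g n) = P.tr (FinGSet.prodMap f g) (map S T m n)

/-- A Green functor: a commutative monoid for the box product of Mackey functors. -/
structure GreenFunctor (G : Type u) [Group G] extends MackeyFunctor G where
  mul : MackeyPairing toMackeyFunctor toMackeyFunctor toMackeyFunctor
  one : obj (FinGSet.pt G)
  mul_assoc : ∀ (S T U : FinGSet G) (a : obj S) (b : obj T) (c : obj U),
    mul.map _ _ (mul.map _ _ a b) c =
      res (FinGSet.prodAssoc S T U) (mul.map _ _ a (mul.map _ _ b c))
  one_mul : ∀ (S : FinGSet G) (a : obj S), mul.map _ _ one a = res (FinGSet.snd (FinGSet.pt G) S) a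
  mul_one : ∀ (S : FinGSet G) (a : obj S), mul.map _ _ a one = res (FinGSet.fst S (FinGSet.pt G)) a
  mul_comm : ∀ (S T : FinGSet G) (a : obj S) (b : obj T),
    mul.map _ _ a b = res (FinGSet.swap S T) (mul.map _ _ b a)

/-- A module over a Green functor `A`: a Mackey functor `M` with an action `M □ A → M` which is
associative and unital. -/
structure GreenModule (A : GreenFunctor G) extends MackeyFunctor G where
  act : MackeyPairing toMackeyFunctor A.toMackeyFunctor toMackeyFunctor
  act_assoc : ∀ (S T U : FinGSet G) (m : obj S) (a : A.obj T) (b : A.obj U),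
    act.map _ _ (act.map _ _ m a) b =
      res (FinGSet.prodAssoc S T U) (act.map _ _ m (A.mul.map _ _ a b))
  act_one : ∀ (S : FinGSet G) (m : obj S),
    act.map _ _ m A.one = res (FinGSet.fst S (FinGSet.pt G)) m

namespace GreenModule

variable {A : GreenFunctor G}

/-- A morphism of `A`-modules: a morphism of Mackey functors compatible with the actions. -/
@[ext]
structure Hom (M N : GreenModule A) extends
    MackeyFunctor.Hom M.toMackeyFunctor N.toMackeyFunctor where
  app_act : ∀ (S T : FinGSet G) (m : M.obj S) (a : A.obj T),
    app _ (M.act.map S T m a) = N.act.map S T (app S m) a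

instance : Category (GreenModule A) where
  Hom := Hom
  id M :=
    { app := fun S => AddMonoidHom.id _
      app_res := fun _ _ => rfl
      app_tr := fun _ _ => rfl
      app_act := fun _ _ _ _ => rfl }
  comp f g :=
    { app := fun S => (g.app S).comp (f.app S)
      app_res := fun h m => by simp [f.app_res, g.app_res]
      app_tr := fun h m => by simp [f.app_tr, g.app_tr]
      app_act := fun S T m a => by simp [f.app_act, g.app_act] }

/-- The component at `S` of a morphism of modules. -/
abbrev homApp {M N : GreenModule A} (f : M ⟶ N) (S : FinGSet G) : M.obj S →+ N.obj S :=
  MackeyFunctor.Hom.app (Hom.toHom f) S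

@[simp] theorem homApp_comp {M N P : GreenModule A} (f : M ⟶ N) (g : N ⟶ P) (S : FinGSet G)
    (m : M.obj S) : homApp (f ≫ g) S m = homApp g S (homApp f S m) := rfl

@[simp] theorem homApp_id (M : GreenModule A) (S : FinGSet G) (m : M.obj S) :
    homApp (𝟙 M) S m = m := rfl

theorem hom_ext {M N : GreenModule A} {f g : M ⟶ N}
    (h : ∀ (S : FinGSet G) (m : M.obj S), homApp f S m = homApp g S m) : f = g :=
  Hom.ext (funext fun S => AddMonoidHom.ext fun m => h S m)

instance (M N : GreenModule A) : Zero (M ⟶ N) :=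
  ⟨{ app := fun S => 0
     app_res := fun _ _ => by simp
     app_tr := fun _ _ => by simp
     app_act := fun _ _ _ _ => by simp }⟩

@[simp] theorem homApp_zero {M N : GreenModule A} (S : FinGSet G) (m : M.obj S) :
    homApp (0 : M ⟶ N) S m = 0 := rfl

instance : Limits.HasZeroMorphisms (GreenModule A) where
  comp_zero f P := hom_ext fun S m => by simp
  zero_comp M _ _ f := hom_ext fun S m => by simp

/-- The underlying coefficient system of a module over a Green functor: its restriction to the
orbits `G/H`, with the contravariant structure maps. -/
def toCoeff [Finite G] (A : GreenFunctor G) : GreenModule A ⥤ CoeffSystem G where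
  obj M :=
    { obj := fun O => AddCommGrpCat.of (M.obj O.unop.orbit)
      map := fun {O P} f => AddCommGrpCat.ofHom
        (M.res (S := P.unop.orbit) (T := O.unop.orbit) f.unop)
      map_id := fun O => by
        ext m
        exact M.res_id _ m
      map_comp := fun {O P Q} f g => by
        ext m
        exact M.res_comp (S := Q.unop.orbit) (T := P.unop.orbit) (U := O.unop.orbit)
          g.unop f.unop m }
  map f :=
    { app := fun O => AddCommGrpCat.ofHom (homApp f O.unop.orbit)
      naturality := fun O P h => by
        ext m
        exact MackeyFunctor.Hom.app_res (Hom.toHom f) (S := P.unop.orbit) (T := O.unop.orbit)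
          h.unop m }

instance [Finite G] : (toCoeff A).PreservesZeroMorphisms where
  map_zero _ _ := rfl

end GreenModule

/-! ### The fixed point Mackey functors and the constant Green functor -/

section FixedPoints

variable {N N' : Type u} [AddCommGroup N] [AddCommGroup N']

/-- For a `ℤ[G]`-module `N` (an abelian group with a homomorphism `ρ : G → End N`) and a `G`-set `S`,
the group of equivariant maps `S → N`. For `S = G/K` it is the group `N^K` of fixed points,
see `equivariantMapsOrbitEquiv`. -/
def equivariantMaps (ρ : G →* AddMonoid.End N) (S : FinGSet G) : AddSubgroup (S → N) where
  carrier := {φ | ∀ (g : G) (s : S), φ (g • s) = ρ g (φ s)}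
  zero_mem' := fun g s => by simp
  add_mem' := fun {a b} ha hb g s => by simp [ha g s, hb g s]
  neg_mem' := fun {a} ha g s => by simp [ha g s]

/-- Evaluation at the base point identifies the equivariant maps `G/K → N` with the fixed points
`N^K`. -/
def equivariantMapsOrbitEquiv [Finite G] (ρ : G →* AddMonoid.End N) (O : OrbitCat G) :
    equivariantMaps ρ O.orbit ≃ {n : N // ∀ k ∈ O.sub, ρ k n = n} where
  toFun φ := ⟨φ.1 O.base, fun k hk => by rw [← φ.2 k, O.smul_base hk]⟩
  invFun n := ⟨fun x => ρ (O.rep x) n.1, fun g x => by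
    have h := n.2 _ (O.mul_rep_mem g x)
    change ρ (O.rep (g • x)) n.1 = (ρ g * ρ (O.rep x)) n.1
    rw [← map_mul]
    conv_rhs => rw [← h]
    change _ = (ρ (g * O.rep x) * ρ _) n.1
    rw [← map_mul, mul_inv_cancel_left]⟩
  left_inv φ := by
    ext x
    change ρ (O.rep x) (φ.1 O.base) = φ.1 x
    rw [← φ.2, O.rep_smul_base]
  right_inv n := Subtype.ext (n.2 _ O.rep_base_mem)

/-- Restriction along `f : S → T`: composition with `f`. On fixed points of subgroups `H ≤ K` this
is the inclusion `N^K → N^H`. -/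
def equivariantMaps.res (ρ : G →* AddMonoid.End N) {S T : FinGSet G} (f : S ⟶ T) :
    equivariantMaps ρ T →+ equivariantMaps ρ S where
  toFun φ := ⟨fun s => φ.1 (FinGSet.fn f s), fun g s => by
    simpa using φ.2 g (FinGSet.fn f s)⟩
  map_zero' := rfl
  map_add' _ _ := rfl

open scoped Classical in
/-- Corestriction along `f : S → T`: summation over the fibres of `f`. On fixed points of subgroups
`H ≤ K` this is `N^H → N^K`, the sum over representatives of the cosets `K/H`. -/
def equivariantMaps.tr (ρ : G →* AddMonoid.End N) {S T : FinGSet G} (f : S ⟶ T) :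
    equivariantMaps ρ S →+ equivariantMaps ρ T where
  toFun φ := ⟨fun t => ∑ s : S with FinGSet.fn f s = t, φ.1 s, fun g t => by
    dsimp only
    rw [map_sum, Finset.sum_filter, Finset.sum_filter,
      ← Equiv.sum_comp (MulAction.toPerm g : Equiv.Perm S)]
    refine Finset.sum_congr rfl fun s _ => ?_
    simp only [MulAction.toPerm_apply, map_smul, smul_left_cancel_iff, φ.2 g s]⟩
  map_zero' := by ext; simp
  map_add' a b := by ext; simp [Finset.sum_add_distrib]

/-- The fixed point Mackey functor `G/K ↦ N^K` of a `ℤ[G]`-module `N`. -/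
def fixedPointMackey (ρ : G →* AddMonoid.End N) : MackeyFunctor G where
  obj S := equivariantMaps ρ S
  res f := equivariantMaps.res ρ f
  tr f := equivariantMaps.tr ρ f
  res_id _ _ := rfl
  res_comp _ _ _ := rfl
  tr_id S m := by
    classical
    ext t
    change ∑ s : S with s = t, m.1 s = m.1 t
    simp [Finset.sum_filter]
  tr_comp {S T U} f g m := by
    classical
    ext u
    change ∑ s : S with FinGSet.fn g (FinGSet.fn f s) = u, m.1 s =
      ∑ t : T with FinGSet.fn g t = u, ∑ s : S with FinGSet.fn f s = t, m.1 s
    rw [← Finset.sum_fiberwise_of_maps_to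
      (s := Finset.univ.filter fun s : S => FinGSet.fn g (FinGSet.fn f s) = u)
      (t := Finset.univ.filter fun t : T => FinGSet.fn g t = u)
      (g := fun s => FinGSet.fn f s) (fun s hs => by simpa using hs)]
    refine Finset.sum_congr rfl fun t ht => Finset.sum_congr ?_ fun _ _ => rfl
    ext s
    simp only [Finset.mem_filter, Finset.mem_univ, true_and] at ht ⊢
    exact ⟨fun h => h.2, fun h => ⟨by rw [h, ht], h⟩⟩
  baseChange {P S T U} p q f g h m := by
    classical
    ext t
    change ∑ s : S with FinGSet.fn f s = FinGSet.fn g t, m.1 s =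
      ∑ x : P with FinGSet.fn q x = t, m.1 (FinGSet.fn p x)
    symm
    refine Finset.sum_bij (fun x _ => FinGSet.fn p x) ?_ ?_ ?_ (fun _ _ => rfl)
    · intro x hx
      simp only [Finset.mem_filter, Finset.mem_univ, true_and] at hx ⊢
      rw [← hx]
      exact DFunLike.congr_fun (F := P.carrier →[G] U.carrier) h.comm x
    · intro x hx y hy hxy
      simp only [Finset.mem_filter, Finset.mem_univ, true_and] at hx hy
      have hc : FinGSet.fn f (FinGSet.fn p x) = FinGSet.fn g t := by
        rw [← hx]
        exact DFunLike.congr_fun (F := P.carrier →[G] U.carrier) h.comm x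
      exact (h.existsUnique _ t hc).unique ⟨rfl, hx⟩ ⟨hxy.symm, hy⟩
    · intro s hs
      simp only [Finset.mem_filter, Finset.mem_univ, true_and] at hs
      obtain ⟨x, ⟨h1, h2⟩, -⟩ := h.existsUnique s t hs
      exact ⟨x, by simp [h2], h1⟩
  additive S T := by
    constructor
    · intro a b h
      ext x
      rcases x with s | t
      · exact congrFun (congrArg (fun z => z.1.1) h) s
      · exact congrFun (congrArg (fun z => z.2.1) h) t
    · rintro ⟨a, b⟩
      refine ⟨⟨Sum.elim a.1 b.1, ?_⟩, rfl⟩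
      rintro g (s | t)
      · exact a.2 g s
      · exact b.2 g t

/-- The trivial `G`-action on the abelian group `ℤ` (placed in the universe `u`). -/
abbrev trivialInt (G : Type u) [Group G] : G →* AddMonoid.End (ULift.{u} ℤ) := 1

/-- The pairing of the fixed points of `N` with the fixed points of the trivial module `ℤ`:
`(φ · a) (s, t) = a t • φ s`. -/
def fixedPointPairing (ρ : G →* AddMonoid.End N) :
    MackeyPairing (fixedPointMackey ρ) (fixedPointMackey (trivialInt G)) (fixedPointMackey ρ) where
  map S T :=
    AddMonoidHom.mk' (fun φ => AddMonoidHom.mk'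
      (fun a => (⟨fun x => (a.1 x.2).down • φ.1 x.1, fun g x => by
          have h1 : a.1 (g • x.2) = a.1 x.2 := a.2 g x.2
          have h2 : φ.1 (g • x.1) = ρ g (φ.1 x.1) := φ.2 g x.1
          change (a.1 (g • x.2)).down • φ.1 (g • x.1) = _
          rw [h1, h2, map_zsmul]⟩ : equivariantMaps ρ (FinGSet.prod S T)))
      (fun a b => Subtype.ext (funext fun x => add_smul _ _ _)))
      (fun φ ψ => AddMonoidHom.ext fun a => Subtype.ext (funext fun x =>
        smul_add (a.1 x.2).down (φ.1 x.1) (ψ.1 x.1)))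
  map_res _ _ _ _ := rfl
  map_tr {S S' T T'} f g φ a := by
    classical
    apply Subtype.ext
    funext x
    change (∑ t : T with FinGSet.fn g t = x.2, a.1 t).down •
        ∑ s : S with FinGSet.fn f s = x.1, φ.1 s =
      ∑ y : (FinGSet.prod S T) with FinGSet.fn (FinGSet.prodMap f g) y = x,
        (a.1 y.2).down • φ.1 y.1
    have hd : (∑ t : T with FinGSet.fn g t = x.2, a.1 t).down =
        ∑ t : T with FinGSet.fn g t = x.2, (a.1 t).down :=
      map_sum (AddEquiv.ulift : ULift.{u} ℤ ≃+ ℤ) _ _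
    rw [hd, Finset.sum_smul]
    simp_rw [Finset.smul_sum]
    rw [← Finset.sum_product']
    refine Finset.sum_bij (fun y _ => (y.2, y.1)) ?_ ?_ ?_ (fun _ _ => rfl)
    · intro y hy
      simp only [Finset.mem_product, Finset.mem_filter, Finset.mem_univ, true_and] at hy
      refine Finset.mem_filter.2 ⟨Finset.mem_univ _, ?_⟩
      change (FinGSet.fn f y.2, FinGSet.fn g y.1) = (x.1, x.2)
      rw [hy.1, hy.2]
    · intro y _ z _ h
      exact Prod.ext (congrArg Prod.snd h) (congrArg Prod.fst h)
    · intro y hy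
      simp only [Finset.mem_filter, Finset.mem_univ, true_and] at hy
      refine ⟨(y.2, y.1), ?_, rfl⟩
      simp only [Finset.mem_product, Finset.mem_filter, Finset.mem_univ, true_and]
      exact ⟨congrArg Prod.snd hy, congrArg Prod.fst hy⟩

/-- The constant Green functor `ℤ`: the fixed point Mackey functor of the trivial module `ℤ`, with
multiplication given by the multiplication of `ℤ`. Its value at each orbit `G/H` is `ℤ`. -/
def constGreen (G : Type u) [Group G] : GreenFunctor G where
  toMackeyFunctor := fixedPointMackey (trivialInt G)
  mul := fixedPointPairing (trivialInt G)
  one := ⟨fun _ => ⟨1⟩, fun _ _ => rfl⟩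
  mul_assoc S T U a b c := by
    apply Subtype.ext
    funext x
    apply ULift.ext
    change (c.1 x.2).down * ((b.1 x.1.2).down * (a.1 x.1.1).down) =
      ((c.1 x.2).down * (b.1 x.1.2).down) * (a.1 x.1.1).down
    ring
  one_mul S a := by
    apply Subtype.ext
    funext x
    apply ULift.ext
    change (a.1 x.2).down * 1 = (a.1 x.2).down
    ring
  mul_one S a := by
    apply Subtype.ext
    funext x
    apply ULift.ext
    change 1 * (a.1 x.1).down = (a.1 x.1).down
    ring
  mul_comm S T a b := by
    apply Subtype.ext
    funext x
    apply ULift.ext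
    change (b.1 x.2).down * (a.1 x.1).down = (a.1 x.1).down * (b.1 x.2).down
    ring

/-- The category of modules over the constant Green functor `ℤ`. -/
abbrev ConstModule (G : Type u) [Group G] := GreenModule (constGreen G)

/-- The fixed points `G/K ↦ N^K` of a `ℤ[G]`-module as a module over the constant Green functor. -/
def fixedPointModule (ρ : G →* AddMonoid.End N) : ConstModule G where
  toMackeyFunctor := fixedPointMackey ρ
  act := fixedPointPairing ρ
  act_assoc S T U m a b := by
    apply Subtype.ext
    funext x
    change (b.1 x.2).down • ((a.1 x.1.2).down • m.1 x.1.1) =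
      ((b.1 x.2).down * (a.1 x.1.2).down) • m.1 x.1.1
    rw [mul_smul]
  act_one S m := by
    apply Subtype.ext
    funext x
    exact one_smul ℤ (m.1 x.1)

/-- The map `N^K → N'^K` induced by an equivariant homomorphism `N → N'`. -/
def equivariantMaps.map {ρ : G →* AddMonoid.End N} {ρ' : G →* AddMonoid.End N'} (h : N →+ N')
    (hh : ∀ (g : G) (n : N), h (ρ g n) = ρ' g (h n)) (S : FinGSet G) :
    equivariantMaps ρ S →+ equivariantMaps ρ' S where
  toFun φ := ⟨fun s => h (φ.1 s), fun g s => by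
    rw [← hh, ← φ.2 g s]⟩
  map_zero' := Subtype.ext (funext fun _ => map_zero h)
  map_add' _ _ := Subtype.ext (funext fun _ => map_add h _ _)

/-- The morphism of modules `(K ↦ N^K) → (K ↦ N'^K)` induced by an equivariant homomorphism. -/
def fixedPointModule.map {ρ : G →* AddMonoid.End N} {ρ' : G →* AddMonoid.End N'} (h : N →+ N')
    (hh : ∀ (g : G) (n : N), h (ρ g n) = ρ' g (h n)) :
    fixedPointModule ρ ⟶ fixedPointModule ρ' :=
  ({ app := equivariantMaps.map h hh
     app_res := fun _ _ => rfl
     app_tr := fun f m => by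
      apply Subtype.ext
      funext t
      exact map_sum h _ _
     app_act := fun S T m a => by
      apply Subtype.ext
      funext x
      exact map_zsmul h _ _ } : GreenModule.Hom (fixedPointModule ρ) (fixedPointModule ρ'))

end FixedPoints

/-! ### Cellular chains -/

/-- A topological space with an increasing sequence of subspaces. For a CW complex we take
`sk n` to be the `(n - 1)`-skeleton, so that `sk 0` is empty. -/
structure FiltSpace where
  carrier : Type u
  [top : TopologicalSpace carrier]
  sk : ℕ → Set carrier
  mono : Monotone sk

namespace FiltSpace

attribute [instance] FiltSpace.top

/-- A filtration preserving continuous map. -/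
@[ext]
structure Hom (X Y : FiltSpace.{u}) where
  map : C(X.carrier, Y.carrier)
  mapsTo : ∀ n, Set.MapsTo map (X.sk n) (Y.sk n)

instance : Category FiltSpace.{u} where
  Hom := Hom
  id X := ⟨ContinuousMap.id _, fun _ => Set.mapsTo_id _⟩
  comp f g := ⟨g.map.comp f.map, fun n => (g.mapsTo n).comp (f.mapsTo n)⟩

/-- The `n`-th space of the filtration, with the subspace topology. -/
def level (X : FiltSpace.{u}) (n : ℕ) : TopCat.{u} := TopCat.of (X.sk n)

theorem sk_subset (X : FiltSpace.{u}) (n : ℕ) : X.sk n ⊆ X.sk (n + 1) := X.mono n.le_succ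

/-- The inclusion of the `n`-th space of the filtration in the next one. -/
def incl (X : FiltSpace.{u}) (n : ℕ) : X.level n ⟶ X.level (n + 1) :=
  TopCat.ofHom ⟨Set.inclusion (X.sk_subset n), continuous_inclusion (X.sk_subset n)⟩

instance (X : FiltSpace.{u}) (n : ℕ) : Mono (X.incl n) :=
  (TopCat.mono_iff_injective _).2 (Set.inclusion_injective (X.sk_subset n))

/-- The map induced on the `n`-th spaces of the filtrations. -/
def levelMap {X Y : FiltSpace.{u}} (f : X ⟶ Y) (n : ℕ) : X.level n ⟶ Y.level n :=
  TopCat.ofHom ⟨(Hom.mapsTo f n).restrict, (Hom.map f).continuous.restrict (Hom.mapsTo f n)⟩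

theorem levelMap_id (X : FiltSpace.{u}) (n : ℕ) : levelMap (𝟙 X) n = 𝟙 _ := rfl

theorem levelMap_comp {X Y Z : FiltSpace.{u}} (f : X ⟶ Y) (g : Y ⟶ Z) (n : ℕ) :
    levelMap (f ≫ g) n = levelMap f n ≫ levelMap g n := rfl

theorem incl_levelMap {X Y : FiltSpace.{u}} (f : X ⟶ Y) (n : ℕ) :
    X.incl n ≫ levelMap f (n + 1) = levelMap f n ≫ Y.incl n := rfl

/-- The singular chain complex functor with integral coefficients. -/
abbrev singularChains : TopCat.{u} ⥤ ChainComplex AddCommGrpCat.{u} ℕ :=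
  (AlgebraicTopology.singularChainComplexFunctor AddCommGrpCat.{u}).obj
    (AddCommGrpCat.of (ULift.{u} ℤ))

/-- The relative singular chain complex `S(X_{n+1}) / S(X_n)` of consecutive filtration steps. -/
def relChains (X : FiltSpace.{u}) (n : ℕ) : ChainComplex AddCommGrpCat.{u} ℕ :=
  Limits.cokernel (singularChains.map (X.incl n))

/-- The projection `S(X_{n+1}) → S(X_{n+1}) / S(X_n)`. -/
def relProj (X : FiltSpace.{u}) (n : ℕ) : singularChains.obj (X.level (n + 1)) ⟶ X.relChains n :=
  Limits.cokernel.π _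

instance (X : FiltSpace.{u}) (n : ℕ) : Epi (X.relProj n) := by
  dsimp only [relProj, relChains]; infer_instance

theorem incl_relProj (X : FiltSpace.{u}) (n : ℕ) :
    singularChains.map (X.incl n) ≫ X.relProj n = 0 :=
  Limits.cokernel.condition _

/-- The map induced on relative singular chains. -/
def relMap {X Y : FiltSpace.{u}} (f : X ⟶ Y) (n : ℕ) : X.relChains n ⟶ Y.relChains n :=
  Limits.cokernel.map _ _ (singularChains.map (levelMap f n))
    (singularChains.map (levelMap f (n + 1)))
    (by rw [← Functor.map_comp, ← Functor.map_comp, incl_levelMap])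

theorem relProj_relMap {X Y : FiltSpace.{u}} (f : X ⟶ Y) (n : ℕ) :
    X.relProj n ≫ relMap f n = singularChains.map (levelMap f (n + 1)) ≫ Y.relProj n :=
  Limits.cokernel.π_desc _ _ _

theorem relMap_id (X : FiltSpace.{u}) (n : ℕ) : relMap (𝟙 X) n = 𝟙 _ := by
  rw [← cancel_epi (X.relProj n), relProj_relMap, levelMap_id, CategoryTheory.Functor.map_id, Category.id_comp,
    Category.comp_id]

theorem relMap_comp {X Y Z : FiltSpace.{u}} (f : X ⟶ Y) (g : Y ⟶ Z) (n : ℕ) :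
    relMap (f ≫ g) n = relMap f n ≫ relMap g n := by
  rw [← cancel_epi (X.relProj n), relProj_relMap, levelMap_comp, Functor.map_comp, Category.assoc,
    ← relProj_relMap, ← Category.assoc, ← relProj_relMap, Category.assoc]

/-- The short exact sequence
`0 → S(X_n) → S(X_{n+1}) → S(X_{n+1}) / S(X_n) → 0` of singular chain complexes. -/
abbrev pairSequence (X : FiltSpace.{u}) (n : ℕ) :
    ShortComplex (ChainComplex AddCommGrpCat.{u} ℕ) :=
  ShortComplex.mk (singularChains.map (X.incl n)) (X.relProj n) (X.incl_relProj n)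

theorem pairSequence_shortExact (X : FiltSpace.{u}) (n : ℕ) : (X.pairSequence n).ShortExact where
  exact := ShortComplex.exact_cokernel (singularChains.map (X.incl n))
  mono_f := by dsimp only [pairSequence]; infer_instance
  epi_g := by dsimp only [pairSequence]; infer_instance

/-- The map induced on the short exact sequences of pairs. -/
def pairSequenceMap {X Y : FiltSpace.{u}} (f : X ⟶ Y) (n : ℕ) :
    X.pairSequence n ⟶ Y.pairSequence n where
  τ₁ := singularChains.map (levelMap f n)
  τ₂ := singularChains.map (levelMap f (n + 1))
  τ₃ := relMap f n
  comm₁₂ := by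
    dsimp only [pairSequence]
    rw [← Functor.map_comp, ← Functor.map_comp, incl_levelMap]
  comm₂₃ := (relProj_relMap f n).symm

/-- The group of cellular `n`-chains: the relative singular homology `H_n(sk (n+1), sk n)`, that is
`H_n(X_n, X_{n-1})` in terms of skeleta. -/
abbrev cellChains (X : FiltSpace.{u}) (n : ℕ) : AddCommGrpCat.{u} :=
  (X.relChains n).homology n

/-- The connecting homomorphism `H_{n+1}(sk (n+2), sk (n+1)) → H_n(sk (n+1))`. -/
def connecting (X : FiltSpace.{u}) (n : ℕ) :
    X.cellChains (n + 1) ⟶ (singularChains.obj (X.level (n + 1))).homology n :=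
  (X.pairSequence_shortExact (n + 1)).δ (n + 1) n rfl

/-- The canonical map `H_n(sk (n+1)) → H_n(sk (n+1), sk n)`. -/
def toCellChains (X : FiltSpace.{u}) (n : ℕ) :
    (singularChains.obj (X.level (n + 1))).homology n ⟶ X.cellChains n :=
  HomologicalComplex.homologyMap (X.relProj n) n

theorem toCellChains_connecting (X : FiltSpace.{u}) (n : ℕ) :
    X.toCellChains (n + 1) ≫ X.connecting n = 0 :=
  (X.pairSequence_shortExact (n + 1)).comp_δ (n + 1) n rfl

/-- The cellular differential: the composite
`H_{n+1}(X_{n+1}, X_n) → H_n(X_n) → H_n(X_n, X_{n-1})` of the connecting homomorphism and the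
canonical map (in terms of skeleta `X_n = sk (n+1)`). -/
def cellDiff (X : FiltSpace.{u}) (n : ℕ) : X.cellChains (n + 1) ⟶ X.cellChains n :=
  X.connecting n ≫ X.toCellChains n

theorem cellDiff_comp (X : FiltSpace.{u}) (n : ℕ) : X.cellDiff (n + 1) ≫ X.cellDiff n = 0 := by
  simp only [cellDiff, Category.assoc]
  rw [← Category.assoc (X.toCellChains (n + 1)), toCellChains_connecting, Limits.zero_comp,
    Limits.comp_zero]

/-- The map induced on cellular chains. -/
def cellMap {X Y : FiltSpace.{u}} (f : X ⟶ Y) (n : ℕ) : X.cellChains n ⟶ Y.cellChains n :=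
  HomologicalComplex.homologyMap (relMap f n) n

theorem cellMap_id (X : FiltSpace.{u}) (n : ℕ) : cellMap (𝟙 X) n = 𝟙 _ := by
  rw [cellMap, relMap_id, HomologicalComplex.homologyMap_id]

theorem cellMap_comp {X Y Z : FiltSpace.{u}} (f : X ⟶ Y) (g : Y ⟶ Z) (n : ℕ) :
    cellMap (f ≫ g) n = cellMap f n ≫ cellMap g n := by
  rw [cellMap, relMap_comp, HomologicalComplex.homologyMap_comp]
  rfl

theorem cellMap_diff {X Y : FiltSpace.{u}} (f : X ⟶ Y) (n : ℕ) :
    cellMap f (n + 1) ≫ Y.cellDiff n = X.cellDiff n ≫ cellMap f n := by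
  have h1 : X.connecting n ≫
      HomologicalComplex.homologyMap (singularChains.map (levelMap f (n + 1))) n =
      cellMap f (n + 1) ≫ Y.connecting n :=
    HomologicalComplex.HomologySequence.δ_naturality (pairSequenceMap f (n + 1))
      (X.pairSequence_shortExact (n + 1)) (Y.pairSequence_shortExact (n + 1)) (n + 1) n rfl
  have h2 : X.toCellChains n ≫ cellMap f n =
      HomologicalComplex.homologyMap (singularChains.map (levelMap f (n + 1))) n ≫
        Y.toCellChains n := by
    rw [toCellChains, toCellChains, cellMap, ← HomologicalComplex.homologyMap_comp,
      ← HomologicalComplex.homologyMap_comp, relProj_relMap]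
  simp only [cellDiff, Category.assoc, h2]
  rw [← Category.assoc, ← Category.assoc, h1]

/-- The cellular chain complex of a filtered space. -/
def cellComplex (X : FiltSpace.{u}) : ChainComplex AddCommGrpCat.{u} ℕ :=
  ChainComplex.of X.cellChains X.cellDiff X.cellDiff_comp

/-- The cellular chain complex as a functor. -/
def cellComplexFunctor : FiltSpace.{u} ⥤ ChainComplex AddCommGrpCat.{u} ℕ where
  obj := cellComplex
  map f := ChainComplex.ofHom (X := cellComplex _) (Y := cellComplex _) (cellMap f) (fun n => by
    simpa [cellComplex] using cellMap_diff f n)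
  map_id X := by
    ext1 n
    exact cellMap_id X n
  map_comp f g := by
    ext1 n
    exact cellMap_comp f g n

end FiltSpace

/-! ### `G`-CW complexes and their chain complexes -/

/-- A `G`-CW complex (for a finite, discrete group `G`): a `G`-space `X` with a CW structure such
that `G` acts on the sets `I_n` of `n`-cells and the characteristic maps `I_n × D^n → X` are
equivariant, where `G` acts trivially on `D^n`. Decomposing the `G`-set `I_n` into orbits, the space
`X_n` is obtained from `X_{n-1}` by attaching equivariant cells `G/H × D^n`. In particular a group
element that maps a cell to itself fixes it pointwise. -/
class GCWComplex (G X : Type u) [Group G] [TopologicalSpace X] [MulAction G X] extends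
    Topology.CWComplex (Set.univ : Set X) where
  /-- The action of `G` on the set of `n`-cells. -/
  cellAction (n : ℕ) : MulAction G (cell n)
  /-- The characteristic maps are equivariant. -/
  map_smul (n : ℕ) (g : G) (i : cell n) (x : Fin n → ℝ) (hx : x ∈ Metric.closedBall 0 1) :
    map n (g • i) x = g • map n i x

namespace GCWComplex

/-- The skeletal filtration of `X`: `skel G X n` is the `(n - 1)`-skeleton, the union of the closed
cells of dimension less than `n`. -/
def skel (G X : Type u) [Group G] [TopologicalSpace X] [T2Space X] [MulAction G X] [GCWComplex G X]
    (n : ℕ) : Set X :=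
  CWComplex.skeletonLT (Set.univ : Set X) (n : ℕ∞)

section Skel

variable {X : Type u} [TopologicalSpace X] [T2Space X] [MulAction G X] [GCWComplex G X]

theorem skel_mono : Monotone (skel G X) := fun _ _ h =>
  CWComplex.skeletonLT_mono (by exact_mod_cast h)

theorem smul_mem_skel {n : ℕ} (g : G) {x : X} (hx : x ∈ skel G X n) : g • x ∈ skel G X n := by
  obtain ⟨m, hm, j, y, hy, rfl⟩ := CWComplex.mem_skeletonLT_iff.1 hx
  exact CWComplex.mem_skeletonLT_iff.2 ⟨m, hm, (cellAction (X := X) m).toSMul.smul g j, y, hy,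
    map_smul m g j y (Metric.ball_subset_closedBall hy)⟩

end Skel

section Spaces

variable (G) (X : Type u) [TopologicalSpace X] [T2Space X] [MulAction G X] [GCWComplex G X]

/-- The space `X` with its skeletal filtration. -/
def filt : FiltSpace.{u} where
  carrier := X
  sk := skel G X
  mono := skel_mono

/-- The action of `g : G` on the filtered space `X`. -/
def smulHom [ContinuousConstSMul G X] (g : G) : filt G X ⟶ filt G X :=
  (⟨⟨fun x : X => g • x, continuous_const_smul (T := X) g⟩,
    fun _ _ hx => smul_mem_skel (X := X) g hx⟩ : FiltSpace.Hom (filt G X) (filt G X))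

/-- For a finite `G`-set `S`, the space of equivariant maps `S → X`, filtered by the subspaces of
equivariant maps to the skeleta. For `S = G/H` it is the fixed point space `X^H`, filtered by its
skeleta `(X^H)_n = X^H ∩ X_n`, see `mapFiltOrbitHomeo`. -/
def mapFilt (S : FinGSet G) : FiltSpace.{u} where
  carrier := {f : S → X // ∀ (g : G) (s : S), f (g • s) = g • f s}
  sk n := {f | ∀ s, f.1 s ∈ skel G X n}
  mono _ _ h _ hf s := skel_mono h (hf s)

/-- Precomposition with an equivariant map `S → T`. -/
def precompHom {S T : FinGSet G} (f : S ⟶ T) : mapFilt G X T ⟶ mapFilt G X S :=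
  (⟨⟨fun φ => ⟨fun s => φ.1 (FinGSet.fn f s), fun g s => by
        simpa using φ.2 g (FinGSet.fn f s)⟩,
      by
        refine Continuous.subtype_mk (continuous_pi fun s => ?_) _
        exact (continuous_apply (FinGSet.fn f s)).comp continuous_subtype_val⟩,
    fun _ _ hφ s => hφ (FinGSet.fn f s)⟩ : FiltSpace.Hom (mapFilt G X T) (mapFilt G X S))

/-- The contravariant functor `S ↦ Map_G(S, X)` on finite `G`-sets. -/
def mapFiltFunctor : (FinGSet G)ᵒᵖ ⥤ FiltSpace.{u} where
  obj S := mapFilt G X S.unop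
  map f := precompHom G X f.unop

/-- Evaluation at `s : S`. For `S = G/H` and `s` the base point this is the inclusion
`X^H → X`. -/
def evalHom (S : FinGSet G) (s : S) : mapFilt G X S ⟶ filt G X :=
  (⟨⟨fun φ => φ.1 s, (continuous_apply s).comp continuous_subtype_val⟩, fun _ _ hφ => hφ s⟩ :
    FiltSpace.Hom (mapFilt G X S) (filt G X))

theorem evalHom_smul [ContinuousConstSMul G X] (S : FinGSet G) (g : G) (s : S) :
    evalHom G X S (g • s) = evalHom G X S s ≫ smulHom G X g :=
  FiltSpace.Hom.ext (ContinuousMap.ext fun φ => φ.2 g s)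

theorem precompHom_evalHom {S T : FinGSet G} (f : S ⟶ T) (s : S) :
    precompHom G X f ≫ evalHom G X S s = evalHom G X T (FinGSet.fn f s) := rfl

/-- Evaluation at the base point identifies the space of equivariant maps `G/H → X` with the
fixed point space `X^H`. -/
def mapFiltOrbitHomeo [Finite G] [ContinuousConstSMul G X] (O : OrbitCat G) :
    (mapFilt G X O.orbit).carrier ≃ₜ {x : X // ∀ h ∈ O.sub, h • x = x} where
  toFun φ := ⟨φ.1 O.base, fun h hh => by rw [← φ.2, O.smul_base hh]⟩
  invFun x := ⟨fun s => O.rep s • x.1, fun g s => by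
    have h := x.2 _ (O.mul_rep_mem g s)
    rw [← mul_smul]
    conv_rhs => rw [← h]
    rw [← mul_smul, mul_inv_cancel_left]⟩
  left_inv φ := Subtype.ext (funext fun s => by
    change O.rep s • φ.1 O.base = φ.1 s
    rw [← φ.2, O.rep_smul_base])
  right_inv x := Subtype.ext (x.2 _ O.rep_base_mem)
  continuous_toFun :=
    Continuous.subtype_mk ((continuous_apply O.base).comp continuous_subtype_val) _
  continuous_invFun := Continuous.subtype_mk
    (continuous_pi fun s => (continuous_const_smul (O.rep s)).comp continuous_subtype_val) _

theorem mapFiltOrbitHomeo_mem [Finite G] [ContinuousConstSMul G X] (O : OrbitCat G) (n : ℕ)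
    (φ : (mapFilt G X O.orbit).carrier) :
    φ ∈ (mapFilt G X O.orbit).sk n ↔ (mapFiltOrbitHomeo G X O φ).1 ∈ skel G X n := by
  refine ⟨fun h => h O.base, fun h s => ?_⟩
  rw [← O.rep_smul_base s, φ.2]
  exact smul_mem_skel _ h

end Spaces

section Chains

variable (G) (X : Type u) [TopologicalSpace X] [T2Space X] [MulAction G X] [GCWComplex G X]

/-- The cellular chain complex `C(X)`. -/
def chains : ChainComplex AddCommGrpCat.{u} ℕ :=
  FiltSpace.cellComplexFunctor.obj (filt G X)

/-- The functor `G/H ↦ C(X^H)` from the opposite of the orbit category to chain complexes. -/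
def coeffChainsFunctor [Finite G] : (OrbitCat G)ᵒᵖ ⥤ ChainComplex AddCommGrpCat.{u} ℕ :=
  OrbitCat.incl.op ⋙ mapFiltFunctor G X ⋙ FiltSpace.cellComplexFunctor

/-- The cellular chain complex of coefficient systems `C_G(X) : G/H ↦ C(X^H)`. -/
def coeffChains [Finite G] : ChainComplex (CoeffSystem G) ℕ where
  X n := coeffChainsFunctor G X ⋙ HomologicalComplex.eval _ _ n
  d i j :=
    { app := fun O => ((coeffChainsFunctor G X).obj O).d i j
      naturality := fun O P f => ((coeffChainsFunctor G X).map f).comm i j }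
  shape i j h := by
    ext O : 2
    exact ((coeffChainsFunctor G X).obj O).shape i j h
  d_comp_d' i j k _ _ := by
    ext O : 2
    exact ((coeffChainsFunctor G X).obj O).d_comp_d i j k

variable [ContinuousConstSMul G X]

/-- The action of `G` on the cellular `n`-chains of `X`, which makes `C(X)` a complex of
`ℤ[G]`-modules. -/
def chainsAction (n : ℕ) : G →* AddMonoid.End ((chains G X).X n) where
  toFun g := ((FiltSpace.cellComplexFunctor.map (smulHom G X g)).f n).hom
  map_one' := by
    have : smulHom G X (1 : G) = 𝟙 _ :=
      FiltSpace.Hom.ext (ContinuousMap.ext fun x => one_smul G (show X from x))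
    rw [this, CategoryTheory.Functor.map_id]
    rfl
  map_mul' g h := by
    have : smulHom G X (g * h) = smulHom G X h ≫ smulHom G X g :=
      FiltSpace.Hom.ext (ContinuousMap.ext fun x => mul_smul g h (show X from x))
    rw [this, CategoryTheory.Functor.map_comp]
    rfl

theorem chainsAction_d (i j : ℕ) (g : G) (c : (chains G X).X i) :
    ((chains G X).d i j).hom (chainsAction G X i g c) =
      chainsAction G X j g (((chains G X).d i j).hom c) :=
  ConcreteCategory.congr_hom
    ((FiltSpace.cellComplexFunctor.map (smulHom G X g)).comm i j) c

/-- The complex of modules over the constant Green functor given by the fixed points of the cellular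
chain complex, `G/K ↦ C(X)^K`. -/
def constChains : ChainComplex (ConstModule G) ℕ where
  X n := fixedPointModule (chainsAction G X n)
  d i j := fixedPointModule.map ((chains G X).d i j).hom (chainsAction_d G X i j)
  shape i j h := by
    apply GreenModule.hom_ext
    intro S φ
    apply Subtype.ext
    funext s
    exact ConcreteCategory.congr_hom ((chains G X).shape i j h) (φ.1 s)
  d_comp_d' i j k _ _ := by
    apply GreenModule.hom_ext
    intro S φ
    apply Subtype.ext
    funext s
    exact ConcreteCategory.congr_hom ((chains G X).d_comp_d i j k) (φ.1 s)

/-- The homomorphism `C_n(Map_G(S, X)) → Map_G(S, C_n(X))`, `c ↦ (s ↦ (ev_s)_* c)`. For `S = G/K`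
it is the homomorphism `C_n(X^K) → C_n(X)^K` induced by the inclusion `X^K → X`. -/
def unitApp (n : ℕ) (S : FinGSet G) :
    (FiltSpace.cellComplexFunctor.obj (mapFilt G X S)).X n →+
      equivariantMaps (chainsAction G X n) S :=
  AddMonoidHom.mk'
    (fun c => ⟨fun s => ((FiltSpace.cellComplexFunctor.map (evalHom G X S s)).f n).hom c,
      fun g s => by
        have h := FiltSpace.cellComplexFunctor.map_comp (evalHom G X S s) (smulHom G X g)
        rw [← evalHom_smul] at h
        exact ConcreteCategory.congr_hom (congrArg (fun z => z.f n) h) c⟩)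
    (fun a b => Subtype.ext (funext fun s => map_add
      ((FiltSpace.cellComplexFunctor.map (evalHom G X S s)).f n).hom a b))

variable [Finite G]

/-- The canonical morphism from `C_G(X)` to the complex of coefficient systems underlying
`G/K ↦ C(X)^K`. At `G/K` it is the homomorphism `C(X^K) → C(X)^K` induced by the inclusion
`X^K → X`. -/
def unit : coeffChains G X ⟶
    ((GreenModule.toCoeff (constGreen G)).mapHomologicalComplex (ComplexShape.down ℕ)).obj
      (constChains G X) where
  f n :=
    { app := fun O => AddCommGrpCat.ofHom (unitApp G X n O.unop.orbit)
      naturality := fun O P f => by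
        ext c
        apply Subtype.ext
        funext s
        have h := FiltSpace.cellComplexFunctor.map_comp
          (precompHom G X (OrbitCat.incl.map f.unop)) (evalHom G X P.unop.orbit s)
        exact (ConcreteCategory.congr_hom (congrArg (fun z => z.f n) h) c).symm }
  comm' i j _ := by
    ext O c
    apply Subtype.ext
    funext s
    exact (ConcreteCategory.congr_hom
      ((FiltSpace.cellComplexFunctor.map (evalHom G X O.unop.orbit s)).comm i j) c)

end Chains

end GCWComplex

end

/-! The universal property is proved in each degree separately. If every `η_n` is universal among
morphisms from `C_G(X)_n` to underlying coefficient systems of modules, the components `ψ_n` exist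
and are unique, and they commute with the differentials because both composites solve the same
universal problem (`existsUnique_unit_comp`).

Topological input. Put `M = H_n(D^n, S^{n-1})`. Then `C_n(X)` is the direct sum of copies of `M`
indexed by the `n`-cells and permuted by `G` (`cellSum_bijective`), and `C_n(X^H)` is generated by
copies of `M` indexed by the `H`-fixed cells, that is, by equivariant maps from `G/H` to the set of
`n`-cells (`cellChains_mapFilt_hom_ext`). The group `M` need not be computed, and independence of
the cells is needed only for `X` itself. Both facts are instances of a statement about attaching
cells (`exists_sum_cellMap_char`, `eq_zero_of_sum_cellMap_char`). Its proof makes chains small by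
barycentric subdivision for the cover by the open cells and a collar of the lower skeleton, and then
stretches every cell radially by the factor two. The stretching is homotopic to the identity and
pushes the collar into the lower skeleton, so only simplices inside a single open cell survive
modulo that skeleton.

Algebraic input. Let `N` be the sum of copies of `M` over a `G`-set `J`. An equivariant map `x : S →
N` has coordinates on `S × F`, for a finite invariant `F ⊆ J`, and `x` is the transfer along `S × F
→ S` of an element with one nonzero index at each point (`tr_present_coord`). A module morphism is
therefore determined by its values on such elements, hence, by restriction to orbits, on the images
under `η` of the cells of fixed point spaces. Conversely, prescribed values on orbits over `J` glue
to all finite `G`-sets over `J`, because Mackey functors are additive (`gluesOrbits`), and `ψ(x)` is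
the transfer of the glued coordinates. What has to be shown is that `ψ(x)` does not depend on how
`x` is written as a transfer (`tr_glue_eq`). This reduces to gluing commuting with transfers
(`tr_glue`), which fails for general Mackey functors but holds for modules over the constant Green
functor by the projection formula `tr (a · res y) = tr a · y` (`tr_smulFun`). -/

noncomputable section


/-! ### Singular chains by generators -/

namespace Sing

open FiltSpace Simplicial Opposite

/-- Singular `k`-simplices of a space. -/
abbrev Simplex (k : ℕ) (X : Type*) [TopologicalSpace X] := C(stdSimplex ℝ (Fin (k + 1)), X)

/-- The group of singular `k`-chains. -/
abbrev Chain (k : ℕ) (X : TopCat.{u}) := (singularChains.obj X).X k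

/-- The chain given by a singular simplex. -/
def gen {k : ℕ} {X : TopCat.{u}} (σ : Simplex k X) : Chain k X :=
  ((TopCat.toSSet.obj X).ιChainComplex (R := AddCommGrpCat.of (ULift.{u} ℤ))
    ((TopCat.toSSetObjEquiv X (op ⦋k⦌)).symm σ)).hom ⟨1⟩

/-- The inclusion of the `i`-th face of the standard simplex. -/
def face {k : ℕ} (i : Fin (k + 2)) :
    C(stdSimplex ℝ (Fin (k + 1)), stdSimplex ℝ (Fin (k + 2))) :=
  ⟨stdSimplex.map i.succAbove, stdSimplex.continuous_map _⟩

/-- The differential of singular chains. -/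
abbrev bd {X : TopCat.{u}} (k : ℕ) : Chain (k + 1) X →+ Chain k X :=
  ((singularChains.obj X).d (k + 1) k).hom

/-- The map induced on singular chains. -/
abbrev push {X Y : TopCat.{u}} (f : X ⟶ Y) (k : ℕ) : Chain k X →+ Chain k Y :=
  ((singularChains.map f).f k).hom

theorem push_gen {X Y : TopCat.{u}} (f : X ⟶ Y) {k : ℕ} (σ : Simplex k X) :
    push f k (gen σ) = gen (f.hom.comp σ) := by
  have := SSet.ι_chainComplexMap_f _ _ (TopCat.toSSet.map f)
    (AddCommGrpCat.of (ULift.{u} ℤ)) ((TopCat.toSSetObjEquiv X (op ⦋k⦌)).symm σ)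
  exact ConcreteCategory.congr_hom this ⟨1⟩

theorem bd_gen {X : TopCat.{u}} {k : ℕ} (σ : Simplex (k + 1) X) :
    bd k (gen σ) = ∑ i : Fin (k + 2), (-1 : ℤ) ^ (i : ℕ) • gen (σ.comp (face i)) := by
  have := SSet.ιChainComplex_d (R := AddCommGrpCat.of (ULift.{u} ℤ))
    (X := TopCat.toSSet.obj X) ((TopCat.toSSetObjEquiv X (op ⦋k + 1⦌)).symm σ)
  have h2 := ConcreteCategory.congr_hom this ⟨1⟩
  refine h2.trans ?_
  exact map_sum ((AddMonoidHom.eval (⟨1⟩ : AddCommGrpCat.of (ULift.{u} ℤ))).comp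
    (AddCommGrpCat.homAddEquiv (M := AddCommGrpCat.of (ULift.{u} ℤ))
      (N := Chain k X)).toAddMonoidHom) _ _

/-- The chain group is a coproduct of copies of `ℤ` indexed by the singular simplices, and each copy
is generated by `1`. -/
theorem hom_ext {X : TopCat.{u}} {k : ℕ} {B : Type u} [AddCommGroup B] {f g : Chain k X →+ B}
    (h : ∀ σ : Simplex k X, f (gen σ) = g (gen σ)) : f = g := by
  have : AddCommGrpCat.ofHom f = AddCommGrpCat.ofHom g := by
    refine SSet.chainComplex_hom_ext fun x => ?_
    obtain ⟨σ, rfl⟩ := (TopCat.toSSetObjEquiv X (op ⦋k⦌)).symm.surjective x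
    refine AddCommGrpCat.hom_ext (AddMonoidHom.ext fun n => ?_)
    have hn : n = n.down • (⟨1⟩ : ULift.{u} ℤ) := ULift.ext _ _ (by simp)
    rw [hn, map_zsmul, map_zsmul]
    exact congrArg _ (h σ)
  exact congrArg AddCommGrpCat.Hom.hom this

/-- The homomorphism on singular chains with given values on the singular simplices. -/
def lift {X : TopCat.{u}} {k : ℕ} {B : Type u} [AddCommGroup B] (F : Simplex k X → B) :
    Chain k X →+ B :=
  AddCommGrpCat.Hom.hom (X := (singularChains.obj X).X k) (Y := AddCommGrpCat.of B)
  (Limits.Cofan.IsColimit.desc (SSet.isColimitChainComplexXCofan (TopCat.toSSet.obj X)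
    (AddCommGrpCat.of (ULift.{u} ℤ)) k) fun x => AddCommGrpCat.ofHom
      ((zmultiplesHom B (F (TopCat.toSSetObjEquiv X (op ⦋k⦌) x))).comp
        (AddEquiv.ulift : ULift.{u} ℤ ≃+ ℤ).toAddMonoidHom))

@[simp] theorem lift_gen {X : TopCat.{u}} {k : ℕ} {B : Type u} [AddCommGroup B]
    (F : Simplex k X → B) (σ : Simplex k X) : lift F (gen σ) = F σ := by
  have := Limits.Cofan.IsColimit.fac (SSet.isColimitChainComplexXCofan (TopCat.toSSet.obj X)
    (AddCommGrpCat.of (ULift.{u} ℤ)) k) (fun x => AddCommGrpCat.ofHom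
      ((zmultiplesHom B (F (TopCat.toSSetObjEquiv X (op ⦋k⦌) x))).comp
        (AddEquiv.ulift : ULift.{u} ℤ ≃+ ℤ).toAddMonoidHom))
    ((TopCat.toSSetObjEquiv X (op ⦋k⦌)).symm σ)
  refine (ConcreteCategory.congr_hom this ⟨1⟩).trans ?_
  change (1 : ℤ) • F _ = _
  rw [one_smul, Equiv.apply_symm_apply]

/-- The projection to the quotient by the closure kills every generator, so it vanishes. -/
theorem closure_gen {X : TopCat.{u}} {k : ℕ} :
    AddSubgroup.closure (Set.range (gen (X := X) (k := k))) = ⊤ := by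
  set H := AddSubgroup.closure (Set.range (gen (X := X) (k := k)))
  have : QuotientAddGroup.mk' H = 0 := hom_ext fun σ => by
    simpa using (AddSubgroup.subset_closure ⟨σ, rfl⟩ : gen σ ∈ H)
  rw [← QuotientAddGroup.ker_mk' H, this]
  exact AddMonoidHom.ker_zero

theorem bd_bd {X : TopCat.{u}} {k : ℕ} (c : Chain (k + 2) X) : bd k (bd (k + 1) c) = 0 :=
  ConcreteCategory.congr_hom ((singularChains.obj X).d_comp_d (k + 2) (k + 1) k) c

end Sing


/-! ### Tuples of points and barycentric subdivision -/

/-- The affine map between standard simplices with given values on the vertices. -/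
def stdSimplex.aff {κ ι : Type*} [Fintype κ] [Fintype ι] (v : κ → stdSimplex ℝ ι)
    (t : stdSimplex ℝ κ) : stdSimplex ℝ ι :=
  ⟨fun i => ∑ k, t k * v k i,
    fun i => Finset.sum_nonneg fun k _ => mul_nonneg (stdSimplex.zero_le t k) ((v k).2.1 i), by
      rw [Finset.sum_comm]
      simp_rw [← Finset.mul_sum, stdSimplex.sum_eq_one, mul_one]
      exact stdSimplex.sum_eq_one t⟩

namespace stdSimplex

section Aff

variable {κ ι l : Type*} [Fintype κ] [Fintype ι] [Fintype l]

theorem aff_apply (v : κ → stdSimplex ℝ ι) (t : stdSimplex ℝ κ) (i : ι) :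
    aff v t i = ∑ k, t k * v k i := rfl

theorem continuous_aff (v : κ → stdSimplex ℝ ι) : Continuous (aff v) := by
  refine Continuous.subtype_mk (continuous_pi fun i => continuous_finsetSum _ fun k _ => ?_) _
  exact ((continuous_apply k).comp continuous_subtype_val).mul continuous_const

theorem aff_aff (v : κ → stdSimplex ℝ ι) (w : l → stdSimplex ℝ κ) (t : stdSimplex ℝ l) :
    aff (fun j => aff v (w j)) t = aff v (aff w t) := by
  ext i
  simp only [aff_apply, Finset.mul_sum, Finset.sum_mul]
  rw [Finset.sum_comm]
  simp only [mul_assoc]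

theorem aff_vertex [DecidableEq κ] (t : stdSimplex ℝ κ) :
    aff (fun k => vertex (S := ℝ) k) t = t := by
  ext i
  simp [aff_apply, Pi.single_apply]

theorem aff_apply_vertex [DecidableEq κ] (v : κ → stdSimplex ℝ ι) (k : κ) :
    aff v (vertex k) = v k := by
  ext i
  simp [aff_apply, Pi.single_apply]

theorem aff_comp [DecidableEq κ] [DecidableEq l] (v : κ → stdSimplex ℝ ι) (f : l → κ)
    (t : stdSimplex ℝ l) : aff (fun j => v (f j)) t = aff v (map f t) := by
  have h : map f t = aff (fun j => vertex (S := ℝ) (f j)) t := by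
    ext i
    simp [aff_apply, Pi.single_apply, FunOnFinite.linearMap_apply_apply, Finset.sum_filter, eq_comm]
  rw [h, ← aff_aff]
  simp only [aff_apply_vertex]

/-- The weights `t k` sum to one, so each coordinate of `x - aff v t` is the convex combination of
the coordinates of `x - v k`; the metric is the supremum metric. -/
theorem dist_aff_le (x : stdSimplex ℝ ι) (v : κ → stdSimplex ℝ ι) (t : stdSimplex ℝ κ) :
    dist x (aff v t) ≤ ∑ k, t k * dist x (v k) := by
  rw [Subtype.dist_eq, dist_pi_le_iff (Finset.sum_nonneg fun k _ =>
    mul_nonneg (stdSimplex.zero_le t k) dist_nonneg)]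
  intro i
  have h : x i - aff v t i = ∑ k, t k * (x i - v k i) := by
    simp_rw [mul_sub, Finset.sum_sub_distrib, ← Finset.sum_mul, stdSimplex.sum_eq_one, one_mul]
    rfl
  change |x i - aff v t i| ≤ _
  rw [h]
  refine (Finset.abs_sum_le_sum_abs _ _).trans (Finset.sum_le_sum fun k _ => ?_)
  rw [abs_mul, abs_of_nonneg (stdSimplex.zero_le t k)]
  exact mul_le_mul_of_nonneg_left (dist_le_pi_dist x.1 (v k).1 i) (stdSimplex.zero_le t k)

theorem dist_aff_le_of_forall (x : stdSimplex ℝ ι) (v : κ → stdSimplex ℝ ι) (t : stdSimplex ℝ κ)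
    {r : ℝ} (h : ∀ k, dist x (v k) ≤ r) : dist x (aff v t) ≤ r :=
  (dist_aff_le x v t).trans <| calc
    _ ≤ ∑ k, t k * r :=
      Finset.sum_le_sum fun k _ => mul_le_mul_of_nonneg_left (h k) (stdSimplex.zero_le t k)
    _ = r := by rw [← Finset.sum_mul, stdSimplex.sum_eq_one, one_mul]

end Aff

end stdSimplex

namespace Tup

open stdSimplex

/-- Formal combinations of `n`-tuples of points of `V`. -/
abbrev _root_.Tup (n : ℕ) (V : Type) := FreeAbelianGroup (Fin n → V)

variable {V W : Type}

/-- Adding a point in front of a tuple. -/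
def cone (b : V) {n : ℕ} : Tup n V →+ Tup (n + 1) V := FreeAbelianGroup.map fun v => Fin.cons b v

@[simp] theorem cone_of (b : V) {n : ℕ} (v : Fin n → V) :
    cone b (.of v) = .of (Fin.cons b v : Fin (n + 1) → V) := FreeAbelianGroup.map_of_apply _

/-- The (augmented) differential on tuples. -/
def d : ∀ n, Tup (n + 1) V →+ Tup n V
  | 0 => FreeAbelianGroup.lift fun v => .of (Fin.tail v)
  | n + 1 => FreeAbelianGroup.lift fun v => .of (Fin.tail v) - cone (v 0) (d n (.of (Fin.tail v)))

theorem d_succ_of {n : ℕ} (v : Fin (n + 2) → V) :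
    d (n + 1) (.of v) = .of (Fin.tail v) - cone (v 0) (d n (.of (Fin.tail v))) :=
  FreeAbelianGroup.lift_apply_of _ _

theorem d_cone_zero (b : V) (c : Tup 0 V) : d 0 (cone b c) = c := by
  have : (d 0).comp (cone b) = AddMonoidHom.id _ := FreeAbelianGroup.lift_ext _ _ fun v => by
    simp [d]
  exact DFunLike.congr_fun this c

/-- Coning is a contracting homotopy of the augmented complex. Together with the recursive
definition of `d` this makes the identities for `d`, `sd` and `sdHomotopy` formal. An `n`-tuple is a
simplex of dimension `n - 1`. -/
theorem d_cone (b : V) {n : ℕ} (c : Tup (n + 1) V) : d (n + 1) (cone b c) = c - cone b (d n c) := by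
  have : (d (n + 1)).comp (cone b) = AddMonoidHom.id _ - (cone b).comp (d n) :=
    FreeAbelianGroup.lift_ext _ _ fun v => by simp [d]
  exact DFunLike.congr_fun this c

theorem d_d {n : ℕ} (c : Tup (n + 2) V) : d n (d (n + 1) c) = 0 := by
  induction n with
  | zero =>
    have : (d 0).comp (d 1) = (0 : Tup 2 V →+ Tup 0 V) := FreeAbelianGroup.lift_ext _ _ fun v => by
      simp only [AddMonoidHom.comp_apply]
      rw [d_succ_of, map_sub, d_cone_zero, sub_self]; rfl
    exact DFunLike.congr_fun this c
  | succ n ih =>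
    have : (d (n + 1)).comp (d (n + 2)) = (0 : Tup (n + 3) V →+ Tup (n + 1) V) :=
      FreeAbelianGroup.lift_ext _ _ fun v => by
        simp only [AddMonoidHom.comp_apply]
        rw [d_succ_of, map_sub, d_cone, ih, map_zero, sub_zero,
          sub_self]; rfl
    exact DFunLike.congr_fun this c

/-- The recursion agrees with the usual alternating sum: omitting the first point gives the tail,
and every other face is the cone, with apex the first point, over a face of the tail. -/
theorem d_of {n : ℕ} (v : Fin (n + 1) → V) :
    d n (.of v) = ∑ i : Fin (n + 1), (-1 : ℤ) ^ (i : ℕ) • .of (v ∘ i.succAbove) := by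
  induction n with
  | zero => simp [d]; rfl
  | succ n ih =>
    rw [d_succ_of, ih, map_sum, Fin.sum_univ_succ (n := n + 1), sub_eq_add_neg]
    refine congrArg₂ (· + ·) ?_ ?_
    · simp
      rfl
    · rw [← Finset.sum_neg_distrib]
      refine Finset.sum_congr rfl fun i _ => ?_
      rw [map_zsmul, cone_of, Fin.val_succ, pow_succ, mul_neg_one, neg_smul]
      congr 3
      ext j
      refine Fin.cases ?_ (fun j => ?_) j
      · simp
      · simp [Fin.tail]

/-- The map induced on tuples by a map of sets. -/
abbrev map (f : V → W) (n : ℕ) : Tup n V →+ Tup n W := FreeAbelianGroup.map fun v => f ∘ v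

theorem map_cone (f : V → W) (b : V) {n : ℕ} (c : Tup n V) :
    map f (n + 1) (cone b c) = cone (f b) (map f n c) := by
  have : (map f (n + 1)).comp (cone b) = (cone (f b)).comp (map f n) :=
    FreeAbelianGroup.lift_ext _ _ fun v => by
      simp only [AddMonoidHom.comp_apply, cone_of, FreeAbelianGroup.map_of_apply]
      congr 1
      ext j
      refine Fin.cases ?_ (fun j => ?_) j <;> simp
  exact DFunLike.congr_fun this c

theorem map_d (f : V → W) {n : ℕ} (c : Tup (n + 1) V) :
    map f n (d n c) = d n (map f (n + 1) c) := by
  have : (map f n).comp (d n) = (d n).comp (map f (n + 1)) :=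
    FreeAbelianGroup.lift_ext _ _ fun v => by
      simp only [AddMonoidHom.comp_apply, FreeAbelianGroup.map_of_apply, d_of, map_sum, map_zsmul]
      rfl
  exact DFunLike.congr_fun this c

section Subdivision

variable {ι κ : Type} [Fintype ι] [Fintype κ]

/-- The barycenter of a nonempty tuple. -/
def bary {n : ℕ} (v : Fin (n + 1) → stdSimplex ℝ ι) : stdSimplex ℝ ι := aff v barycenter

/-- Barycentric subdivision. -/
def sd : ∀ n, Tup n (stdSimplex ℝ ι) →+ Tup n (stdSimplex ℝ ι)
  | 0 => AddMonoidHom.id _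
  | n + 1 => FreeAbelianGroup.lift fun v => cone (bary v) (sd n (d n (.of v)))

/-- The homotopy from the identity to the barycentric subdivision. -/
def sdHomotopy : ∀ n, Tup n (stdSimplex ℝ ι) →+ Tup (n + 1) (stdSimplex ℝ ι)
  | 0 => 0
  | n + 1 => FreeAbelianGroup.lift fun v => cone (bary v) (.of v - sdHomotopy n (d n (.of v)))

theorem sd_of {n : ℕ} (v : Fin (n + 1) → stdSimplex ℝ ι) :
    sd (n + 1) (.of v) = cone (bary v) (sd n (d n (.of v))) :=
  FreeAbelianGroup.lift_apply_of _ _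

theorem sdHomotopy_of {n : ℕ} (v : Fin (n + 1) → stdSimplex ℝ ι) :
    sdHomotopy (n + 1) (.of v) = cone (bary v) (.of v - sdHomotopy n (d n (.of v))) :=
  FreeAbelianGroup.lift_apply_of _ _

/-- By the cone formula, the boundary of the cone over `sd (d v)` is `sd (d v)` minus the cone over
`d (sd (d v))`, and the latter is `sd (d (d v)) = 0` by induction. -/
theorem d_sd {n : ℕ} (c : Tup (n + 1) (stdSimplex ℝ ι)) : d n (sd (n + 1) c) = sd n (d n c) := by
  induction n with
  | zero =>
    have : (d 0).comp (sd 1) = (sd 0).comp (d (V := stdSimplex ℝ ι) 0) :=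
      FreeAbelianGroup.lift_ext _ _ fun v => by
        simp only [AddMonoidHom.comp_apply]
        rw [sd_of, d_cone_zero]
    exact DFunLike.congr_fun this c
  | succ n ih =>
    have : (d (n + 1)).comp (sd (n + 2)) = (sd (n + 1)).comp (d (V := stdSimplex ℝ ι) (n + 1)) :=
      FreeAbelianGroup.lift_ext _ _ fun v => by
        simp only [AddMonoidHom.comp_apply]
        rw [sd_of, d_cone, ih, d_d, map_zero, map_zero, sub_zero]
    exact DFunLike.congr_fun this c

theorem d_sdHomotopy {n : ℕ} (c : Tup (n + 1) (stdSimplex ℝ ι)) :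
    d (n + 1) (sdHomotopy (n + 1) c) = c - sd (n + 1) c - sdHomotopy n (d n c) := by
  induction n with
  | zero =>
    have : (d 1).comp (sdHomotopy 1) = AddMonoidHom.id _ - sd 1 -
        (sdHomotopy 0).comp (d (V := stdSimplex ℝ ι) 0) :=
      FreeAbelianGroup.lift_ext _ _ fun v => by
        simp only [AddMonoidHom.comp_apply, AddMonoidHom.sub_apply, AddMonoidHom.id_apply]
        rw [sdHomotopy_of, d_cone, sdHomotopy, sd_of, sd]
        simp
    exact DFunLike.congr_fun this c
  | succ n ih =>
    have : (d (n + 2)).comp (sdHomotopy (n + 2)) = AddMonoidHom.id _ - sd (n + 2) -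
        (sdHomotopy (n + 1)).comp (d (V := stdSimplex ℝ ι) (n + 1)) :=
      FreeAbelianGroup.lift_ext _ _ fun v => by
        simp only [AddMonoidHom.comp_apply, AddMonoidHom.sub_apply, AddMonoidHom.id_apply]
        rw [sdHomotopy_of, d_cone, map_sub (d (n + 1)), ih, d_d,
          map_zero, sub_zero, sd_of]
        rw [sub_sub_cancel]
        abel
    exact DFunLike.congr_fun this c

theorem bary_aff {n : ℕ} (u : κ → stdSimplex ℝ ι) (v : Fin (n + 1) → stdSimplex ℝ κ) :
    bary (aff u ∘ v) = aff u (bary v) := aff_aff u v _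

/-- Affine maps preserve barycenters. This naturality is what carries subdivision from tuples of
points to singular chains. -/
theorem map_sd (u : κ → stdSimplex ℝ ι) {n : ℕ} (c : Tup n (stdSimplex ℝ κ)) :
    map (aff u) n (sd n c) = sd n (map (aff u) n c) := by
  induction n with
  | zero => rfl
  | succ n ih =>
    have : (map (aff u) (n + 1)).comp (sd (n + 1)) = (sd (n + 1)).comp (map (aff u) (n + 1)) :=
      FreeAbelianGroup.lift_ext _ _ fun v => by
        simp only [AddMonoidHom.comp_apply]
        rw [sd_of, map_cone, ih, map_d, FreeAbelianGroup.map_of_apply,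
          sd_of, bary_aff]
    exact DFunLike.congr_fun this c

theorem map_sdHomotopy (u : κ → stdSimplex ℝ ι) {n : ℕ} (c : Tup n (stdSimplex ℝ κ)) :
    map (aff u) (n + 1) (sdHomotopy n c) = sdHomotopy n (map (aff u) n c) := by
  induction n with
  | zero => simp [sdHomotopy]
  | succ n ih =>
    have : (map (aff u) (n + 2)).comp (sdHomotopy (n + 1)) =
        (sdHomotopy (n + 1)).comp (map (aff u) (n + 1)) :=
      FreeAbelianGroup.lift_ext _ _ fun v => by
        simp only [AddMonoidHom.comp_apply]
        rw [sdHomotopy_of, map_cone, map_sub, ih, map_d,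
          FreeAbelianGroup.map_of_apply, sdHomotopy_of, bary_aff]
    exact DFunLike.congr_fun this c

/-- The subgroup generated by tuples in the hull of `v` whose points have pairwise distances at
most `r`. -/
def fine {m : ℕ} (v : Fin m → stdSimplex ℝ ι) (n : ℕ) (r : ℝ) :
    AddSubgroup (Tup n (stdSimplex ℝ ι)) :=
  AddSubgroup.closure (FreeAbelianGroup.of ''
    {w | (∀ i, w i ∈ Set.range (aff v)) ∧ ∀ i j, dist (w i) (w j) ≤ r})

theorem dist_bary_le {n : ℕ} (v : Fin (n + 1) → stdSimplex ℝ ι) {r : ℝ}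
    (hv : ∀ i j, dist (v i) (v j) ≤ r) (i : Fin (n + 1)) :
    dist (v i) (bary v) ≤ n / (n + 1) * r := by
  refine (dist_aff_le _ _ _).trans ?_
  -- The summand of `v i` itself vanishes; the other `n` summands have weight `1 / (n + 1)`, which
  -- gives the factor `n / (n + 1)`.
  rw [Fin.sum_univ_succAbove _ i, dist_self, mul_zero, zero_add]
  calc _ ≤ ∑ j : Fin n, ((n : ℝ) + 1)⁻¹ * r := Finset.sum_le_sum fun j _ => by
        have : (barycenter : stdSimplex ℝ (Fin (n + 1))) (i.succAbove j) = ((n : ℝ) + 1)⁻¹ := by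
          refine (barycenter_apply _).trans ?_
          simp
        rw [this]
        exact mul_le_mul_of_nonneg_left (hv _ _) (by positivity)
    _ = _ := by simp; ring

/-- Recursion over the faces: the tuples in the subdivision are cones from the barycenter over
tuples in the subdivided faces. The former distances are bounded by `dist_bary_le` and convexity,
the latter by the statement for the faces. -/
theorem sd_mem_fine {n : ℕ} (v : Fin (n + 1) → stdSimplex ℝ ι) {r : ℝ}
    (hv : ∀ i j, dist (v i) (v j) ≤ r) : sd (n + 1) (.of v) ∈ fine v (n + 1) (n / (n + 1) * r) := by
  have hr : 0 ≤ r := dist_nonneg.trans (hv 0 0)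
  have key : ∀ c ∈ fine v n (n / (n + 1) * r), cone (bary v) c ∈ fine v (n + 1) (n / (n + 1) * r) := by
    intro c hc
    have : fine v n (n / (n + 1) * r) ≤ (fine v (n + 1) (n / (n + 1) * r)).comap (cone (bary v)) := by
      refine (AddSubgroup.closure_le _).2 ?_
      rintro _ ⟨w, ⟨hw, hw'⟩, rfl⟩
      have hb : ∀ i, dist (bary v) (w i) ≤ n / (n + 1) * r := fun i => by
        obtain ⟨t, ht⟩ := hw i
        rw [← ht]
        exact dist_aff_le_of_forall _ _ _ fun k => by
          rw [dist_comm]; exact dist_bary_le v hv k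
      refine AddSubgroup.subset_closure ⟨_, ⟨?_, ?_⟩, (cone_of _ _).symm⟩
      · intro i
        refine Fin.cases ⟨_, rfl⟩ (fun i => ?_) i
        simpa using hw i
      · intro i j
        refine Fin.cases ?_ (fun i => ?_) i <;> refine Fin.cases ?_ (fun j => ?_) j
        · simp; positivity
        · simpa using hb j
        · simpa [dist_comm] using hb i
        · simpa using hw' i j
    exact this hc
  rw [sd_of]
  refine key _ ?_
  cases n with
  | zero =>
    rw [sd, AddMonoidHom.id_apply]
    -- The empty tuple satisfies the conditions vacuously.
    have h : ∀ c : Tup 0 (stdSimplex ℝ ι), c ∈ fine v 0 (((0 : ℕ) : ℝ) / ((0 : ℕ) + 1) * r) := by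
      intro c
      induction c using FreeAbelianGroup.induction_on with
      | zero => exact zero_mem _
      | of w => exact AddSubgroup.subset_closure ⟨w, ⟨fun i => i.elim0, fun i => i.elim0⟩, rfl⟩
      | neg w h => exact neg_mem h
      | add a b ha hb => exact add_mem ha hb
    exact h _
  | succ n =>
    rw [d_of, map_sum]
    refine sum_mem fun i _ => ?_
    rw [map_zsmul]
    refine zsmul_mem ?_ _
    have h1 := sd_mem_fine (v ∘ i.succAbove) (r := r) fun _ _ => hv _ _
    refine (AddSubgroup.closure_mono (Set.image_mono ?_)) h1
    rintro w ⟨hw, hw'⟩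
    refine ⟨fun j => ?_, fun a b => (hw' a b).trans (mul_le_mul_of_nonneg_right ?_ hr)⟩
    · obtain ⟨t, ht⟩ := hw j
      exact ⟨stdSimplex.map i.succAbove t, by rw [← ht, ← aff_comp]; rfl⟩
    -- The contraction factor of the faces is at most that of the simplex, since `n / (n + 1)`
    -- increases with `n`.
    · rw [div_le_div_iff₀ (by positivity) (by positivity)]
      push_cast
      nlinarith

theorem iterate_sd_mem_fine {n m : ℕ} (u : Fin m → stdSimplex ℝ ι) {r : ℝ} {c : Tup (n + 1) _}
    (hc : c ∈ fine u (n + 1) r) (N : ℕ) :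
    (sd (n + 1))^[N] c ∈ fine u (n + 1) ((n / (n + 1)) ^ N * r) := by
  induction N with
  | zero => simpa using hc
  | succ N ih =>
    rw [Function.iterate_succ_apply', pow_succ', mul_assoc]
    set r' := ((n : ℝ) / (n + 1)) ^ N * r
    have : fine u (n + 1) r' ≤ (fine u (n + 1) (n / (n + 1) * r')).comap (sd (n + 1)) := by
      refine (AddSubgroup.closure_le _).2 ?_
      rintro _ ⟨v, ⟨hv, hv'⟩, rfl⟩
      refine (AddSubgroup.closure_mono (Set.image_mono ?_)) (sd_mem_fine v hv')
      rintro w ⟨hw, hw'⟩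
      refine ⟨fun j => ?_, hw'⟩
      obtain ⟨t, ht⟩ := hw j
      -- The hull of points of the hull of `u` is contained in the hull of `u`.
      choose s hs using hv
      exact ⟨aff s t, by rw [← ht, ← aff_aff]; congr 1; exact funext hs⟩
    exact this ih

end Subdivision

end Tup


/-! ### Small singular chains -/

namespace Sing

open stdSimplex FiltSpace

variable {X Y : TopCat.{u}}

/-- The affine map between standard simplices as a continuous map. -/
def affMap {m n : ℕ} (v : Fin n → stdSimplex ℝ (Fin m)) :
    C(stdSimplex ℝ (Fin n), stdSimplex ℝ (Fin m)) := ⟨aff v, continuous_aff v⟩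

/-- The singular chain in `X` given by a singular simplex `σ` and a combination of tuples of
points of its domain. -/
def realize {m : ℕ} (σ : Simplex m X) (n : ℕ) :
    Tup (n + 1) (stdSimplex ℝ (Fin (m + 1))) →+ Chain n X :=
  FreeAbelianGroup.lift fun v => gen (σ.comp (affMap v))

theorem realize_of {m : ℕ} (σ : Simplex m X) {n : ℕ}
    (v : Fin (n + 1) → stdSimplex ℝ (Fin (m + 1))) :
    realize σ n (.of v) = gen (σ.comp (affMap v)) := FreeAbelianGroup.lift_apply_of _ _

theorem bd_realize {m : ℕ} (σ : Simplex m X) {n : ℕ}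
    (c : Tup (n + 2) (stdSimplex ℝ (Fin (m + 1)))) :
    bd n (realize σ (n + 1) c) = realize σ n (Tup.d (n + 1) c) := by
  have : (bd n).comp (realize σ (n + 1)) = (realize σ n).comp (Tup.d (n + 1)) :=
    FreeAbelianGroup.lift_ext _ _ fun v => by
      simp only [AddMonoidHom.comp_apply, realize_of, Tup.d_of, map_sum, map_zsmul, bd_gen]
      refine Finset.sum_congr rfl fun i _ => congrArg _ (congrArg gen ?_)
      ext t
      exact congrArg σ (aff_comp v i.succAbove t).symm
  exact DFunLike.congr_fun this c

theorem realize_comp_affMap {l m : ℕ} (σ : Simplex m X)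
    (w : Fin (l + 1) → stdSimplex ℝ (Fin (m + 1))) {n : ℕ}
    (c : Tup (n + 1) (stdSimplex ℝ (Fin (l + 1)))) :
    realize (σ.comp (affMap w)) n c = realize σ n (Tup.map (aff w) (n + 1) c) := by
  have : realize (σ.comp (affMap w)) n = (realize σ n).comp (Tup.map (aff w) (n + 1)) :=
    FreeAbelianGroup.lift_ext _ _ fun v => by
      simp only [AddMonoidHom.comp_apply, realize_of, FreeAbelianGroup.map_of_apply]
      refine congrArg gen ?_
      ext t
      exact congrArg σ (aff_aff w v t).symm
  exact DFunLike.congr_fun this c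

/-- The tuple of vertices of the standard simplex. -/
def vertices (n : ℕ) : Fin (n + 1) → stdSimplex ℝ (Fin (n + 1)) := fun i => vertex i

theorem realize_vertices {n : ℕ} (σ : Simplex n X) : realize σ n (.of (vertices n)) = gen σ := by
  rw [realize_of]
  refine congrArg gen ?_
  ext t
  exact congrArg σ (aff_vertex t)

theorem map_aff_vertices {l n : ℕ} (w : Fin (n + 1) → stdSimplex ℝ (Fin l)) :
    Tup.map (aff w) (n + 1) (.of (vertices n)) = .of w := by
  rw [FreeAbelianGroup.map_of_apply]
  exact congrArg _ (funext fun i => aff_apply_vertex w i)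

/-- Barycentric subdivision of singular chains. -/
def subdiv (X : TopCat.{u}) (n : ℕ) : Chain n X →+ Chain n X :=
  lift fun σ => realize σ n (Tup.sd (n + 1) (.of (vertices n)))

/-- The natural homotopy from the identity to the barycentric subdivision. -/
def subdivHomotopy (X : TopCat.{u}) (n : ℕ) : Chain n X →+ Chain (n + 1) X :=
  lift fun σ => realize σ (n + 1) (Tup.sdHomotopy (n + 1) (.of (vertices n)))

/-- Subdivision of singular chains is defined on the tuple of vertices only; naturality under affine
maps extends the formula to all tuples, so identities for `Tup.sd` pass to `subdiv`. -/
theorem subdiv_realize {m : ℕ} (σ : Simplex m X) {n : ℕ}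
    (c : Tup (n + 1) (stdSimplex ℝ (Fin (m + 1)))) :
    subdiv X n (realize σ n c) = realize σ n (Tup.sd (n + 1) c) := by
  have : (subdiv X n).comp (realize σ n) = (realize σ n).comp (Tup.sd (n + 1)) :=
    FreeAbelianGroup.lift_ext _ _ fun v => by
      simp only [AddMonoidHom.comp_apply]
      rw [realize_of, subdiv, lift_gen, realize_comp_affMap, Tup.map_sd, map_aff_vertices]
  exact DFunLike.congr_fun this c

theorem subdivHomotopy_realize {m : ℕ} (σ : Simplex m X) {n : ℕ}
    (c : Tup (n + 1) (stdSimplex ℝ (Fin (m + 1)))) :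
    subdivHomotopy X n (realize σ n c) = realize σ (n + 1) (Tup.sdHomotopy (n + 1) c) := by
  have : (subdivHomotopy X n).comp (realize σ n) =
      (realize σ (n + 1)).comp (Tup.sdHomotopy (n + 1)) :=
    FreeAbelianGroup.lift_ext _ _ fun v => by
      simp only [AddMonoidHom.comp_apply]
      rw [realize_of, subdivHomotopy, lift_gen, realize_comp_affMap, Tup.map_sdHomotopy,
        map_aff_vertices]
  exact DFunLike.congr_fun this c

theorem bd_subdiv {n : ℕ} (c : Chain (n + 1) X) :
    bd n (subdiv X (n + 1) c) = subdiv X n (bd n c) := by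
  have : (bd n).comp (subdiv X (n + 1)) = (subdiv X n).comp (bd n) := hom_ext fun σ => by
    simp only [AddMonoidHom.comp_apply]
    rw [← realize_vertices σ, subdiv_realize, bd_realize, Tup.d_sd, bd_realize, subdiv_realize]
  exact DFunLike.congr_fun this c

theorem bd_subdivHomotopy {n : ℕ} (c : Chain (n + 1) X) :
    bd (n + 1) (subdivHomotopy X (n + 1) c) =
      c - subdiv X (n + 1) c - subdivHomotopy X n (bd n c) := by
  have : (bd (n + 1)).comp (subdivHomotopy X (n + 1)) =
      AddMonoidHom.id _ - subdiv X (n + 1) - (subdivHomotopy X n).comp (bd n) := hom_ext fun σ => by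
    simp only [AddMonoidHom.comp_apply, AddMonoidHom.sub_apply, AddMonoidHom.id_apply]
    rw [← realize_vertices σ, subdivHomotopy_realize, bd_realize, Tup.d_sdHomotopy,
      subdiv_realize, bd_realize, subdivHomotopy_realize, map_sub, map_sub]
  exact DFunLike.congr_fun this c

/-- The singular chains generated by the simplices contained in a member of the family `𝒰`. -/
def smallChains (𝒰 : Set (Set X)) (k : ℕ) : AddSubgroup (Chain k X) :=
  AddSubgroup.closure (gen '' {σ | ∃ U ∈ 𝒰, Set.range σ ⊆ U})

variable {𝒰 : Set (Set X)}

theorem gen_mem_smallChains {k : ℕ} {σ : Simplex k X} {U : Set X} (hU : U ∈ 𝒰)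
    (hσ : Set.range σ ⊆ U) : gen σ ∈ smallChains 𝒰 k :=
  AddSubgroup.subset_closure ⟨σ, ⟨U, hU, hσ⟩, rfl⟩

theorem realize_mem_smallChains {m : ℕ} {σ : Simplex m X} {U : Set X} (hU : U ∈ 𝒰)
    (hσ : Set.range σ ⊆ U) {n : ℕ} (c : Tup (n + 1) (stdSimplex ℝ (Fin (m + 1)))) :
    realize σ n c ∈ smallChains 𝒰 n := by
  have h : ∀ v, realize σ n (.of v) ∈ smallChains 𝒰 n := fun v => by
    rw [realize_of]
    refine gen_mem_smallChains hU ?_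
    rintro _ ⟨t, rfl⟩
    exact hσ ⟨_, rfl⟩
  induction c using FreeAbelianGroup.induction_on with
  | zero => rw [map_zero]; exact zero_mem _
  | of v => exact h v
  | neg v _ => rw [map_neg]; exact neg_mem (h v)
  | add a b ha hb => rw [map_add]; exact add_mem ha hb

theorem subdiv_mem_smallChains {k : ℕ} {c : Chain k X} (hc : c ∈ smallChains 𝒰 k) :
    subdiv X k c ∈ smallChains 𝒰 k := by
  have : smallChains 𝒰 k ≤ (smallChains 𝒰 k).comap (subdiv X k) := by
    refine (AddSubgroup.closure_le _).2 ?_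
    rintro _ ⟨σ, ⟨U, hU, hσ⟩, rfl⟩
    rw [SetLike.mem_coe, AddSubgroup.mem_comap, subdiv, lift_gen]
    exact realize_mem_smallChains hU hσ _
  exact this hc

theorem subdivHomotopy_mem_smallChains {k : ℕ} {c : Chain k X} (hc : c ∈ smallChains 𝒰 k) :
    subdivHomotopy X k c ∈ smallChains 𝒰 (k + 1) := by
  have : smallChains 𝒰 k ≤ (smallChains 𝒰 (k + 1)).comap (subdivHomotopy X k) := by
    refine (AddSubgroup.closure_le _).2 ?_
    rintro _ ⟨σ, ⟨U, hU, hσ⟩, rfl⟩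
    rw [SetLike.mem_coe, AddSubgroup.mem_comap, subdivHomotopy, lift_gen]
    exact realize_mem_smallChains hU hσ _
  exact this hc

theorem iterate_subdiv_gen {k : ℕ} (σ : Simplex k X) (N : ℕ) :
    (subdiv X k)^[N] (gen σ) = realize σ k ((Tup.sd (k + 1))^[N] (.of (vertices k))) := by
  induction N with
  | zero => exact (realize_vertices σ).symm
  | succ N ih => rw [Function.iterate_succ_apply', ih, subdiv_realize, Function.iterate_succ_apply']

/-- Pulling the cover back to the standard simplex gives a Lebesgue number, and iterated subdivision
makes the tuples smaller than it. -/
theorem exists_iterate_subdiv_gen_mem (ho : ∀ U ∈ 𝒰, IsOpen U) (hc : ⋃₀ 𝒰 = Set.univ) {k : ℕ}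
    (σ : Simplex k X) : ∃ N, (subdiv X k)^[N] (gen σ) ∈ smallChains 𝒰 k := by
  obtain ⟨δ, hδ, h⟩ := lebesgue_number_lemma_of_metric_sUnion
    (s := (Set.univ : Set (stdSimplex ℝ (Fin (k + 1))))) (c := (fun U => σ ⁻¹' U) '' 𝒰)
    isCompact_univ (by
      rintro _ ⟨U, hU, rfl⟩
      exact (ho U hU).preimage σ.continuous) (by
      intro t _
      obtain ⟨U, hU, ht⟩ := (hc ▸ Set.mem_univ (σ t) : σ t ∈ ⋃₀ 𝒰)
      exact ⟨_, ⟨U, hU, rfl⟩, ht⟩)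
  set D := Metric.diam (Set.univ : Set (stdSimplex ℝ (Fin (k + 1))))
  -- After `N` subdivisions the distances are at most `(k / (k + 1)) ^ N * D`, with `D` the diameter
  -- of the simplex.
  have hlim := (tendsto_pow_atTop_nhds_zero_of_lt_one (r := (k : ℝ) / (k + 1)) (by positivity)
    ((div_lt_one (by positivity)).2 (by linarith))).mul_const D
  rw [zero_mul] at hlim
  obtain ⟨N, hN⟩ := (hlim.eventually (gt_mem_nhds hδ)).exists
  refine ⟨N, ?_⟩
  rw [iterate_subdiv_gen]
  have h0 : .of (vertices k) ∈ Tup.fine (vertices k) (k + 1) D :=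
    AddSubgroup.subset_closure ⟨_, ⟨fun i => ⟨vertices k i, aff_vertex _⟩, fun i j =>
      Metric.dist_le_diam_of_mem isCompact_univ.isBounded (Set.mem_univ _) (Set.mem_univ _)⟩, rfl⟩
  have h1 : Tup.fine (vertices k) (k + 1) ((k / (k + 1)) ^ N * D) ≤
      (smallChains 𝒰 k).comap (realize σ k) := by
    refine (AddSubgroup.closure_le _).2 ?_
    rintro _ ⟨w, ⟨-, hw⟩, rfl⟩
    rw [SetLike.mem_coe, AddSubgroup.mem_comap, realize_of]
    -- The hull of a fine tuple lies in the ball of radius `δ` around its first point, hence in one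
    -- member of the pulled back cover.
    obtain ⟨_, ⟨U, hU, rfl⟩, hb⟩ := h (w 0) (Set.mem_univ _)
    refine gen_mem_smallChains hU ?_
    rintro _ ⟨t, rfl⟩
    refine hb ?_
    rw [Metric.mem_ball, dist_comm]
    exact (dist_aff_le_of_forall (w 0) w t fun i => hw 0 i).trans_lt hN
  exact h1 (Tup.iterate_sd_mem_fine _ h0 N)

theorem exists_iterate_subdiv_mem (ho : ∀ U ∈ 𝒰, IsOpen U) (hc : ⋃₀ 𝒰 = Set.univ) {k : ℕ}
    (c : Chain k X) : ∃ N, (subdiv X k)^[N] c ∈ smallChains 𝒰 k := by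
  -- Further subdivision keeps a chain small, so the exponents found for two summands may be
  -- replaced by their sum.
  have hstep : ∀ {c : Chain k X} {N : ℕ} (M : ℕ), (subdiv X k)^[N] c ∈ smallChains 𝒰 k →
      (subdiv X k)^[M + N] c ∈ smallChains 𝒰 k := fun {c N} M h => by
    induction M with
    | zero => simpa using h
    | succ M ih =>
      rw [Nat.succ_add, Function.iterate_succ_apply']
      exact subdiv_mem_smallChains ih
  have hc' : c ∈ AddSubgroup.closure (Set.range (gen (X := X) (k := k))) := by
    rw [closure_gen]; trivial
  induction hc' using AddSubgroup.closure_induction with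
  | mem x hx =>
    obtain ⟨σ, rfl⟩ := hx
    exact exists_iterate_subdiv_gen_mem ho hc σ
  | zero => exact ⟨0, zero_mem _⟩
  | add a b _ _ ha hb =>
    obtain ⟨N, hN⟩ := ha
    obtain ⟨M, hM⟩ := hb
    refine ⟨M + N, ?_⟩
    rw [iterate_map_add]
    exact add_mem (hstep M hN) (by rw [add_comm]; exact hstep N hM)
  | neg a _ ha =>
    obtain ⟨N, hN⟩ := ha
    exact ⟨N, by rw [iterate_map_neg]; exact neg_mem hN⟩

theorem gen_zero_mem_smallChains (hc : ⋃₀ 𝒰 = Set.univ) (c : Chain 0 X) :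
    c ∈ smallChains 𝒰 0 := by
  have hc' : c ∈ AddSubgroup.closure (Set.range (gen (X := X) (k := 0))) := by
    rw [closure_gen]; trivial
  refine (AddSubgroup.closure_le _).2 ?_ hc'
  rintro _ ⟨σ, rfl⟩
  obtain ⟨U, hU, ht⟩ := (hc ▸ Set.mem_univ (σ (vertex 0)) : σ (vertex 0) ∈ ⋃₀ 𝒰)
  refine gen_mem_smallChains hU ?_
  rintro _ ⟨t, rfl⟩
  have : Unique (stdSimplex ℝ (Fin (0 + 1))) := inferInstanceAs (Unique (stdSimplex ℝ (Fin 1)))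
  rwa [Subsingleton.elim t (vertex 0)]

/-- A singular chain whose boundary is small is small up to a boundary. -/
theorem exists_sub_bd_mem_smallChains (ho : ∀ U ∈ 𝒰, IsOpen U) (hc : ⋃₀ 𝒰 = Set.univ) {k : ℕ}
    (c : Chain k X) (hk : ∀ l, ((singularChains.obj X).d k l).hom c ∈ smallChains 𝒰 l) :
    ∃ w : Chain (k + 1) X, c - bd k w ∈ smallChains 𝒰 k := by
  cases k with
  | zero => exact ⟨0, gen_zero_mem_smallChains hc _⟩
  | succ k =>
    have hk' : bd k c ∈ smallChains 𝒰 k := hk k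
    obtain ⟨N, hN⟩ := exists_iterate_subdiv_mem ho hc c
    -- The chain homotopy writes `c' - subdiv c'` as a boundary plus the homotopy applied to `bd
    -- c'`. Boundaries of all iterates stay small, and the homotopy preserves smallness, so each
    -- subdivision changes the chain by a boundary modulo small chains.
    suffices h : ∀ N, bd k ((subdiv X (k + 1))^[N] c) ∈ smallChains 𝒰 k ∧
        ∃ w, c - (subdiv X (k + 1))^[N] c - bd (k + 1) w ∈ smallChains 𝒰 (k + 1) by
      obtain ⟨-, w, hw⟩ := h N
      refine ⟨w, ?_⟩
      have := add_mem hw hN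
      rwa [sub_right_comm, sub_add_cancel] at this
    intro N
    induction N with
    | zero => exact ⟨hk', 0, by simp [zero_mem]⟩
    | succ N ih =>
      obtain ⟨h1, w, hw⟩ := ih
      rw [Function.iterate_succ_apply']
      set c' := (subdiv X (k + 1))^[N] c
      refine ⟨by rw [bd_subdiv]; exact subdiv_mem_smallChains h1,
        w + subdivHomotopy X (k + 1) c', ?_⟩
      have := add_mem hw (subdivHomotopy_mem_smallChains h1)
      convert this using 1
      rw [map_add, bd_subdivHomotopy]
      abel

end Sing


/-! ### Representatives of homology classes -/

namespace HomologicalComplex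

variable {ι : Type*} {c : ComplexShape ι}

/-- The chain `x` is a cycle which represents the homology class `h`. -/
def Represents (K : HomologicalComplex AddCommGrpCat.{u} c) {i : ι} (x : K.X i)
    (h : K.homology i) : Prop :=
  ∃ z : K.cycles i, K.iCycles i z = x ∧ K.homologyπ i z = h

namespace Represents

variable {K L : HomologicalComplex AddCommGrpCat.{u} c} {i : ι}

theorem exists_chain (h : K.homology i) : ∃ x, K.Represents x h := by
  obtain ⟨z, rfl⟩ := (AddCommGrpCat.epi_iff_surjective (K.homologyπ i)).1 inferInstance h
  exact ⟨_, z, rfl, rfl⟩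

theorem exists_class (x : K.X i) (hx : ∀ j, K.d i j x = 0) : ∃ h, K.Represents x h := by
  obtain ⟨z, hz⟩ := (ShortComplex.ab_exact_iff _).1 (ShortComplex.exact_of_f_is_kernel
    (ShortComplex.mk _ _ (K.iCycles_d i (c.next i))) (K.cyclesIsKernel i _ rfl)) x (hx _)
  exact ⟨K.homologyπ i z, z, hz, rfl⟩

theorem d_eq_zero {x : K.X i} {h : K.homology i} (H : K.Represents x h) (j : ι) :
    K.d i j x = 0 := by
  obtain ⟨z, rfl, -⟩ := H
  exact ConcreteCategory.congr_hom (K.iCycles_d i j) z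

theorem zero : K.Represents (0 : K.X i) 0 := ⟨0, map_zero _, map_zero _⟩

theorem add {x y : K.X i} {h k : K.homology i} (H : K.Represents x h) (H' : K.Represents y k) :
    K.Represents (x + y) (h + k) := by
  obtain ⟨z, rfl, rfl⟩ := H
  obtain ⟨w, rfl, rfl⟩ := H'
  exact ⟨z + w, map_add _ _ _, map_add _ _ _⟩

theorem neg {x : K.X i} {h : K.homology i} (H : K.Represents x h) : K.Represents (-x) (-h) := by
  obtain ⟨z, rfl, rfl⟩ := H
  exact ⟨-z, map_neg _ _, map_neg _ _⟩

theorem sum {α : Type*} (s : Finset α) {x : α → K.X i} {h : α → K.homology i}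
    (H : ∀ a ∈ s, K.Represents (x a) (h a)) : K.Represents (∑ a ∈ s, x a) (∑ a ∈ s, h a) := by
  classical
  induction s using Finset.induction_on with
  | empty => exact zero
  | insert a s ha ih =>
    rw [Finset.sum_insert ha, Finset.sum_insert ha]
    exact (H a (Finset.mem_insert_self _ _)).add (ih fun b hb => H b (Finset.mem_insert_of_mem hb))

theorem of_d (j : ι) (w : K.X j) : K.Represents (K.d j i w) 0 := by
  by_cases hij : c.Rel j i
  · refine ⟨K.toCycles j i w, ?_, ?_⟩
    · exact ConcreteCategory.congr_hom (K.toCycles_i j i) w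
    · exact ConcreteCategory.congr_hom (K.toCycles_comp_homologyπ j i) w
  · rw [K.shape j i hij]
    exact zero

theorem exists_d_eq {x : K.X i} (H : K.Represents x 0) (j : ι) (hj : c.prev i = j) :
    ∃ w : K.X j, K.d j i w = x := by
  obtain ⟨z, rfl, hz⟩ := H
  have := (ShortComplex.ab_exact_iff _).1 (ShortComplex.exact_of_g_is_cokernel
    (ShortComplex.mk _ _ (K.toCycles_comp_homologyπ j i)) (K.homologyIsCokernel j i hj)) z hz
  obtain ⟨w, hw⟩ := this
  refine ⟨w, ?_⟩
  rw [← hw]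
  exact (ConcreteCategory.congr_hom (K.toCycles_i j i) w).symm

theorem unique {x : K.X i} {h k : K.homology i} (H : K.Represents x h) (H' : K.Represents x k) :
    h = k := by
  obtain ⟨z, rfl, rfl⟩ := H
  obtain ⟨w, hw, rfl⟩ := H'
  rw [(AddCommGrpCat.mono_iff_injective (K.iCycles i)).1 inferInstance hw]

theorem map (f : K ⟶ L) {x : K.X i} {h : K.homology i} (H : K.Represents x h) :
    L.Represents (f.f i x) (homologyMap f i h) := by
  obtain ⟨z, rfl, rfl⟩ := H
  exact ⟨cyclesMap f i z, ConcreteCategory.congr_hom (cyclesMap_i f i) z,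
    (ConcreteCategory.congr_hom (homologyπ_naturality f i) z).symm⟩

end Represents

end HomologicalComplex

/-! ### Relative singular chains -/

namespace FiltSpace

open Sing

variable (Y : FiltSpace.{u}) (n : ℕ)

/-- The class of a singular chain of `Y.level (n + 1)` modulo the chains of `Y.level n`. -/
abbrev relClass (k : ℕ) : Chain k (Y.level (n + 1)) →+ (Y.relChains n).X k :=
  ((Y.relProj n).f k).hom

theorem relClass_surjective (k : ℕ) : Function.Surjective (Y.relClass n k) :=
  (AddCommGrpCat.epi_iff_surjective ((Y.relProj n).f k)).1 inferInstance

variable {Y n}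

/-- Evaluation in degree `k` preserves the exactness of the sequence of the pair. -/
theorem relClass_eq_zero_iff {k : ℕ} (c : Chain k (Y.level (n + 1))) :
    Y.relClass n k c = 0 ↔ ∃ b : Chain k (Y.level n), push (Y.incl n) k b = c := by
  constructor
  · exact (ShortComplex.ab_exact_iff _).1 ((Y.pairSequence_shortExact n).exact.map
      (HomologicalComplex.eval AddCommGrpCat.{u} (ComplexShape.down ℕ) k)) c
  · rintro ⟨b, rfl⟩
    exact ConcreteCategory.congr_hom (congrArg (fun f => f.f k) (Y.incl_relProj n)) b

theorem d_relClass {k : ℕ} (c : Chain (k + 1) (Y.level (n + 1))) :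
    (Y.relChains n).d (k + 1) k (Y.relClass n (k + 1) c) = Y.relClass n k (bd k c) :=
  ConcreteCategory.congr_hom ((Y.relProj n).comm (k + 1) k) c

theorem relMap_relClass {Z : FiltSpace.{u}} (f : Y ⟶ Z) {k : ℕ} (c : Chain k (Y.level (n + 1))) :
    (relMap f n).f k (Y.relClass n k c) = Z.relClass n k (push (levelMap f (n + 1)) k c) :=
  ConcreteCategory.congr_hom (congrArg (fun g => g.f k) (relProj_relMap f n)) c

theorem relClass_gen_eq_zero {k : ℕ} {σ : Simplex k (Y.level (n + 1))}
    (hσ : ∀ t, (σ t).1 ∈ Y.sk n) : Y.relClass n k (gen σ) = 0 := by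
  rw [relClass_eq_zero_iff]
  refine ⟨gen (X := Y.level n) ⟨fun t => ⟨(σ t).1, hσ t⟩, ?_⟩, ?_⟩
  · exact (continuous_subtype_val.comp σ.continuous).subtype_mk _
  · rw [push_gen]
    rfl

/-- The map on relative chains induced by a self-map of `Y.level (n + 1)` which is the identity on
`Y.level n`. -/
def relEnd (h : Y.level (n + 1) ⟶ Y.level (n + 1)) (hh : Y.incl n ≫ h = Y.incl n) :
    Y.relChains n ⟶ Y.relChains n :=
  Limits.cokernel.map _ _ (𝟙 _) (singularChains.map h)
    (by rw [← Functor.map_comp, hh, Category.id_comp])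

theorem relProj_relEnd (h : Y.level (n + 1) ⟶ Y.level (n + 1)) (hh : Y.incl n ≫ h = Y.incl n) :
    Y.relProj n ≫ relEnd h hh = singularChains.map h ≫ Y.relProj n :=
  Limits.cokernel.π_desc _ _ _

theorem relEnd_relClass (h : Y.level (n + 1) ⟶ Y.level (n + 1)) (hh : Y.incl n ≫ h = Y.incl n)
    {k : ℕ} (c : Chain k (Y.level (n + 1))) :
    (relEnd h hh).f k (Y.relClass n k c) = Y.relClass n k (push h k c) :=
  ConcreteCategory.congr_hom (congrArg (fun g => g.f k) (relProj_relEnd h hh)) c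

/-- Five lemma for the sequence of the pair: the map is the identity on the subcomplex and a
quasi-isomorphism in the middle. The homotopy to the identity need not be relative to `Y.level n`.
-/
theorem homologyMap_relEnd_bijective (h : Y.level (n + 1) ⟶ Y.level (n + 1))
    (hh : Y.incl n ≫ h = Y.incl n) (H : h.hom.Homotopic (ContinuousMap.id _)) (k : ℕ) :
    Function.Bijective (HomologicalComplex.homologyMap (relEnd h hh) k) := by
  let φ : Y.pairSequence n ⟶ Y.pairSequence n :=
    { τ₁ := 𝟙 _
      τ₂ := singularChains.map h
      τ₃ := relEnd h hh
      comm₁₂ := by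
        dsimp only [pairSequence]
        rw [← Functor.map_comp, hh, Category.id_comp]
      comm₂₃ := (relProj_relEnd h hh).symm }
  have h2 : QuasiIso φ.τ₂ := by
    refine ⟨fun i => (quasiIsoAt_iff_isIso_homologyMap _ _).2 ?_⟩
    have e := TopCat.Homotopy.congr_homologyMap_singularChainComplexFunctor
      (X := Y.level (n + 1)) (Y := Y.level (n + 1)) (f := h) (g := 𝟙 _)
      (Classical.choice H) (AddCommGrpCat.of (ULift.{u} ℤ)) i
    change IsIso (HomologicalComplex.homologyMap (singularChains.map h) i)
    rw [e, CategoryTheory.Functor.map_id, HomologicalComplex.homologyMap_id]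
    infer_instance
  have h3 : QuasiIso φ.τ₃ := HomologicalComplex.HomologySequence.quasiIso_τ₃ φ
    (Y.pairSequence_shortExact n) (Y.pairSequence_shortExact n)
    (inferInstanceAs (QuasiIso (𝟙 _))) h2
  exact ConcreteCategory.bijective_of_isIso (HomologicalComplex.homologyMap φ.τ₃ k)

end FiltSpace


/-! ### Discs -/

/-- Radial stretching by the factor `1 + t`, cut off at the unit sphere. -/
def radialStretch {n : ℕ} (t : ℝ) (y : Fin n → ℝ) : Fin n → ℝ :=
  ((1 + t) / max 1 ((1 + t) * ‖y‖)) • y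

section RadialStretch

variable {n : ℕ}

theorem continuous_radialStretch :
    Continuous fun p : ℝ × (Fin n → ℝ) => radialStretch p.1 p.2 := by
  refine ((continuous_const.add continuous_fst).div (continuous_const.max
    ((continuous_const.add continuous_fst).mul continuous_snd.norm)) fun p => ?_).smul
    continuous_snd
  exact (lt_of_lt_of_le one_pos (le_max_left _ _)).ne'

theorem radialStretch_zero {y : Fin n → ℝ} (hy : ‖y‖ ≤ 1) : radialStretch 0 y = y := by
  simp [radialStretch, max_eq_left hy]

theorem norm_radialStretch {t : ℝ} (ht : 0 ≤ t) (y : Fin n → ℝ) :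
    ‖radialStretch t y‖ = (1 + t) * ‖y‖ / max 1 ((1 + t) * ‖y‖) := by
  have : (0 : ℝ) < max 1 ((1 + t) * ‖y‖) := lt_of_lt_of_le one_pos (le_max_left _ _)
  rw [radialStretch, norm_smul, Real.norm_of_nonneg (by positivity)]
  ring

theorem norm_radialStretch_le {t : ℝ} (ht : 0 ≤ t) (y : Fin n → ℝ) : ‖radialStretch t y‖ ≤ 1 := by
  rw [norm_radialStretch ht, div_le_one (lt_of_lt_of_le one_pos (le_max_left _ _))]
  exact le_max_right _ _

/-- At `t = 1` the condition reads `‖y‖ ≥ 1 / 2`: everything outside the open half disc reaches the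
boundary sphere. -/
theorem norm_radialStretch_eq {t : ℝ} (ht : 0 ≤ t) {y : Fin n → ℝ} (hy : 1 ≤ (1 + t) * ‖y‖) :
    ‖radialStretch t y‖ = 1 := by
  rw [norm_radialStretch ht, max_eq_right hy, div_self (by linarith)]

theorem radialStretch_of_norm_eq {t : ℝ} (ht : 0 ≤ t) {y : Fin n → ℝ} (hy : ‖y‖ = 1) :
    radialStretch t y = y := by
  rw [radialStretch, hy, mul_one, max_eq_right (by linarith), div_self (by linarith), one_smul]

end RadialStretch

namespace FiltSpace

open Sing

/-- The closed `n`-disc, filtered by the empty set, its boundary sphere and the full disc. -/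
def disc (n : ℕ) : FiltSpace.{u} where
  carrier := ULift.{u} {y : Fin n → ℝ // ‖y‖ ≤ 1}
  sk k := {x | n < k ∨ k = n ∧ ‖x.down.1‖ = 1}
  mono k l hkl x hx := by
    rcases hx with hx | ⟨rfl, hx⟩
    · exact Or.inl (hx.trans_le hkl)
    · rcases hkl.eq_or_lt with rfl | h
      · exact Or.inr ⟨rfl, hx⟩
      · exact Or.inl h

theorem mem_disc_sk {n : ℕ} (x : (disc.{u} n).carrier) : x ∈ (disc n).sk n ↔ ‖x.down.1‖ = 1 :=
  ⟨fun h => h.elim (fun h => absurd h (lt_irrefl n)) fun h => h.2, fun h => Or.inr ⟨rfl, h⟩⟩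

/-- The point of the disc given by a vector of norm at most one. -/
def discPoint {n : ℕ} (y : Fin n → ℝ) (hy : ‖y‖ ≤ 1) : (disc.{u} n).level (n + 1) :=
  (⟨⟨⟨y, hy⟩⟩, Or.inl n.lt_succ_self⟩ : (disc.{u} n).sk (n + 1))

/-- The vector underlying a point of the disc. -/
def discVec {n : ℕ} (x : (disc.{u} n).level (n + 1)) : Fin n → ℝ := x.1.down.1

theorem norm_discVec_le {n : ℕ} (x : (disc.{u} n).level (n + 1)) : ‖discVec x‖ ≤ 1 := x.1.down.2

theorem continuous_discVec {n : ℕ} : Continuous (discVec.{u} (n := n)) :=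
  continuous_subtype_val.comp (continuous_uliftDown.comp continuous_subtype_val)

theorem discVec_injective {n : ℕ} : Function.Injective (discVec.{u} (n := n)) := fun _ _ h =>
  Subtype.ext (ULift.ext _ _ (Subtype.ext h))

theorem continuous_discPoint {n : ℕ} {T : Type*} [TopologicalSpace T] {f : T → Fin n → ℝ}
    (hf : Continuous f) (h : ∀ t, ‖f t‖ ≤ 1) : Continuous fun t => discPoint.{u} (f t) (h t) :=
  (continuous_uliftUp.comp (hf.subtype_mk h)).subtype_mk _

/-- The radial stretching of the disc by the factor `2`. -/
def discStretch (n : ℕ) : (disc.{u} n).level (n + 1) ⟶ (disc.{u} n).level (n + 1) :=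
  TopCat.ofHom ⟨fun x => discPoint (radialStretch 1 (discVec x))
      (norm_radialStretch_le zero_le_one _),
    continuous_discPoint (continuous_radialStretch.comp
      (continuous_const.prodMk continuous_discVec)) _⟩

theorem discStretch_homotopic (n : ℕ) :
    (discStretch.{u} n).hom.Homotopic (ContinuousMap.id _) := by
  refine ContinuousMap.Homotopic.symm ⟨⟨⟨fun p => discPoint (radialStretch p.1 (discVec p.2))
    (norm_radialStretch_le p.1.2.1 _), ?_⟩, ?_, ?_⟩⟩
  · exact continuous_discPoint (continuous_radialStretch.comp
      ((continuous_subtype_val.comp continuous_fst).prodMk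
        (continuous_discVec.comp continuous_snd))) _
  · intro x
    exact discVec_injective (radialStretch_zero (norm_discVec_le x))
  · intro x
    rfl

theorem incl_discStretch (n : ℕ) : (disc.{u} n).incl n ≫ discStretch n = (disc n).incl n := by
  ext x
  exact discVec_injective (radialStretch_of_norm_eq zero_le_one ((mem_disc_sk _).1 x.2))

/-- A presentation of `Y.level (n + 1)` as obtained from `Y.level n` by attaching `n`-cells. -/
structure CellAttachment (Y : FiltSpace.{u}) (n : ℕ) (J : Type u) where
  /-- The characteristic maps. -/
  char : J → (disc n ⟶ Y)
  /-- A neighbourhood of `Y.level n`. -/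
  collar : Set (Y.level (n + 1))
  /-- The open cells. -/
  openCell : J → Set (Y.level (n + 1))
  isOpen_collar : IsOpen collar
  isOpen_openCell : ∀ j, IsOpen (openCell j)
  cover : ∀ y, y ∈ collar ∨ ∃ j, y ∈ openCell j
  mem_collar : ∀ y : Y.level (n + 1), y.1 ∈ Y.sk n → y ∈ collar
  notMem_openCell : ∀ (y : Y.level (n + 1)) j, y.1 ∈ Y.sk n → y ∉ openCell j
  /-- The inverses of the characteristic maps on open cells. -/
  inv : ∀ j, C(openCell j, (disc.{u} n).level (n + 1))
  char_inv : ∀ j y, levelMap (char j) (n + 1) (inv j y) = y.1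
  inv_char : ∀ j x (hx : levelMap (char j) (n + 1) x ∈ openCell j), inv j ⟨_, hx⟩ = x
  eq_of_char_mem : ∀ i j x, levelMap (char j) (n + 1) x ∈ openCell i → j = i
  mem_of_char_mem : ∀ j x, (levelMap (char j) (n + 1) x).1 ∈ Y.sk n → x.1 ∈ (disc.{u} n).sk n
  /-- The radial stretching of cells. -/
  stretch : Y.level (n + 1) ⟶ Y.level (n + 1)
  stretch_homotopic : stretch.hom.Homotopic (ContinuousMap.id _)
  incl_stretch : Y.incl n ≫ stretch = Y.incl n
  stretch_mem : ∀ y ∈ collar, (stretch y).1 ∈ Y.sk n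
  char_stretch : ∀ j, levelMap (char j) (n + 1) ≫ stretch =
    discStretch n ≫ levelMap (char j) (n + 1)

/-! ### Cellular chains of a cell attachment -/

namespace CellAttachment

variable {Y : FiltSpace.{u}} {n : ℕ} {J : Type u} (a : CellAttachment Y n J)

theorem char_stretch_apply (j : J) (x : (disc.{u} n).level (n + 1)) :
    a.stretch (levelMap (a.char j) (n + 1) x) = levelMap (a.char j) (n + 1) (discStretch n x) :=
  ConcreteCategory.congr_hom (a.char_stretch j) x

theorem eq_of_mem {i j : J} {y : Y.level (n + 1)} (hi : y ∈ a.openCell i) (hj : y ∈ a.openCell j) :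
    i = j :=
  a.eq_of_char_mem j i (a.inv i ⟨y, hi⟩) (by rwa [a.char_inv])

/-- The open cover by the collar and the open cells. -/
def family : Set (Set (Y.level (n + 1))) := insert a.collar (Set.range a.openCell)

theorem isOpen_family : ∀ U ∈ a.family, IsOpen U := by
  rintro _ (rfl | ⟨j, rfl⟩)
  · exact a.isOpen_collar
  · exact a.isOpen_openCell j

theorem sUnion_family : ⋃₀ a.family = Set.univ := by
  refine Set.eq_univ_of_forall fun y => ?_
  rcases a.cover y with h | ⟨j, h⟩
  · exact ⟨_, Or.inl rfl, h⟩
  · exact ⟨_, Or.inr ⟨j, rfl⟩, h⟩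

theorem push_incl_mem {k : ℕ} (b : Chain k (Y.level n)) :
    push (Y.incl n) k b ∈ smallChains a.family k := by
  have hb : b ∈ AddSubgroup.closure (Set.range (gen (X := Y.level n) (k := k))) := by
    rw [closure_gen]; trivial
  refine (AddSubgroup.closure_le ((smallChains a.family k).comap (push (Y.incl n) k))).2 ?_ hb
  rintro _ ⟨σ, rfl⟩
  rw [SetLike.mem_coe, AddSubgroup.mem_comap, push_gen]
  refine gen_mem_smallChains (Or.inl rfl) ?_
  rintro _ ⟨t, rfl⟩
  exact a.mem_collar _ (σ t).2

/-- The open cover of the disc obtained by pulling back along a characteristic map. -/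
def discFamily (j : J) : Set (Set ((disc.{u} n).level (n + 1))) :=
  (fun U => levelMap (a.char j) (n + 1) ⁻¹' U) '' a.family

theorem push_char_mem (j : J) {k : ℕ} {c : Chain k ((disc.{u} n).level (n + 1))}
    (hc : c ∈ smallChains (a.discFamily j) k) :
    push (levelMap (a.char j) (n + 1)) k c ∈ smallChains a.family k := by
  refine (AddSubgroup.closure_le ((smallChains a.family k).comap (push _ k))).2 ?_ hc
  rintro _ ⟨σ, ⟨_, ⟨U, hU, rfl⟩, hσ⟩, rfl⟩
  rw [SetLike.mem_coe, AddSubgroup.mem_comap, push_gen]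
  refine gen_mem_smallChains hU ?_
  rintro _ ⟨t, rfl⟩
  exact hσ ⟨t, rfl⟩

/-- The simplex in the disc obtained from a simplex in the open cell by stretching. -/
def retractSimplex (j : J) {k : ℕ} (σ : Simplex k (Y.level (n + 1)))
    (h : Set.range σ ⊆ a.openCell j) : Simplex k ((disc.{u} n).level (n + 1)) :=
  (discStretch n).hom.comp ((a.inv j).comp ⟨fun t => ⟨σ t, h ⟨t, rfl⟩⟩, by fun_prop⟩)

theorem char_retractSimplex (j : J) {k : ℕ} (σ : Simplex k (Y.level (n + 1)))
    (h : Set.range σ ⊆ a.openCell j) (t : stdSimplex ℝ (Fin (k + 1))) :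
    levelMap (a.char j) (n + 1) (a.retractSimplex j σ h t) = a.stretch (σ t) :=
  (a.char_stretch_apply j _).symm.trans (congrArg a.stretch (a.char_inv j _))

open scoped Classical in
/-- The coordinate in the cell `j` of a chain subordinate to the open cover. -/
def coord (j : J) (k : ℕ) : Chain k (Y.level (n + 1)) →+ ((disc.{u} n).relChains n).X k :=
  Sing.lift fun σ => if h : Set.range σ ⊆ a.openCell j then
    (disc.{u} n).relClass n k (gen (a.retractSimplex j σ h)) else 0

theorem coord_gen {j : J} {k : ℕ} {σ : Simplex k (Y.level (n + 1))}
    (h : Set.range σ ⊆ a.openCell j) :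
    a.coord j k (gen σ) = (disc.{u} n).relClass n k (gen (a.retractSimplex j σ h)) := by
  rw [coord, lift_gen, dif_pos h]

theorem coord_gen_of_not {j : J} {k : ℕ} {σ : Simplex k (Y.level (n + 1))}
    (h : ¬ Set.range σ ⊆ a.openCell j) : a.coord j k (gen σ) = 0 := by
  rw [coord, lift_gen, dif_neg h]

theorem coord_gen_of_notMem {j : J} {k : ℕ} {σ : Simplex k (Y.level (n + 1))}
    {t : stdSimplex ℝ (Fin (k + 1))} (h : σ t ∉ a.openCell j) : a.coord j k (gen σ) = 0 :=
  a.coord_gen_of_not fun h' => h (h' ⟨t, rfl⟩)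

theorem coord_gen_of_ne {i j : J} (hij : i ≠ j) {k : ℕ} {σ : Simplex k (Y.level (n + 1))}
    (h : Set.range σ ⊆ a.openCell i) : a.coord j k (gen σ) = 0 :=
  a.coord_gen_of_notMem (t := stdSimplex.vertex 0) fun h' => hij (a.eq_of_mem (h ⟨_, rfl⟩) h')

/-- A simplex in both the collar and the open cell is stretched into the lower space, so its
retraction to the disc lies in the sphere and is zero modulo it. Hence the overlap of the two kinds
of cover members causes no ambiguity. -/
theorem coord_gen_of_collar {j : J} {k : ℕ} {σ : Simplex k (Y.level (n + 1))}
    (hσ : Set.range σ ⊆ a.collar) : a.coord j k (gen σ) = 0 := by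
  by_cases h : Set.range σ ⊆ a.openCell j
  · rw [a.coord_gen h]
    refine relClass_gen_eq_zero fun t => a.mem_of_char_mem j _ ?_
    rw [a.char_retractSimplex]
    exact a.stretch_mem _ (hσ ⟨t, rfl⟩)
  · exact a.coord_gen_of_not h

theorem coord_push_incl {j : J} {k : ℕ} (b : Chain k (Y.level n)) :
    a.coord j k (push (Y.incl n) k b) = 0 := by
  have : (a.coord j k).comp (push (Y.incl n) k) = 0 := hom_ext fun σ => by
    rw [AddMonoidHom.comp_apply, push_gen]
    exact a.coord_gen_of_collar (by
      rintro _ ⟨t, rfl⟩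
      exact a.mem_collar _ (σ t).2)
  exact DFunLike.congr_fun this b

/-- Smallness is essential: a general simplex not contained in the cell `j` may have a face inside
it. A small one lies in the collar or in another cell, and then all its faces have coordinate zero
as well. -/
theorem coord_bd {j : J} {k : ℕ} {c : Chain (k + 1) (Y.level (n + 1))}
    (hc : c ∈ smallChains a.family (k + 1)) :
    a.coord j k (bd k c) = ((disc.{u} n).relChains n).d (k + 1) k (a.coord j (k + 1) c) := by
  have hface : ∀ {σ : Simplex (k + 1) (Y.level (n + 1))} {U : Set (Y.level (n + 1))},
      Set.range σ ⊆ U → ∀ i, Set.range (σ.comp (face i)) ⊆ U := fun h i => by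
    rintro _ ⟨t, rfl⟩
    exact h ⟨_, rfl⟩
  refine (AddSubgroup.closure_le (AddMonoidHom.eqLocus ((a.coord j k).comp (bd k))
    ((((disc.{u} n).relChains n).d (k + 1) k).hom.comp (a.coord j (k + 1))))).2 ?_ hc
  rintro _ ⟨σ, ⟨U, hU, hσ⟩, rfl⟩
  change a.coord j k (bd k (gen σ)) =
    ((disc.{u} n).relChains n).d (k + 1) k (a.coord j (k + 1) (gen σ))
  rw [bd_gen, map_sum]
  simp only [map_zsmul]
  by_cases h : Set.range σ ⊆ a.openCell j
  · rw [a.coord_gen h, d_relClass, bd_gen, map_sum]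
    refine Finset.sum_congr rfl fun i _ => ?_
    rw [a.coord_gen (hface h i), map_zsmul]
    rfl
  · rw [a.coord_gen_of_not h, map_zero]
    refine Finset.sum_eq_zero fun i _ => ?_
    rcases hU with rfl | ⟨l, rfl⟩
    · rw [a.coord_gen_of_collar (hface hσ i), smul_zero]
    · rw [a.coord_gen_of_ne (i := l) (by rintro rfl; exact h hσ) (hface hσ i), smul_zero]

/-- Within the open cell, retracting and pushing forward cancel up to the stretching. A small
simplex not mapped into the cell is mapped into the collar, and its stretching lies in the sphere.
-/
theorem coord_push_char {j : J} {k : ℕ} {c : Chain k ((disc.{u} n).level (n + 1))}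
    (hc : c ∈ smallChains (a.discFamily j) k) :
    a.coord j k (push (levelMap (a.char j) (n + 1)) k c) =
      (disc.{u} n).relClass n k (push (discStretch n) k c) := by
  refine (AddSubgroup.closure_le (AddMonoidHom.eqLocus
    ((a.coord j k).comp (push (levelMap (a.char j) (n + 1)) k))
    (((disc.{u} n).relClass n k).comp (push (discStretch n) k)))).2 ?_ hc
  rintro _ ⟨σ, ⟨_, ⟨U, hU, rfl⟩, hσ⟩, rfl⟩
  change a.coord j k (push (levelMap (a.char j) (n + 1)) k (gen σ)) =
    (disc.{u} n).relClass n k (push (discStretch n) k (gen σ))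
  rw [push_gen, push_gen]
  by_cases h : Set.range ((levelMap (a.char j) (n + 1)).hom.comp σ) ⊆ a.openCell j
  · rw [a.coord_gen h]
    congr 2
    ext1 t
    exact congrArg (discStretch n) (a.inv_char j (σ t) (h ⟨t, rfl⟩))
  · rw [a.coord_gen_of_not h]
    symm
    refine relClass_gen_eq_zero fun t => a.mem_of_char_mem j _ ?_
    rcases hU with rfl | ⟨l, rfl⟩
    · have := a.stretch_mem _ (hσ ⟨t, rfl⟩)
      rwa [a.char_stretch_apply] at this
    · exfalso
      refine h ?_
      rintro _ ⟨s, rfl⟩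
      have hs : levelMap (a.char j) (n + 1) (σ s) ∈ a.openCell l := hσ ⟨s, rfl⟩
      obtain rfl := a.eq_of_char_mem l j _ hs
      exact hs

/-- The image of a closed cell misses every other open cell, so no smallness is needed. -/
theorem coord_push_char_of_ne {i j : J} (hij : i ≠ j) {k : ℕ}
    (c : Chain k ((disc.{u} n).level (n + 1))) :
    a.coord j k (push (levelMap (a.char i) (n + 1)) k c) = 0 := by
  have : (a.coord j k).comp (push (levelMap (a.char i) (n + 1)) k) = 0 := hom_ext fun σ => by
    rw [AddMonoidHom.comp_apply, push_gen]
    exact a.coord_gen_of_notMem (t := stdSimplex.vertex 0) fun h => hij (a.eq_of_char_mem j i _ h)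
  exact DFunLike.congr_fun this c

/-- Modulo the lower space, the stretching of a small chain is the sum of its parts in the cells.
The equality is required for all larger index sets so that two chains can be handled with the union
of theirs. -/
theorem exists_sum_coord {k : ℕ} {c : Chain k (Y.level (n + 1))}
    (hc : c ∈ smallChains a.family k) : ∃ s : Finset J, ∀ s', s ⊆ s' →
      ∑ j ∈ s', (relMap (a.char j) n).f k (a.coord j k c) =
        Y.relClass n k (push a.stretch k c) := by
  classical
  induction hc using AddSubgroup.closure_induction with
  | mem x hx =>
    obtain ⟨σ, ⟨U, hU, hσ⟩, rfl⟩ := hx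
    rcases hU with rfl | ⟨l, rfl⟩
    · refine ⟨∅, fun s _ => ?_⟩
      rw [push_gen, relClass_gen_eq_zero fun t => a.stretch_mem _ (hσ ⟨t, rfl⟩)]
      refine Finset.sum_eq_zero fun j _ => ?_
      rw [a.coord_gen_of_collar hσ, map_zero]
    · refine ⟨{l}, fun s hs => ?_⟩
      rw [Finset.sum_eq_single_of_mem l (hs (Finset.mem_singleton_self l)) fun j _ hj => by
        rw [a.coord_gen_of_ne hj.symm hσ, map_zero]]
      rw [a.coord_gen hσ, relMap_relClass, push_gen, push_gen]
      congr 2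
      ext1 t
      exact a.char_retractSimplex l σ hσ t
  | zero => exact ⟨∅, fun s _ => by simp⟩
  | add x y _ _ hx hy =>
    obtain ⟨s, hs⟩ := hx
    obtain ⟨s', hs'⟩ := hy
    refine ⟨s ∪ s', fun r hr => ?_⟩
    simp only [map_add, Finset.sum_add_distrib]
    rw [hs r (Finset.union_subset_left hr), hs' r (Finset.union_subset_right hr)]
  | neg x _ hx =>
    obtain ⟨s, hs⟩ := hx
    exact ⟨s, fun r hr => by simp only [map_neg, Finset.sum_neg_distrib, hs r hr]⟩

/-- The cellular chains are generated by the cells. -/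
theorem exists_sum_cellMap_char (c : Y.cellChains n) : ∃ (s : Finset J)
    (m : J → (disc.{u} n).cellChains n), ∑ j ∈ s, cellMap (a.char j) n (m j) = c := by
  -- Since the stretching is bijective on relative homology, it suffices to decompose stretched
  -- classes.
  obtain ⟨c, rfl⟩ :=
    (homologyMap_relEnd_bijective a.stretch a.incl_stretch a.stretch_homotopic n).2 c
  obtain ⟨x, hx⟩ := HomologicalComplex.Represents.exists_chain c
  obtain ⟨z, rfl⟩ := relClass_surjective Y n n x
  have hz : ∀ l, ∃ b : Chain l (Y.level n),
      push (Y.incl n) l b = ((singularChains.obj (Y.level (n + 1))).d n l).hom z := by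
    intro l
    rw [← relClass_eq_zero_iff]
    refine Eq.trans ?_ (hx.d_eq_zero l)
    exact (ConcreteCategory.congr_hom ((Y.relProj n).comm n l) z).symm
  -- The boundary of a relative cycle lies in the lower space, hence in the collar, so it is already
  -- small.
  obtain ⟨w, hw⟩ := exists_sub_bd_mem_smallChains a.isOpen_family a.sUnion_family z fun l => by
    obtain ⟨b, hb⟩ := hz l
    rw [← hb]
    exact a.push_incl_mem b
  have hx' : (Y.relChains n).Represents (Y.relClass n n (z - bd n w)) c := by
    have := hx.add (HomologicalComplex.Represents.of_d (n + 1) (Y.relClass n (n + 1) w)).neg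
    rw [neg_zero, add_zero] at this
    convert this using 1
    rw [map_sub, sub_eq_add_neg, d_relClass]
  -- The coordinates of a small relative cycle are relative cycles of the disc: `coord` commutes
  -- with the boundary and kills chains of the lower space.
  have hcyc : ∀ j l, ((disc.{u} n).relChains n).d n l (a.coord j n (z - bd n w)) = 0 := by
    intro j l
    by_cases hl : l + 1 = n
    · subst hl
      rw [← a.coord_bd hw, map_sub, bd_bd, sub_zero]
      obtain ⟨b, hb⟩ := hz l
      exact (congrArg _ hb.symm).trans (a.coord_push_incl b)
    · rw [HomologicalComplex.shape _ _ _ hl]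
      rfl
  choose m hm using fun j =>
    HomologicalComplex.Represents.exists_class (a.coord j n (z - bd n w)) (hcyc j)
  obtain ⟨s, hs⟩ := a.exists_sum_coord hw
  refine ⟨s, m, HomologicalComplex.Represents.unique
    (HomologicalComplex.Represents.sum s fun j _ => (hm j).map (relMap (a.char j) n)) ?_⟩
  have := hs s subset_rfl
  rw [← relEnd_relClass a.stretch a.incl_stretch] at this
  rw [this]
  exact hx'.map _

/-- The cells are linearly independent in the cellular chains. -/
theorem eq_zero_of_sum_cellMap_char (s : Finset J) (m : J → (disc.{u} n).cellChains n)
    (h : ∑ j ∈ s, cellMap (a.char j) n (m j) = 0) {i : J} (hi : i ∈ s) : m i = 0 := by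
  -- Each class has a representative small for the pulled back cover; its boundary lies in the
  -- sphere, which the characteristic map sends into the collar.
  have hrep : ∀ j, ∃ z ∈ smallChains (a.discFamily j) n,
      ((disc.{u} n).relChains n).Represents ((disc.{u} n).relClass n n z) (m j) := by
    intro j
    obtain ⟨x, hx⟩ := HomologicalComplex.Represents.exists_chain (m j)
    obtain ⟨z, rfl⟩ := relClass_surjective (disc.{u} n) n n x
    obtain ⟨w, hw⟩ := exists_sub_bd_mem_smallChains (𝒰 := a.discFamily j) (by
        rintro _ ⟨U, hU, rfl⟩
        exact (a.isOpen_family U hU).preimage (levelMap (a.char j) (n + 1)).hom.continuous) (by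
        refine Set.eq_univ_of_forall fun y => ?_
        obtain ⟨U, hU, hy⟩ : levelMap (a.char j) (n + 1) y ∈ ⋃₀ a.family := by
          rw [a.sUnion_family]; trivial
        exact ⟨_, ⟨U, hU, rfl⟩, hy⟩) z fun l => by
      obtain ⟨b, hb⟩ := (relClass_eq_zero_iff (Y := disc.{u} n) (n := n)
        (((singularChains.obj ((disc.{u} n).level (n + 1))).d n l).hom z)).1
          ((ConcreteCategory.congr_hom (((disc.{u} n).relProj n).comm n l) z).symm.trans
            (hx.d_eq_zero l))
      rw [← hb]
      have hb' : b ∈ AddSubgroup.closure (Set.range (gen (X := (disc.{u} n).level n) (k := l))) := by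
        rw [closure_gen]; trivial
      refine (AddSubgroup.closure_le ((smallChains (a.discFamily j) l).comap
        (push ((disc.{u} n).incl n) l))).2 ?_ hb'
      rintro _ ⟨σ, rfl⟩
      rw [SetLike.mem_coe, AddSubgroup.mem_comap, push_gen]
      refine gen_mem_smallChains ⟨_, Or.inl rfl, rfl⟩ ?_
      rintro _ ⟨t, rfl⟩
      exact a.mem_collar _ ((a.char j).mapsTo n (σ t).2)
    refine ⟨_, hw, ?_⟩
    have := hx.add (HomologicalComplex.Represents.of_d (n + 1)
      ((disc.{u} n).relClass n (n + 1) w)).neg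
    rw [neg_zero, add_zero] at this
    convert this using 1
    rw [map_sub, sub_eq_add_neg, d_relClass]
  choose z hz hzm using hrep
  have hsum := HomologicalComplex.Represents.sum s fun j _ => (hzm j).map (relMap (a.char j) n)
  rw [show ∑ j ∈ s, HomologicalComplex.homologyMap (relMap (a.char j) n) n (m j) = 0 from h]
    at hsum
  obtain ⟨x, hx⟩ := hsum.exists_d_eq (n + 1) (by simp)
  obtain ⟨v, rfl⟩ := relClass_surjective Y n (n + 1) x
  rw [d_relClass] at hx
  simp only [relMap_relClass] at hx
  rw [← map_sum, ← sub_eq_zero, ← map_sub, relClass_eq_zero_iff] at hx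
  obtain ⟨b, hb⟩ := hx
  -- Vanishing of the sum means that the chosen representatives together bound, modulo a chain `b`
  -- of the lower space.
  have hv : bd n v = push (Y.incl n) n b + ∑ j ∈ s, push (levelMap (a.char j) (n + 1)) n (z j) := by
    rw [hb, sub_add_cancel]
  -- Replacing `v` by a small chain changes it by a boundary and leaves `bd v` unchanged.
  obtain ⟨w, hw⟩ := exists_sub_bd_mem_smallChains a.isOpen_family a.sUnion_family v fun l => by
    by_cases hl : l + 1 = n + 1
    · obtain rfl : l = n := by omega
      change bd l v ∈ _
      rw [hv]
      exact add_mem (a.push_incl_mem b) (sum_mem fun j _ => a.push_char_mem j (hz j))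
    · rw [HomologicalComplex.shape _ _ _ hl]
      exact zero_mem _
  -- The coordinate in the cell `i` removes `b` and all other summands, leaving the stretched
  -- representative of `m i` as a relative boundary. Stretching is injective on the homology of the
  -- disc, so `m i = 0`.
  have key := a.coord_bd (j := i) hw
  rw [map_sub, bd_bd, sub_zero, hv, map_add, a.coord_push_incl, zero_add, map_sum,
    Finset.sum_eq_single_of_mem i hi fun j _ hj => a.coord_push_char_of_ne hj _,
    a.coord_push_char (hz i), ← relEnd_relClass _ (incl_discStretch n)] at key
  have hmi := (hzm i).map (relEnd _ (incl_discStretch n))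
  rw [key] at hmi
  refine (homologyMap_relEnd_bijective _ (incl_discStretch n) (discStretch_homotopic n) n).1 ?_
  rw [map_zero]
  exact hmi.unique (HomologicalComplex.Represents.of_d _ _)

end CellAttachment

end FiltSpace


/-! ### The cells of a `G`-CW complex -/

namespace GCWComplex

open FiltSpace

variable (G X : Type u) [Group G] [TopologicalSpace X] [T2Space X] [MulAction G X] [GCWComplex G X]

/-- The set of `n`-cells. -/
def Cells (n : ℕ) : Type u := RelCWComplex.cell (Set.univ : Set X) n

instance (n : ℕ) : MulAction G (Cells G X n) := cellAction n

variable {G X} {n : ℕ}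

/-- The characteristic map of a cell. -/
def charFun (j : Cells G X n) (y : Fin n → ℝ) : X := RelCWComplex.map (C := (Set.univ : Set X)) n j y

/-- The inverse of the characteristic map on the open cell. -/
def charInv (j : Cells G X n) (x : X) : Fin n → ℝ :=
  (RelCWComplex.map (C := (Set.univ : Set X)) n j).symm x

/-- The open cell. -/
def openCell (j : Cells G X n) : Set X := RelCWComplex.openCell (C := (Set.univ : Set X)) n j

theorem charFun_smul (g : G) (j : Cells G X n) {y : Fin n → ℝ} (hy : ‖y‖ ≤ 1) :
    charFun (g • j) y = g • charFun j y :=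
  map_smul n g j y (mem_closedBall_zero_iff.2 hy)

theorem charFun_mem_openCell (j : Cells G X n) {y : Fin n → ℝ} (hy : ‖y‖ < 1) :
    charFun j y ∈ openCell j := ⟨y, mem_ball_zero_iff.2 hy, rfl⟩

theorem norm_charInv_lt {j : Cells G X n} {x : X} (hx : x ∈ openCell j) : ‖charInv j x‖ < 1 := by
  obtain ⟨y, hy, rfl⟩ := hx
  have hs : y ∈ (RelCWComplex.map (C := (Set.univ : Set X)) n j).source :=
    (RelCWComplex.source_eq n j).ge hy
  have := (RelCWComplex.map (C := (Set.univ : Set X)) n j).left_inv hs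
  change ‖(RelCWComplex.map (C := (Set.univ : Set X)) n j).symm _‖ < 1
  rw [this]
  exact mem_ball_zero_iff.1 hy

theorem charInv_charFun (j : Cells G X n) {y : Fin n → ℝ} (hy : ‖y‖ < 1) :
    charInv j (charFun j y) = y :=
  (RelCWComplex.map (C := (Set.univ : Set X)) n j).left_inv 
    ((RelCWComplex.source_eq n j).ge (mem_ball_zero_iff.2 hy))

theorem charFun_charInv {j : Cells G X n} {x : X} (hx : x ∈ openCell j) :
    charFun j (charInv j x) = x := by
  obtain ⟨y, hy, rfl⟩ := hx
  exact congrArg (charFun j) (charInv_charFun j (mem_ball_zero_iff.1 hy))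

theorem continuousOn_charInv (j : Cells G X n) : ContinuousOn (charInv j) (openCell j) := by
  refine (RelCWComplex.continuousOn_symm (C := (Set.univ : Set X)) n j).mono ?_
  rintro _ ⟨y, hy, rfl⟩
  exact (RelCWComplex.map (C := (Set.univ : Set X)) n j).map_source 
    ((RelCWComplex.source_eq n j).ge hy)

theorem eq_of_mem_openCell {i j : Cells G X n} {x : X} (hi : x ∈ openCell i)
    (hj : x ∈ openCell j) : i = j := by
  by_contra h
  refine Set.disjoint_left.1 (RelCWComplex.disjoint_openCell_of_ne (C := (Set.univ : Set X))
    (i := i) (j := j) ?_) hi hj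
  intro e
  exact h (eq_of_heq (Sigma.mk.inj e).2)

theorem notMem_openCell_of_mem_skel {x : X} (hx : x ∈ skel G X n) (j : Cells G X n) :
    x ∉ openCell j := fun h =>
  Set.disjoint_left.1 (RelCWComplex.disjoint_skeletonLT_openCell (C := (Set.univ : Set X))
    (n := (n : ℕ∞)) (m := n) (j := j) le_rfl) hx h

theorem charFun_mem_skel_succ (j : Cells G X n) {y : Fin n → ℝ} (hy : ‖y‖ ≤ 1) :
    charFun j y ∈ skel G X (n + 1) := by
  have := RelCWComplex.closedCell_subset_skeletonLT (C := (Set.univ : Set X)) n j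
    ⟨y, mem_closedBall_zero_iff.2 hy, rfl⟩
  exact_mod_cast this

theorem charFun_mem_skel (j : Cells G X n) {y : Fin n → ℝ} (hy : ‖y‖ = 1) :
    charFun j y ∈ skel G X n :=
  RelCWComplex.cellFrontier_subset_skeletonLT (C := (Set.univ : Set X)) n j
    ⟨y, mem_sphere_zero_iff_norm.2 hy, rfl⟩

theorem smul_mem_openCell {j : Cells G X n} {x : X} (g : G) (hx : x ∈ openCell j) :
    g • x ∈ openCell (g • j) := by
  rw [← charFun_charInv hx, ← charFun_smul g j (norm_charInv_lt hx).le]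
  exact charFun_mem_openCell _ (norm_charInv_lt hx)

theorem mem_skel_or_mem_openCell {x : X} (hx : x ∈ skel G X (n + 1)) :
    x ∈ skel G X n ∨ ∃ j : Cells G X n, x ∈ openCell j := by
  obtain ⟨m, hm, j, hj⟩ := CWComplex.mem_skeletonLT_iff.1 hx
  have hm' : m < n + 1 := by exact_mod_cast hm
  rcases Nat.lt_succ_iff_lt_or_eq.1 hm' with h | rfl
  · exact Or.inl (CWComplex.mem_skeletonLT_iff.2 ⟨m, by exact_mod_cast h, j, hj⟩)
  · exact Or.inr ⟨j, hj⟩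

theorem isClosed_skel : IsClosed (skel G X n) :=
  RelCWComplex.Subcomplex.closed (C := (Set.univ : Set X)) _

/-- The characteristic map of a cell as a map of filtered spaces. -/
def charHom (j : Cells G X n) : disc.{u} n ⟶ filt G X :=
  (⟨⟨fun x => charFun (X := X) j x.down.1, by
      refine (RelCWComplex.continuousOn (C := (Set.univ : Set X)) n j).comp_continuous
        (continuous_subtype_val.comp continuous_uliftDown) fun x => ?_
      exact mem_closedBall_zero_iff.2 x.down.2⟩,
    fun k x hx => by
      rcases hx with hx | ⟨rfl, hx⟩
      · exact skel_mono (X := X) (Nat.succ_le_of_lt hx) (charFun_mem_skel_succ (X := X) j x.down.2)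
      · exact charFun_mem_skel (X := X) j hx⟩ : FiltSpace.Hom (disc n) (filt G X))

/-- A subset of the `n`-skeleton is closed if its preimages in the `(n - 1)`-skeleton and in all
`n`-cells are closed. -/
theorem isClosed_of_preimage {A : Set ((filt G X).level (n + 1))}
    (h0 : IsClosed ((filt G X).incl n ⁻¹' A))
    (h1 : ∀ j : Cells G X n, IsClosed (levelMap (charHom j) (n + 1) ⁻¹' A)) : IsClosed A := by
  let B : Set X := Subtype.val '' A
  have hBA : A = Subtype.val ⁻¹' B := (Set.preimage_image_eq _ Subtype.val_injective).symm
  have hB0 : IsClosed (B ∩ skel G X n) := by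
    have : B ∩ skel G X n = Subtype.val '' ((filt G X).incl n ⁻¹' A) := by
      ext x
      constructor
      · rintro ⟨⟨y, hy, rfl⟩, hx⟩
        exact ⟨⟨y.1, hx⟩, hy, rfl⟩
      · rintro ⟨y, hy, rfl⟩
        exact ⟨⟨_, hy, rfl⟩, y.2⟩
    rw [this]
    exact (isClosed_skel (G := G) (X := X)).isClosedEmbedding_subtypeVal.isClosedMap _ h0
  have hB1 : ∀ j : Cells G X n, IsClosed (B ∩ RelCWComplex.closedCell (C := (Set.univ : Set X)) n j) := by
    intro j
    have : B ∩ RelCWComplex.closedCell (C := (Set.univ : Set X)) n j =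
        charFun j '' (Metric.closedBall 0 1 ∩ charFun j ⁻¹' B) := by
      rw [Set.image_inter_preimage, Set.inter_comm]
      rfl
    have h2 : Metric.closedBall 0 1 ∩ charFun j ⁻¹' B =
        discVec '' (levelMap (charHom j) (n + 1) ⁻¹' A) := by
      ext y
      constructor
      · rintro ⟨hy, ⟨z, hz, hzy⟩⟩
        refine ⟨discPoint y (mem_closedBall_zero_iff.1 hy), ?_, rfl⟩
        have : levelMap (charHom j) (n + 1) (discPoint y (mem_closedBall_zero_iff.1 hy)) = z :=
          Subtype.ext hzy.symm
        rw [Set.mem_preimage, this]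
        exact hz
      · rintro ⟨x, hx, rfl⟩
        exact ⟨mem_closedBall_zero_iff.2 (norm_discVec_le x), ⟨_, hx, rfl⟩⟩
    have hcl : IsClosedEmbedding (discVec.{u} (n := n)) := by
      refine ⟨⟨?_, discVec_injective⟩, ?_⟩
      · exact ((IsEmbedding.subtypeVal (p := fun y : Fin n → ℝ => ‖y‖ ≤ 1)).comp
          (Homeomorph.ulift.{u}.isEmbedding.comp
            (IsEmbedding.subtypeVal (p := (· ∈ (disc.{u} n).sk (n + 1)))))).isInducing
      · have : Set.range (discVec.{u} (n := n)) = Metric.closedBall 0 1 := by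
          ext y
          constructor
          · rintro ⟨x, rfl⟩
            exact mem_closedBall_zero_iff.2 (norm_discVec_le x)
          · intro hy
            exact ⟨discPoint y (mem_closedBall_zero_iff.1 hy), rfl⟩
        rw [this]
        exact Metric.isClosed_closedBall
    -- The trace of `B` on a closed `n`-cell is the image of a compact set in a Hausdorff space,
    -- hence closed.
    have hK : IsCompact (Metric.closedBall 0 1 ∩ charFun j ⁻¹' B) := by
      refine (isCompact_closedBall _ _).of_isClosed_subset ?_ Set.inter_subset_left
      rw [h2]
      exact hcl.isClosedMap _ (h1 j)
    rw [this]
    refine (hK.image_of_continuousOn ?_).isClosed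
    exact (RelCWComplex.continuousOn (C := (Set.univ : Set X)) n j).mono Set.inter_subset_left
  have hB : IsClosed B := by
    refine CWComplex.isClosed_of_disjoint_openCell_or_isClosed_inter_closedCell
      (C := (Set.univ : Set X)) (Set.subset_univ _) fun m _ j => ?_
    -- Cells of dimension below `n` lie in the lower skeleton, where `B` is closed; open cells above
    -- dimension `n` do not meet `B`.
    rcases lt_trichotomy m n with hm | rfl | hm
    · right
      have : RelCWComplex.closedCell (C := (Set.univ : Set X)) m j ⊆ skel G X n :=
        (RelCWComplex.closedCell_subset_skeletonLT m j).trans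
          (RelCWComplex.skeletonLT_mono (by exact_mod_cast hm))
      rw [← Set.inter_eq_self_of_subset_right this, ← Set.inter_assoc]
      exact hB0.inter RelCWComplex.isClosed_closedCell
    · exact Or.inr (hB1 j)
    · left
      refine Set.disjoint_of_subset_left ?_ (RelCWComplex.disjoint_skeletonLT_openCell
        (C := (Set.univ : Set X)) (n := ((n + 1 : ℕ) : ℕ∞)) (by exact_mod_cast hm))
      rintro _ ⟨y, -, rfl⟩
      exact y.2
  rw [hBA]
  exact hB.preimage continuous_subtype_val

end GCWComplex


/-! ### Radial stretching and the collar of a skeleton -/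

namespace GCWComplex

open FiltSpace

variable {G X : Type u} [Group G] [TopologicalSpace X] [T2Space X] [MulAction G X] [GCWComplex G X]
variable {n : ℕ}

/-- The point of `X` underlying a point of a skeleton. -/
def point {k : ℕ} (y : (filt G X).level k) : X := y.1

theorem point_mem {k : ℕ} (y : (filt G X).level k) : point y ∈ skel G X k := y.2

theorem point_injective {k : ℕ} : Function.Injective (point (G := G) (X := X) (k := k)) :=
  Subtype.val_injective

theorem continuous_point {k : ℕ} : Continuous (point (G := G) (X := X) (k := k)) :=
  continuous_subtype_val

theorem point_incl (y : (filt G X).level n) : point ((filt G X).incl n y) = point y := rfl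

/-- The point of a skeleton given by a point of `X`. -/
def mkPoint {k : ℕ} (x : X) (hx : x ∈ skel G X k) : (filt G X).level k :=
  (⟨x, hx⟩ : (filt G X).sk k)

/-- If one point is interior to its disc then so is the other, since the sphere maps into the lower
skeleton, which misses all open `n`-cells. Distinct open cells are disjoint, and characteristic maps
are injective on open discs. -/
theorem charHom_injOn {i j : Cells G X n} {x y : (disc.{u} n).level (n + 1)}
    (h : levelMap (charHom i) (n + 1) x = levelMap (charHom j) (n + 1) y) (hy : ‖discVec y‖ < 1) :
    i = j ∧ x = y := by
  have h' : charFun i (discVec x) = charFun j (discVec y) := congrArg point h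
  have hx : ‖discVec x‖ < 1 := by
    refine lt_of_le_of_ne (norm_discVec_le x) fun hx => ?_
    refine notMem_openCell_of_mem_skel (charFun_mem_skel i hx) j ?_
    rw [h']
    exact charFun_mem_openCell j hy
  have hij : i = j := eq_of_mem_openCell (charFun_mem_openCell i hx) (by
    rw [h']; exact charFun_mem_openCell j hy)
  subst hij
  refine ⟨rfl, discVec_injective ?_⟩
  rw [← charInv_charFun i hx, h', charInv_charFun i hy]

theorem exists_charHom_eq {y : (filt G X).level (n + 1)} {j : Cells G X n}
    (hy : point y ∈ openCell j) :
    levelMap (charHom j) (n + 1) (discPoint (charInv j (point y)) (norm_charInv_lt hy).le) = y :=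
  point_injective (charFun_charInv hy)

variable (G) in
open scoped Classical in
/-- The radial stretching of all open `n`-cells. -/
def cellStretch (n : ℕ) (t : ℝ) (x : X) : X :=
  if h : ∃ j : Cells G X n, x ∈ openCell j then
    charFun h.choose (radialStretch t (charInv h.choose x)) else x

theorem cellStretch_of_mem_skel {x : X} (hx : x ∈ skel G X n) (t : ℝ) :
    cellStretch G n t x = x :=
  dif_neg fun ⟨j, hj⟩ => notMem_openCell_of_mem_skel hx j hj

theorem cellStretch_charFun (j : Cells G X n) {y : Fin n → ℝ} (hy : ‖y‖ ≤ 1) {t : ℝ} (ht : 0 ≤ t) :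
    cellStretch G n t (charFun j y) = charFun j (radialStretch t y) := by
  rcases hy.lt_or_eq with h | h
  · have hj := charFun_mem_openCell j h
    have hex : ∃ j' : Cells G X n, charFun j y ∈ openCell j' := ⟨j, hj⟩
    rw [cellStretch, dif_pos hex, eq_of_mem_openCell hex.choose_spec hj, charInv_charFun j h]
  · rw [cellStretch_of_mem_skel (charFun_mem_skel j h), radialStretch_of_norm_eq ht h]

theorem cellStretch_mem_skel {x : X} (hx : x ∈ skel G X (n + 1)) {t : ℝ} (ht : 0 ≤ t) :
    cellStretch G n t x ∈ skel G X (n + 1) := by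
  rcases mem_skel_or_mem_openCell hx with h | ⟨j, h⟩
  · rwa [cellStretch_of_mem_skel h]
  · rw [← charFun_charInv h, cellStretch_charFun j (norm_charInv_lt h).le ht]
    exact charFun_mem_skel_succ j (norm_radialStretch_le ht _)

theorem cellStretch_zero {x : X} (hx : x ∈ skel G X (n + 1)) : cellStretch G n 0 x = x := by
  rcases mem_skel_or_mem_openCell hx with h | ⟨j, h⟩
  · rw [cellStretch_of_mem_skel h]
  · rw [← charFun_charInv h, cellStretch_charFun j (norm_charInv_lt h).le le_rfl,
      radialStretch_zero (norm_charInv_lt h).le]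

theorem cellStretch_smul (g : G) {x : X} (hx : x ∈ skel G X (n + 1)) {t : ℝ} (ht : 0 ≤ t) :
    cellStretch G n t (g • x) = g • cellStretch G n t x := by
  rcases mem_skel_or_mem_openCell hx with h | ⟨j, h⟩
  · rw [cellStretch_of_mem_skel h, cellStretch_of_mem_skel (smul_mem_skel g h)]
  · rw [← charFun_charInv h, cellStretch_charFun j (norm_charInv_lt h).le ht,
      ← charFun_smul g j (norm_charInv_lt h).le, cellStretch_charFun _ (norm_charInv_lt h).le ht,
      ← charFun_smul g j (norm_radialStretch_le ht _)]

variable (G X n) in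
/-- The radial stretching of the `n`-cells as a homotopy. -/
def stretchFun (p : unitInterval × (filt G X).level (n + 1)) : (filt G X).level (n + 1) :=
  mkPoint (cellStretch G n p.1.1 (point p.2)) (cellStretch_mem_skel (point_mem p.2) p.1.2.1)

theorem stretchFun_incl (t : unitInterval) (y : (filt G X).level n) :
    stretchFun G X n (t, (filt G X).incl n y) = (filt G X).incl n y :=
  point_injective (cellStretch_of_mem_skel (point_mem y) _)

theorem stretchFun_char (t : unitInterval) (j : Cells G X n) (x : (disc.{u} n).level (n + 1)) :
    stretchFun G X n (t, levelMap (charHom j) (n + 1) x) = levelMap (charHom j) (n + 1)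
      (discPoint (radialStretch t (discVec x)) (norm_radialStretch_le t.2.1 _)) :=
  point_injective (cellStretch_charFun j (norm_discVec_le x) t.2.1)

theorem continuous_of_comp {Z : Type*} [TopologicalSpace Z] {f : (filt G X).level (n + 1) → Z}
    (h0 : Continuous (f ∘ (filt G X).incl n))
    (h1 : ∀ j : Cells G X n, Continuous (f ∘ levelMap (charHom j) (n + 1))) : Continuous f :=
  continuous_iff_isClosed.2 fun _ hC => isClosed_of_preimage (hC.preimage h0)
    fun j => hC.preimage (h1 j)

/-- Continuity out of the skeleton can be tested on the lower skeleton and the cells, but this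
criterion is not stated for the product with the interval. Currying turns the homotopy into a map
from the skeleton to a space of paths, where the criterion applies; uncurrying uses local
compactness of the interval. -/
theorem continuous_stretchFun : Continuous (stretchFun G X n) := by
  have hdisc : ∀ j : Cells G X n, Continuous
      fun p : (disc.{u} n).level (n + 1) × unitInterval =>
        stretchFun G X n (p.2, levelMap (charHom j) (n + 1) p.1) := by
    intro j
    simp only [stretchFun_char]
    exact (levelMap (charHom j) (n + 1)).hom.continuous.comp (continuous_discPoint
      (continuous_radialStretch.comp ((continuous_subtype_val.comp continuous_snd).prodMk
        (continuous_discVec.comp continuous_fst))) _)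
  have hbase : Continuous fun p : (filt G X).level n × unitInterval =>
      stretchFun G X n (p.2, (filt G X).incl n p.1) := by
    simp only [stretchFun_incl]
    exact ((filt G X).incl n).hom.continuous.comp continuous_fst
  have hcont : ∀ y, Continuous fun t => stretchFun G X n (t, y) := by
    intro y
    rcases mem_skel_or_mem_openCell (point_mem y) with h | ⟨j, h⟩
    · exact hbase.comp (Continuous.prodMk_right (mkPoint (point y) h))
    · rw [← exists_charHom_eq h]
      exact (hdisc j).comp (Continuous.prodMk_right (discPoint _ (norm_charInv_lt h).le))
  let F : (filt G X).level (n + 1) → C(unitInterval, (filt G X).level (n + 1)) :=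
    fun y => ⟨fun t => stretchFun G X n (t, y), hcont y⟩
  have hF : Continuous F := continuous_of_comp
    (ContinuousMap.curry ⟨_, hbase⟩).continuous
    fun j => (ContinuousMap.curry ⟨_, hdisc j⟩).continuous
  exact (ContinuousMap.continuous_uncurry_of_continuous ⟨F, hF⟩).comp continuous_swap

variable (G X n) in
/-- The union of the closed half cells. -/
def core : Set ((filt G X).level (n + 1)) :=
  {y | ∃ (j : Cells G X n) (x : (disc.{u} n).level (n + 1)),
    ‖discVec x‖ ≤ 1 / 2 ∧ levelMap (charHom j) (n + 1) x = y}

/-- The preimage is empty in the lower skeleton and the closed half disc in each disc. The radius `1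
/ 2` matches the stretching factor two. -/
theorem isClosed_core : IsClosed (core G X n) := by
  refine isClosed_of_preimage ?_ fun j => ?_
  · convert isClosed_empty
    refine Set.eq_empty_of_forall_notMem ?_
    rintro y ⟨j, x, hx, h⟩
    refine notMem_openCell_of_mem_skel (point_mem y) j ?_
    rw [← point_incl, ← h]
    exact charFun_mem_openCell j (hx.trans_lt (by norm_num))
  · have : levelMap (charHom j) (n + 1) ⁻¹' core G X n = {x | ‖discVec x‖ ≤ 1 / 2} := by
      ext x
      constructor
      · rintro ⟨i, x', hx', h⟩
        obtain ⟨-, rfl⟩ := charHom_injOn h.symm (hx'.trans_lt (by norm_num))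
        exact hx'
      · intro hx
        exact ⟨j, x, hx, rfl⟩
    rw [this]
    exact isClosed_le continuous_discVec.norm continuous_const

/-- The preimage of the complement is the boundary sphere in the disc of `j`, and everything in the
other discs and in the lower skeleton. -/
theorem isOpen_openCell_level (j : Cells G X n) :
    IsOpen {y : (filt G X).level (n + 1) | point y ∈ openCell j} := by
  rw [← isClosed_compl_iff]
  refine isClosed_of_preimage ?_ fun i => ?_
  · convert isClosed_univ
    exact Set.eq_univ_of_forall fun y => notMem_openCell_of_mem_skel (point_mem y) j
  · by_cases hij : i = j
    · subst hij
      have : levelMap (charHom i) (n + 1) ⁻¹' {y | point y ∈ openCell i}ᶜ = {x | 1 ≤ ‖discVec x‖} := by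
        ext x
        constructor
        · intro hx
          by_contra h
          exact hx (charFun_mem_openCell i (not_le.1 h))
        · intro hx h
          have h' := charHom_injOn (exists_charHom_eq h).symm (norm_charInv_lt h)
          have : ‖discVec x‖ < 1 := by
            rw [h'.2]
            exact norm_charInv_lt h
          exact absurd hx (not_le.2 this)
      rw [this]
      exact isClosed_le continuous_const continuous_discVec.norm
    · convert isClosed_univ
      refine Set.eq_univ_of_forall fun x h => hij ?_
      exact (charHom_injOn (exists_charHom_eq h).symm (norm_charInv_lt h)).1

theorem stretchFun_one_mem {y : (filt G X).level (n + 1)} (hy : y ∉ core G X n) :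
    point (stretchFun G X n (1, y)) ∈ skel G X n := by
  rcases mem_skel_or_mem_openCell (point_mem y) with h | ⟨j, h⟩
  · have := stretchFun_incl 1 (mkPoint (point y) h)
    exact (congrArg point this).symm ▸ h
  · rw [← exists_charHom_eq h, stretchFun_char]
    refine charFun_mem_skel j (norm_radialStretch_eq zero_le_one ?_)
    by_contra h'
    refine hy ⟨j, _, ?_, exists_charHom_eq h⟩
    change 1 ≤ (1 + 1) * ‖discVec _‖ → False at h'
    by_contra h''
    exact h' (by linarith)

variable (G X n) in
/-- The cells of `X` as a cell attachment. -/
def cellAttachment : CellAttachment (filt G X) n (Cells G X n) where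
  char := charHom
  collar := (core G X n)ᶜ
  openCell j := {y | point y ∈ openCell j}
  isOpen_collar := isClosed_core.isOpen_compl
  isOpen_openCell := isOpen_openCell_level
  cover y := by
    by_cases h : y ∈ core G X n
    · obtain ⟨j, x, hx, rfl⟩ := h
      exact Or.inr ⟨j, charFun_mem_openCell j (hx.trans_lt (by norm_num))⟩
    · exact Or.inl h
  mem_collar y hy := by
    rintro ⟨j, x, hx, rfl⟩
    exact notMem_openCell_of_mem_skel (G := G) (X := X) hy j
      (charFun_mem_openCell j (hx.trans_lt (by norm_num)))
  notMem_openCell y j hy := notMem_openCell_of_mem_skel (G := G) (X := X) hy j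
  inv j := ⟨fun y => discPoint (charInv j (point y.1)) (norm_charInv_lt y.2).le,
    continuous_discPoint ((continuousOn_charInv j).comp_continuous
      (continuous_point.comp continuous_subtype_val) fun y => y.2) _⟩
  char_inv j y := exists_charHom_eq y.2
  inv_char j x hx := (charHom_injOn (exists_charHom_eq hx).symm (norm_charInv_lt hx)).2.symm
  eq_of_char_mem i j x hx := (charHom_injOn (exists_charHom_eq hx).symm (norm_charInv_lt hx)).1
  mem_of_char_mem j x hx := by
    rw [mem_disc_sk]
    by_contra h
    exact notMem_openCell_of_mem_skel (G := G) (X := X) hx j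
      (charFun_mem_openCell j (lt_of_le_of_ne (norm_discVec_le x) h))
  stretch := TopCat.ofHom ⟨fun y => stretchFun G X n (1, y),
    continuous_stretchFun.comp (Continuous.prodMk_right _)⟩
  stretch_homotopic := ContinuousMap.Homotopic.symm ⟨⟨⟨_, continuous_stretchFun⟩,
    fun y => point_injective
      (cellStretch_zero (G := G) (X := X) (n := n) (x := point y) (point_mem y)), fun _ => rfl⟩⟩
  incl_stretch := by
    ext y
    exact stretchFun_incl 1 y
  stretch_mem y hy := stretchFun_one_mem (G := G) (X := X) hy
  char_stretch j := by
    ext x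
    exact stretchFun_char 1 j x

/-! ### The cells of the fixed point spaces -/

section MapFilt

variable {S : FinGSet G}

/-- The characteristic map of a cell of the space of equivariant maps. -/
def mapCharHom (i : S.carrier →[G] Cells G X n) : disc.{u} n ⟶ mapFilt G X S :=
  (⟨⟨fun x => ⟨fun s => charFun (X := X) (i s) x.down.1, fun g s =>
        (congrArg (fun j => charFun (X := X) j x.down.1) (_root_.map_smul i g s)).trans
          (charFun_smul g (i s) x.down.2)⟩,
      Continuous.subtype_mk (continuous_pi fun s => (charHom (X := X) (i s)).map.continuous) _⟩,
    fun k _ hx s => (charHom (X := X) (i s)).mapsTo k hx⟩ : FiltSpace.Hom (disc n) (mapFilt G X S))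

theorem mapCharHom_evalHom (i : S.carrier →[G] Cells G X n) (s : S) :
    mapCharHom i ≫ evalHom G X S s = charHom (i s) := rfl

theorem levelMap_eval_mapCharHom (i : S.carrier →[G] Cells G X n) (s : S)
    (x : (disc.{u} n).level (n + 1)) :
    levelMap (evalHom G X S s) (n + 1) (levelMap (mapCharHom i) (n + 1) x) =
      levelMap (charHom (i s)) (n + 1) x := rfl

/-- The point of `X` which is the value of an equivariant map at `s`. -/
def mapPoint {k : ℕ} (f : (mapFilt G X S).level k) (s : S) : X := f.1.1 s

theorem mapPoint_mem {k : ℕ} (f : (mapFilt G X S).level k) (s : S) :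
    mapPoint f s ∈ skel G X k := f.2 s

theorem mapPoint_smul {k : ℕ} (f : (mapFilt G X S).level k) (g : G) (s : S) :
    mapPoint f (g • s) = g • mapPoint f s := f.1.2 g s

theorem mapFilt_level_ext {k : ℕ} {f f' : (mapFilt G X S).level k}
    (h : ∀ s, levelMap (evalHom G X S s) k f = levelMap (evalHom G X S s) k f') : f = f' :=
  Subtype.ext (Subtype.ext (funext fun s => congrArg Subtype.val (h s)))

variable (X S n) in
/-- The radial stretching of the cells of the space of equivariant maps. -/
def mapStretchFun (p : unitInterval × (mapFilt G X S).level (n + 1)) :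
    (mapFilt G X S).level (n + 1) :=
  (⟨⟨fun s => cellStretch G n p.1.1 (mapPoint p.2 s), fun g s =>
      (congrArg (cellStretch G n p.1.1) (mapPoint_smul p.2 g s)).trans
        (cellStretch_smul g (mapPoint_mem p.2 s) p.1.2.1)⟩,
    fun s => cellStretch_mem_skel (mapPoint_mem p.2 s) p.1.2.1⟩ : (mapFilt G X S).sk (n + 1))

/-- The topology on equivariant maps is that of pointwise evaluation, so continuity is inherited
from `X`; no separate verification of the weak topology on fixed point spaces is needed. -/
theorem continuous_mapStretchFun : Continuous (mapStretchFun X n S) := by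
  refine Continuous.subtype_mk (Continuous.subtype_mk (continuous_pi fun s => ?_) _) _
  exact continuous_subtype_val.comp ((continuous_stretchFun (G := G) (X := X) (n := n)).comp
    (continuous_fst.prodMk
      ((levelMap (evalHom G X S s) (n + 1)).hom.continuous.comp continuous_snd)))

variable [MulAction.IsPretransitive G S.carrier]

/-- By transitivity all values of `f` are translates of the one at `s₀`, hence lie in open cells.
These cells are unique, so they depend equivariantly on the point. -/
theorem exists_equivariant_openCell {f : (mapFilt G X S).level (n + 1)} {s₀ : S}
    {j : Cells G X n} (h : mapPoint f s₀ ∈ openCell j) :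
    ∃ i : S.carrier →[G] Cells G X n, ∀ s, mapPoint f s ∈ openCell (i s) := by
  have hex : ∀ s, ∃ j : Cells G X n, mapPoint f s ∈ openCell j := fun s => by
    obtain ⟨g, rfl⟩ := MulAction.exists_smul_eq G s₀ s
    rw [mapPoint_smul]
    exact ⟨_, smul_mem_openCell g h⟩
  choose i hi using hex
  refine ⟨⟨i, fun g s => eq_of_mem_openCell (hi (g • s)) ?_⟩, hi⟩
  rw [mapPoint_smul]
  exact smul_mem_openCell g (hi s)

theorem equivariant_ext {i i' : S.carrier →[G] Cells G X n} (s₀ : S) (h : i s₀ = i' s₀) :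
    i = i' := by
  ext s
  obtain ⟨g, rfl⟩ := MulAction.exists_smul_eq G s₀ s
  rw [_root_.map_smul, _root_.map_smul, h]

variable (X n) in
/-- The cells of the space of equivariant maps from a transitive `G`-set, as a cell attachment. -/
def mapCellAttachment (s₀ : S) :
    CellAttachment (mapFilt G X S) n (S.carrier →[G] Cells G X n) where
  char := mapCharHom
  collar := levelMap (evalHom G X S s₀) (n + 1) ⁻¹' (cellAttachment G X n).collar
  openCell i := levelMap (evalHom G X S s₀) (n + 1) ⁻¹' (cellAttachment G X n).openCell (i s₀)
  isOpen_collar := (cellAttachment G X n).isOpen_collar.preimage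
    (levelMap (evalHom G X S s₀) (n + 1)).hom.continuous
  isOpen_openCell i := ((cellAttachment G X n).isOpen_openCell (i s₀)).preimage
    (levelMap (evalHom G X S s₀) (n + 1)).hom.continuous
  cover f := by
    rcases (cellAttachment G X n).cover (levelMap (evalHom G X S s₀) (n + 1) f) with h | ⟨j, h⟩
    · exact Or.inl h
    · obtain ⟨i, hi⟩ := exists_equivariant_openCell (f := f) (s₀ := s₀) h
      exact Or.inr ⟨i, hi s₀⟩
  mem_collar f hf := (cellAttachment G X n).mem_collar _ (hf s₀)
  notMem_openCell f i hf := (cellAttachment G X n).notMem_openCell _ _ (hf s₀)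
  inv i := ((cellAttachment G X n).inv (i s₀)).comp
    ⟨fun f => ⟨levelMap (evalHom G X S s₀) (n + 1) f.1, f.2⟩,
      ((levelMap (evalHom G X S s₀) (n + 1)).hom.continuous.comp
        continuous_subtype_val).subtype_mk _⟩
  -- The collar, the open cells and the inverses are pulled back along evaluation at `s₀`; the
  -- identities at other points follow by equivariance.
  char_inv i f := by
    refine mapFilt_level_ext fun s => ?_
    rw [levelMap_eval_mapCharHom]
    have h0 := (cellAttachment G X n).char_inv (i s₀) ⟨levelMap (evalHom G X S s₀) (n + 1) f.1, f.2⟩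
    obtain ⟨g, rfl⟩ := MulAction.exists_smul_eq G s₀ s
    set x := (cellAttachment G X n).inv (i s₀) ⟨levelMap (evalHom G X S s₀) (n + 1) f.1, f.2⟩
    have h1 : charFun (i s₀) (discVec x) = mapPoint f.1 s₀ := congrArg point h0
    refine point_injective ?_
    change charFun (i (g • s₀)) (discVec x) = mapPoint f.1 (g • s₀)
    rw [_root_.map_smul, charFun_smul g _ (norm_discVec_le x), h1, mapPoint_smul]
  inv_char i x hx := (cellAttachment G X n).inv_char (i s₀) x hx
  eq_of_char_mem i i' x hx := equivariant_ext s₀ ((cellAttachment G X n).eq_of_char_mem _ _ x hx)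
  mem_of_char_mem i x hx := (cellAttachment G X n).mem_of_char_mem (i s₀) x (hx s₀)
  stretch := TopCat.ofHom ⟨fun f => mapStretchFun X n S (1, f),
    continuous_mapStretchFun.comp (Continuous.prodMk_right _)⟩
  stretch_homotopic := ContinuousMap.Homotopic.symm ⟨⟨⟨_, continuous_mapStretchFun⟩,
    fun f => mapFilt_level_ext fun s => point_injective
      (cellStretch_zero (mapPoint_mem f s)), fun _ => rfl⟩⟩
  incl_stretch := by
    ext f
    exact mapFilt_level_ext fun s =>
      stretchFun_incl (G := G) (X := X) 1 (levelMap (evalHom G X S s) n f)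
  stretch_mem f hf s := by
    obtain ⟨g, rfl⟩ := MulAction.exists_smul_eq G s₀ s
    have h0 := (cellAttachment G X n).stretch_mem _ hf
    change mapPoint (mapStretchFun X n S (1, f)) (g • s₀) ∈ skel G X n
    rw [mapPoint_smul]
    exact smul_mem_skel (X := X) g h0
  char_stretch i := by
    ext x
    exact mapFilt_level_ext fun s => stretchFun_char (G := G) (X := X) 1 (i s) x

end MapFilt

end GCWComplex


/-! ### Values of Mackey functors are determined on orbits -/

namespace FinGSet

variable {G : Type u} [Group G]

theorem hom_ext {S T : FinGSet G} {f g : S ⟶ T} (h : ∀ s, fn f s = fn g s) : f = g :=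
  MulActionHom.ext (f := fn f) (g := fn g) h

theorem exists_inverse {S T : FinGSet G} (f : S ⟶ T) (hf : Function.Bijective (fn f)) :
    ∃ g : T ⟶ S, f ≫ g = 𝟙 S ∧ g ≫ f = 𝟙 T := by
  obtain ⟨k, h1, h2⟩ := Function.bijective_iff_has_inverse.1 hf
  exact ⟨(fn f).inverse k h1 h2, hom_ext h1, hom_ext h2⟩

/-- The map out of a disjoint union. -/
def sumDesc {S T U : FinGSet G} (f : S ⟶ U) (g : T ⟶ U) : sum S T ⟶ U where
  toFun := Sum.elim (fn f) (fn g)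
  map_smul' a := by
    rintro (s | t)
    · exact _root_.map_smul (fn f) a s
    · exact _root_.map_smul (fn g) a t

/-- The map into a product. -/
def lift {S T U : FinGSet G} (f : U ⟶ S) (g : U ⟶ T) : U ⟶ prod S T where
  toFun u := (fn f u, fn g u)
  map_smul' a u := Prod.ext (_root_.map_smul (fn f) a u) (_root_.map_smul (fn g) a u)

/-- The map to the one-point set. -/
def toPt (S : FinGSet G) : S ⟶ pt G where
  toFun _ := PUnit.unit
  map_smul' _ _ := rfl

/-- The finite `G`-set given by an invariant subset. -/
def sub (S : FinGSet G) (A : Set S) (hA : ∀ (g : G), ∀ s ∈ A, g • s ∈ A) : FinGSet G where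
  carrier := A
  mulAction :=
    { smul g s := ⟨g • s.1, hA g s.1 s.2⟩
      one_smul s := Subtype.ext (one_smul G s.1)
      mul_smul g h s := Subtype.ext (mul_smul g h s.1) }

/-- The inclusion of an invariant subset. -/
def subIncl (S : FinGSet G) (A : Set S) (hA : ∀ (g : G), ∀ s ∈ A, g • s ∈ A) :
    S.sub A hA ⟶ S where
  toFun := Subtype.val
  map_smul' _ _ := rfl

/-- The orbit category object `G/G_s`. -/
def stab {S : FinGSet G} (s : S) : OrbitCat G := ⟨MulAction.stabilizer G s⟩

variable [Finite G]

/-- The orbit map `G/G_s → S`. -/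
def stabMap {S : FinGSet G} (s : S) : (stab s).orbit ⟶ S where
  toFun := MulAction.ofQuotientStabilizer G s
  map_smul' g x := MulAction.ofQuotientStabilizer_smul G s g x

theorem fn_stabMap_base {S : FinGSet G} (s : S) : fn (stabMap s) (stab s).base = s :=
  one_smul G s

theorem fn_stabMap_injective {S : FinGSet G} (s : S) : Function.Injective (fn (stabMap s)) :=
  MulAction.injective_ofQuotientStabilizer G s

theorem range_fn_stabMap {S : FinGSet G} (s : S) :
    Set.range (fn (stabMap s)) = MulAction.orbit G s := by
  ext t
  constructor
  · rintro ⟨x, rfl⟩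
    obtain ⟨g, rfl⟩ := (stab s).exists_smul_base x
    exact ⟨g, by rw [_root_.map_smul, fn_stabMap_base]⟩
  · rintro ⟨g, rfl⟩
    exact ⟨g • (stab s).base, by rw [_root_.map_smul, fn_stabMap_base]⟩

/-- A map from an orbit to a disjoint union factors through one of the summands. -/
theorem orbit_sum_cases {S T : FinGSet G} {O : OrbitCat G} (f : O.orbit ⟶ sum S T) :
    (∃ f' : O.orbit ⟶ S, f = f' ≫ inl S T) ∨ (∃ f' : O.orbit ⟶ T, f = f' ≫ inr S T) := by
  have key : ∀ x, ∃ g : G, fn f x = g • fn f O.base := fun x => by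
    obtain ⟨g, rfl⟩ := O.exists_smul_base x
    exact ⟨g, _root_.map_smul (fn f) g _⟩
  rcases hb : fn f O.base with s | t
  · left
    have : ∀ x, ∃ s', fn f x = Sum.inl s' := fun x => by
      obtain ⟨g, hg⟩ := key x
      exact ⟨g • s, by rw [hg, hb]; rfl⟩
    choose k hk using this
    refine ⟨(⟨k, fun g x => Sum.inl_injective (β := T) ?_⟩ : O.orbit.carrier →[G] S.carrier), hom_ext hk⟩
    rw [← hk]
    exact (_root_.map_smul (fn f) g x).trans (by rw [hk]; rfl)
  · right
    have : ∀ x, ∃ s', fn f x = Sum.inr s' := fun x => by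
      obtain ⟨g, hg⟩ := key x
      exact ⟨g • t, by rw [hg, hb]; rfl⟩
    choose k hk using this
    refine ⟨(⟨k, fun g x => Sum.inr_injective (α := S) ?_⟩ : O.orbit.carrier →[G] T.carrier), hom_ext hk⟩
    rw [← hk]
    exact (_root_.map_smul (fn f) g x).trans (by rw [hk]; rfl)

end FinGSet

namespace MackeyFunctor

open FinGSet

variable {G : Type u} [Group G] [Finite G] (D : MackeyFunctor G)

/-- A compatible family of elements of the values of `D` at the orbits over `S`. -/
def IsOrbitFamily {S : FinGSet G} (y : ∀ O : OrbitCat G, (O.orbit ⟶ S) → D.obj O.orbit) : Prop :=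
  ∀ ⦃O P : OrbitCat G⦄ (h : O.orbit ⟶ P.orbit) (f : P.orbit ⟶ S), y O (h ≫ f) = D.res h (y P f)

/-- Compatible families over `S` are the same as elements of `D(S)`. -/
def GluesOrbits (S : FinGSet G) : Prop :=
  ∀ y : ∀ O : OrbitCat G, (O.orbit ⟶ S) → D.obj O.orbit, D.IsOrbitFamily y →
    ∃! z : D.obj S, ∀ (O : OrbitCat G) (f : O.orbit ⟶ S), D.res f z = y O f

/-- The two inclusions of the empty set in its double coincide, while additivity lets the two
restrictions be prescribed arbitrarily. -/
theorem subsingleton_obj (S : FinGSet G) [IsEmpty S] : Subsingleton (D.obj S) := by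
  refine ⟨fun a b => ?_⟩
  obtain ⟨z, hz⟩ := (D.additive S S).2 (a, b)
  have h : inl S S = inr S S := hom_ext fun s => isEmptyElim s
  have h1 : D.res (inl S S) z = a := congrArg Prod.fst hz
  have h2 : D.res (inr S S) z = b := congrArg Prod.snd hz
  rw [← h1, ← h2, h]

theorem GluesOrbits.empty (S : FinGSet G) [IsEmpty S] : D.GluesOrbits S := by
  intro y _
  have := D.subsingleton_obj S
  exact ⟨0, fun O f => isEmptyElim (fn f O.base), fun z _ => Subsingleton.elim _ _⟩

theorem GluesOrbits.orbit (O : OrbitCat G) : D.GluesOrbits O.orbit := by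
  intro y hy
  refine ⟨y O (𝟙 _), fun P f => ?_, fun z hz => ?_⟩
  · rw [← hy, Category.comp_id]
  · rw [← hz, D.res_id]

variable {D}

theorem IsOrbitFamily.precomp {S T : FinGSet G}
    {y : ∀ O : OrbitCat G, (O.orbit ⟶ T) → D.obj O.orbit} (hy : D.IsOrbitFamily y) (k : S ⟶ T) :
    D.IsOrbitFamily (fun O (f : O.orbit ⟶ S) => y O (f ≫ k)) := fun O P h f => by
  dsimp only
  rw [Category.assoc, hy]

theorem GluesOrbits.sum {S T : FinGSet G} (hS : D.GluesOrbits S) (hT : D.GluesOrbits T) :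
    D.GluesOrbits (FinGSet.sum S T) := by
  intro y hy
  obtain ⟨a, ha, ha'⟩ := hS _ (hy.precomp (inl S T))
  obtain ⟨b, hb, hb'⟩ := hT _ (hy.precomp (inr S T))
  obtain ⟨z, hz⟩ := (D.additive S T).2 (a, b)
  have h1 : D.res (inl S T) z = a := congrArg Prod.fst hz
  have h2 : D.res (inr S T) z = b := congrArg Prod.snd hz
  refine ⟨z, fun O f => ?_, fun w hw => (D.additive S T).1 (Prod.ext ?_ ?_)⟩
  · rcases orbit_sum_cases f with ⟨f, rfl⟩ | ⟨f, rfl⟩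
    · rw [D.res_comp, h1, ha]
    · rw [D.res_comp, h2, hb]
  · refine (ha' _ fun O f => ?_).trans h1.symm
    change D.res f (D.res _ w) = _
    rw [← D.res_comp, hw]
  · refine (hb' _ fun O f => ?_).trans h2.symm
    change D.res f (D.res _ w) = _
    rw [← D.res_comp, hw]

theorem GluesOrbits.of_bijective {S T : FinGSet G} (hS : D.GluesOrbits S) (k : S ⟶ T)
    (hk : Function.Bijective (fn k)) : D.GluesOrbits T := by
  intro y hy
  obtain ⟨l, hl, hl'⟩ := exists_inverse k hk
  obtain ⟨a, ha, ha'⟩ := hS _ (hy.precomp k)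
  refine ⟨D.res l a, fun O f => ?_, fun w hw => ?_⟩
  · rw [← D.res_comp, ha, Category.assoc, hl', Category.comp_id]
  · rw [← ha' (D.res k w) (fun O f => by rw [← D.res_comp, hw]), ← D.res_comp, hl', D.res_id]

-- Induction on the cardinality of `S`: a nonempty `S` is the disjoint union of an orbit and a
-- smaller invariant subset, and additivity combines the two.
variable (D) in
theorem gluesOrbits (S : FinGSet G) : D.GluesOrbits S := by
  induction h : Nat.card S using Nat.strong_induction_on generalizing S with
  | _ n ih =>
    rcases isEmpty_or_nonempty S with hS | ⟨⟨s⟩⟩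
    · exact GluesOrbits.empty D S
    · have hA : ∀ (g : G), ∀ t ∈ (MulAction.orbit G s)ᶜ, g • t ∈ (MulAction.orbit G s)ᶜ :=
        fun g t ht h => ht (by
          simpa using MulAction.mem_orbit_of_mem_orbit g⁻¹ h)
      refine ((GluesOrbits.orbit D (stab s)).sum
        (ih (Nat.card (S.sub _ hA)) ?_ (S.sub _ hA) rfl)).of_bijective
          (sumDesc (stabMap s) (S.subIncl _ hA)) ?_
      · rw [← h]
        exact (Set.ncard_lt_card (s := (MulAction.orbit G s)ᶜ)
          (fun h => (h.symm ▸ Set.mem_univ s : s ∈ (MulAction.orbit G s)ᶜ)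
            (MulAction.mem_orbit_self s)))
      · constructor
        · refine Function.Injective.sumElim (fn_stabMap_injective s) Subtype.val_injective ?_
          intro a b hab
          refine b.2 ?_
          have : fn (stabMap s) a ∈ MulAction.orbit G s := by
            rw [← range_fn_stabMap]
            exact ⟨a, rfl⟩
          rwa [show fn (stabMap s) a = b.1 from hab] at this
        · intro t
          by_cases ht : t ∈ MulAction.orbit G s
          · rw [← range_fn_stabMap] at ht
            obtain ⟨x, hx⟩ := ht
            exact ⟨Sum.inl x, hx⟩
          · exact ⟨Sum.inr ⟨t, ht⟩, rfl⟩

theorem ext_orbit {S : FinGSet G} {a b : D.obj S}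
    (h : ∀ (O : OrbitCat G) (f : O.orbit ⟶ S), D.res f a = D.res f b) : a = b :=
  (D.gluesOrbits S (fun _ f => D.res f b) fun _ _ h f => D.res_comp h f b).unique h
    fun _ _ => rfl

end MackeyFunctor

/-! ### Modules over the constant Green functor -/

namespace GreenModule

open FinGSet

variable {G : Type u} [Group G] (D : ConstModule G)

/-- The action of the invariant integral functions on `S` on the value of a module at `S`. -/
def smulFun {S : FinGSet G} (y : D.obj S) (a : (constGreen G).obj S) : D.obj S :=
  D.res (FinGSet.lift (𝟙 S) (𝟙 S)) (D.act.map S S y a)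

theorem res_lift_act {S T U : FinGSet G} (f : U ⟶ S) (g : U ⟶ T) (y : D.obj S)
    (a : (constGreen G).obj T) :
    D.res (FinGSet.lift f g) (D.act.map S T y a) =
      D.smulFun (D.res f y) ((constGreen G).res g a) := by
  have h := D.act.map_res f g y a
  rw [smulFun, h, ← D.res_comp]
  rfl

theorem res_smulFun {S T : FinGSet G} (f : S ⟶ T) (y : D.obj T)
    (a : (constGreen G).obj T) :
    D.res f (D.smulFun y a) = D.smulFun (D.res f y) ((constGreen G).res f a) := by
  rw [← res_lift_act, smulFun, ← D.res_comp]
  rfl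

/-- A constant function is an integral multiple of the restricted unit, which acts as the identity.
-/
theorem smulFun_eq_zsmul {S : FinGSet G} (y : D.obj S) (a : (constGreen G).obj S)
    (c : ℤ) 
    (ha : ∀ s, (show equivariantMaps (trivialInt G) S from a).1 s = ⟨c⟩) : D.smulFun y a = c • y := by
  have h : a = c • (constGreen G).res (toPt S) (constGreen G).one := by
    apply Subtype.ext
    funext s
    refine (ha s).trans ?_
    change _ = c • (⟨1⟩ : ULift.{u} ℤ)
    apply ULift.ext
    change c = c • (1 : ℤ)
    simp
  have h1 := D.act.map_res (𝟙 S) (toPt S) y (constGreen G).one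
  rw [D.act_one, D.res_id, ← D.res_comp] at h1
  rw [smulFun, h, map_zsmul, map_zsmul]
  congr 1
  refine (congrArg _ h1).trans ?_
  rw [← D.res_comp]
  exact D.res_id S y

/-- The projection formula. -/
theorem tr_smulFun {S T : FinGSet G} (p : S ⟶ T) (y : D.obj T)
    (a : (constGreen G).obj S) :
    D.tr p (D.smulFun (D.res p y) a) = D.smulFun y ((constGreen G).tr p a) := by
  have h := D.act.map_tr (𝟙 T) p y a
  rw [D.tr_id] at h
  change _ = D.res _ _
  -- Base change along the diagonal of `T`: the pullback of `id × p : T × S → T × T` is `S`,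
  -- embedded in `T × S` as the graph of `p`.
  rw [h, D.baseChange (FinGSet.lift p (𝟙 S)) p _ _ ⟨rfl, ?_⟩, D.res_lift_act p (𝟙 S) y a]
  · rfl
  · rintro ⟨t, s⟩ t' hst
    have h1 : t = t' := congrArg Prod.fst hst
    have h2 : fn p s = t' := congrArg Prod.snd hst
    refine ⟨s, ⟨Prod.ext (h2.trans h1.symm) rfl, h2⟩, fun s' hs' => congrArg Prod.snd hs'.1⟩

theorem exists_eq_const [Finite G] {O : OrbitCat G} (a : (constGreen G).obj O.orbit) :
    ∃ c : ℤ, ∀ s, (show equivariantMaps (trivialInt G) O.orbit from a).1 s = ⟨c⟩ := by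
  refine ⟨((show equivariantMaps (trivialInt G) O.orbit from a).1 O.base).down, fun s => ?_⟩
  obtain ⟨g, rfl⟩ := O.exists_smul_base s
  exact (show equivariantMaps (trivialInt G) O.orbit from a).2 g O.base

variable {D}

/-- A morphism of the underlying Mackey functors is a morphism of modules. -/
def homOfMackey [Finite G] {M N : ConstModule G}
    (f : M.toMackeyFunctor.Hom N.toMackeyFunctor) : M ⟶ N :=
  ({ toHom := f
     app_act := fun S T m a => by
      refine N.toMackeyFunctor.ext_orbit fun O k => ?_
      -- After restriction to an orbit the coefficient is a constant integer, and every additive map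
      -- commutes with integers.
      have hk : k = FinGSet.lift (k ≫ fst S T) (k ≫ snd S T) := rfl
      obtain ⟨c, hc⟩ := exists_eq_const ((constGreen G).res (k ≫ snd S T) a)
      rw [← f.app_res, hk]
      refine (congrArg _ (M.res_lift_act _ _ m a)).trans
        (Eq.trans ?_ (N.res_lift_act _ _ (f.app S m) a).symm)
      rw [smulFun_eq_zsmul _ _ _ _ hc, smulFun_eq_zsmul _ _ _ _ hc, map_zsmul, f.app_res] } : GreenModule.Hom M N)

end GreenModule


/-! ### Morphisms out of the fixed points of an induced module -/

open FinGSet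

/-- The invariant functions on `S` with values in `M`. -/
abbrev InvFun {G : Type u} [Group G] (M : Type u) [AddCommGroup M] (S : FinGSet G) :
    AddSubgroup (S → M) :=
  equivariantMaps (1 : G →* AddMonoid.End M) S

namespace InvFun

variable {G : Type u} [Group G] {M : Type u} [AddCommGroup M] {S T : FinGSet G}

/-- The constant function. -/
def const (S : FinGSet G) (μ : M) : InvFun M S := ⟨fun _ => μ, fun _ _ => rfl⟩

/-- The multiple of an element of `M` by an integral function. -/
def scale (a : InvFun (ULift.{u} ℤ) S) (μ : M) : InvFun M S :=
  ⟨fun s => (a.1 s).down • μ, fun g s =>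
    congrArg (fun z : ULift.{u} ℤ => z.down • μ) (a.2 g s)⟩

open scoped Classical in
/-- The indicator function of a level set. -/
def levelSet (m : InvFun M S) (μ : M) : InvFun (ULift.{u} ℤ) S :=
  ⟨fun s => ⟨if m.1 s = μ then 1 else 0⟩, fun g s =>
    congrArg (fun z => (⟨if z = μ then 1 else 0⟩ : ULift.{u} ℤ)) (m.2 g s)⟩

theorem apply_eq_of_orbit [Finite G] {O : OrbitCat G} (m : InvFun M O.orbit) (s : O.orbit) :
    m.1 s = m.1 O.base := by
  obtain ⟨g, rfl⟩ := O.exists_smul_base s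
  exact m.2 g O.base

-- Splitting `m` by its finitely many values reduces statements about `m` to constant functions
-- multiplied by integral ones, to which the projection formula applies.
open scoped Classical in
theorem sum_scale_levelSet (m : InvFun M S) :
    ∑ μ ∈ Finset.univ.image m.1, scale (levelSet m μ) μ = m := by
  apply Subtype.ext
  funext s
  rw [AddSubgroup.val_finsetSum, Finset.sum_apply]
  change ∑ μ ∈ Finset.univ.image m.1, (if m.1 s = μ then (1 : ℤ) else 0) • μ = m.1 s
  rw [Finset.sum_eq_single (m.1 s)]
  · simp
  · intro μ _ h
    rw [if_neg h.symm, zero_smul]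
  · intro h
    exact (h (Finset.mem_image_of_mem _ (Finset.mem_univ s))).elim

theorem tr_scale (g : S ⟶ T) (a : InvFun (ULift.{u} ℤ) S) (μ : M) :
    equivariantMaps.tr 1 g (scale a μ) = scale (equivariantMaps.tr 1 g a) μ := by
  classical
  apply Subtype.ext
  funext t
  change ∑ s : S with fn g s = t, (a.1 s).down • μ = (∑ s : S with fn g s = t, a.1 s).down • μ
  have hd : (∑ s : S with fn g s = t, a.1 s).down = ∑ s : S with fn g s = t, (a.1 s).down :=
    map_sum (AddEquiv.ulift : ULift.{u} ℤ ≃+ ℤ) _ _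
  rw [hd, Finset.sum_smul]

end InvFun

/-- A natural family of homomorphisms from `M` to the values of `D` at the orbits over `J`. -/
structure OrbitValues {G : Type u} [Group G] [Finite G] (J M : Type u) [MulAction G J]
    [AddCommGroup M] (D : MackeyFunctor G) where
  val : ∀ O : OrbitCat G, (O.orbit.carrier →[G] J) → M →+ D.obj O.orbit
  val_comp : ∀ {O P : OrbitCat G} (h : O.orbit ⟶ P.orbit) (i : P.orbit.carrier →[G] J) (m : M),
    val O (i.comp (fn h)) m = D.res h (val P i m)

namespace OrbitValues

variable {G : Type u} [Group G] [Finite G] {J M : Type u} [MulAction G J] [AddCommGroup M]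

section Mackey

variable {D : MackeyFunctor G} (v : OrbitValues J M D) {R S : FinGSet G}

theorem existsUnique_glue (i : R.carrier →[G] J) (m : InvFun M R) :
    ∃! z : D.obj R, ∀ (O : OrbitCat G) (f : O.orbit ⟶ R),
      D.res f z = v.val O (i.comp (fn f)) (m.1 (fn f O.base)) := by
  refine D.gluesOrbits R (fun O f => v.val O (i.comp (fn f)) (m.1 (fn f O.base))) ?_
  intro O P h f
  have hm := InvFun.apply_eq_of_orbit (equivariantMaps.res 1 f m) (fn h O.base)
  change m.1 (fn f (fn h O.base)) = m.1 (fn f P.base) at hm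
  dsimp only
  rw [fn_comp, hm, ← v.val_comp]
  rfl

/-- The extension of a family of values on orbits to all finite `G`-sets over `J`. -/
def glue (i : R.carrier →[G] J) : InvFun M R →+ D.obj R :=
  AddMonoidHom.mk' (fun m => (v.existsUnique_glue i m).choose) fun m m' =>
    D.ext_orbit fun O f => by
      rw [map_add, (v.existsUnique_glue i m).choose_spec.1,
        (v.existsUnique_glue i m').choose_spec.1, (v.existsUnique_glue i (m + m')).choose_spec.1,
        ← map_add]
      rfl

theorem res_glue_orbit (i : R.carrier →[G] J) (m : InvFun M R) {O : OrbitCat G}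
    (f : O.orbit ⟶ R) :
    D.res f (v.glue i m) = v.val O (i.comp (fn f)) (m.1 (fn f O.base)) :=
  (v.existsUnique_glue i m).choose_spec.1 O f

theorem res_glue (f : S ⟶ R) (i : R.carrier →[G] J) (m : InvFun M R) :
    D.res f (v.glue i m) = v.glue (i.comp (fn f)) (equivariantMaps.res 1 f m) :=
  D.ext_orbit fun O k => by
    rw [← D.res_comp, res_glue_orbit, res_glue_orbit]
    rfl

theorem glue_orbit {O : OrbitCat G} (i : O.orbit.carrier →[G] J) (m : M) :
    v.glue i (InvFun.const _ m) = v.val O i m := by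
  rw [← D.res_id _ (v.glue i _), res_glue_orbit]
  rfl

end Mackey

variable {D : ConstModule G} (v : OrbitValues J M D.toMackeyFunctor) {P R S : FinGSet G}

theorem glue_scale (i : R.carrier →[G] J) (a : InvFun (ULift.{u} ℤ) R) (μ : M) :
    v.glue i (InvFun.scale a μ) = D.smulFun (v.glue i (InvFun.const R μ))
      (show (constGreen G).obj R from a) := by
  refine D.toMackeyFunctor.ext_orbit fun O f => ?_
  refine Eq.trans ?_ (D.res_smulFun f _ _).symm
  rw [D.smulFun_eq_zsmul _ _ (a.1 (fn f O.base)).down, res_glue_orbit,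
    res_glue_orbit, ← map_zsmul]
  · rfl
  · exact InvFun.apply_eq_of_orbit (equivariantMaps.res 1 f a)

/-- This is where the module structure on `D` is indispensable. For a single value `μ`, the glued
constant on `P` is restricted from `R`, so the projection formula moves the transfer onto the
integral coefficient; the general case is a sum of these. -/
theorem tr_glue (g : P ⟶ R) (i : R.carrier →[G] J) (m : InvFun M P) :
    D.tr g (v.glue (i.comp (fn g)) m) = v.glue i (equivariantMaps.tr 1 g m) := by
  rw [← InvFun.sum_scale_levelSet m, map_sum, map_sum, map_sum, map_sum]
  refine Finset.sum_congr rfl fun μ _ => ?_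
  have h : v.glue (i.comp (fn g)) (InvFun.const P μ) = D.res g (v.glue i (InvFun.const R μ)) :=
    (v.res_glue g i (InvFun.const R μ)).symm
  rw [glue_scale, InvFun.tr_scale, glue_scale, h]
  exact D.tr_smulFun g _ _

end OrbitValues

/-! ### Induced modules -/

/-- The `G`-module `N` is the direct sum of copies of `M` indexed by the `G`-set `J`. -/
structure InducedModule {G : Type u} [Group G] (J M : Type u) {N : Type u} [MulAction G J]
    [AddCommGroup M] [AddCommGroup N] (ρ : G →* AddMonoid.End N) where
  equiv : (J →₀ M) ≃+ N
  equiv_single : ∀ (g : G) (j : J) (m : M),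
    ρ g (equiv (Finsupp.single j m)) = equiv (Finsupp.single (g • j) m)

namespace InducedModule

variable {G : Type u} [Group G] [Finite G] {J M N : Type u} [MulAction G J]
  [AddCommGroup M] [AddCommGroup N] {ρ : G →* AddMonoid.End N} (I : InducedModule J M ρ)
  {P R S : FinGSet G}

theorem symm_apply_smul (g : G) (x : N) (j : J) :
    I.equiv.symm (ρ g x) (g • j) = I.equiv.symm x j := by
  obtain ⟨y, rfl⟩ := I.equiv.surjective x
  rw [I.equiv.symm_apply_apply]
  induction y using Finsupp.induction_linear with
  | zero => simp
  | add y z hy hz => rw [map_add, map_add, map_add, Finsupp.add_apply, hy, hz, Finsupp.add_apply]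
  | single k m =>
    classical
    rw [I.equiv_single, I.equiv.symm_apply_apply, Finsupp.single_apply, Finsupp.single_apply]
    simp only [smul_left_cancel_iff]

/-- The equivariant map `r ↦ m r` in the summand of index `i r`. -/
def present (i : R.carrier →[G] J) (m : InvFun M R) : equivariantMaps ρ R :=
  ⟨fun r => I.equiv (Finsupp.single (i r) (m.1 r)), fun g r => by
    dsimp only
    rw [I.equiv_single, _root_.map_smul, show m.1 (g • r) = m.1 r from m.2 g r]⟩

variable (G) in
/-- The invariant subset generated by a finite set. -/
def hull (T : Finset J) : FinGSet G where
  carrier := {j : J // ∃ g : G, ∃ t ∈ T, g • t = j}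
  mulAction :=
    { smul g j := ⟨g • j.1, by
        obtain ⟨h, t, ht, hj⟩ := j.2
        exact ⟨g * h, t, ht, by rw [mul_smul, hj]⟩⟩
      one_smul j := Subtype.ext (one_smul G j.1)
      mul_smul g h j := Subtype.ext (mul_smul g h j.1) }
  finite := by
    have : Finite (G × T) := inferInstance
    refine Finite.of_surjective (fun p : G × T =>
      (⟨p.1 • p.2.1, p.1, p.2.1, p.2.2, rfl⟩ : {j : J // ∃ g : G, ∃ t ∈ T, g • t = j})) ?_
    rintro ⟨_, g, t, ht, rfl⟩
    exact ⟨(g, ⟨t, ht⟩), rfl⟩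

/-- The inclusion of the invariant subset generated by a finite set. -/
def hullIncl (T : Finset J) : (hull G T).carrier →[G] J where
  toFun := Subtype.val
  map_smul' _ _ := rfl

/-- The index of a point of `S × T`. -/
def index (S : FinGSet G) (T : Finset J) : (S.prod (hull G T)).carrier →[G] J :=
  (hullIncl T).comp (fn (snd S (hull G T)))

/-- The coordinates of an equivariant map. -/
def coord (T : Finset J) (S : FinGSet G) :
    equivariantMaps ρ S →+ InvFun M (S.prod (hull G T)) :=
  AddMonoidHom.mk' (fun x => ⟨fun p => I.equiv.symm (x.1 p.1) p.2.1, fun g p => by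
      change I.equiv.symm (x.1 (g • p.1)) (g • p.2.1) = _
      rw [x.2, symm_apply_smul]; rfl⟩) fun x y => by
    apply Subtype.ext
    funext p
    change I.equiv.symm (x.1 p.1 + y.1 p.1) p.2.1 = _
    rw [map_add]
    rfl

open scoped Classical in
/-- The indices of the nonzero coordinates of an equivariant map. -/
def supp (x : equivariantMaps ρ S) : Finset J :=
  Finset.univ.biUnion fun s => (I.equiv.symm (x.1 s)).support

theorem mem_supp {x : equivariantMaps ρ S} {j : J} {s : S} (h : I.equiv.symm (x.1 s) j ≠ 0) :
    j ∈ I.supp x := by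
  classical
  exact Finset.mem_biUnion.2 ⟨s, Finset.mem_univ _, Finsupp.mem_support_iff.2 h⟩

theorem supp_res_subset (f : R ⟶ S) (x : equivariantMaps ρ S) :
    I.supp (equivariantMaps.res ρ f x) ⊆ I.supp x := by
  classical
  intro j hj
  obtain ⟨s, _, hs⟩ := Finset.mem_biUnion.1 hj
  exact I.mem_supp (Finsupp.mem_support_iff.1 hs)

/-- Summing over the fibre of `S × F → S` at `s`, where `F` is the hull of `T`, reassembles `x s`
from its coordinates; none is lost because the support lies in `T`. -/
theorem tr_present_coord (T : Finset J) (x : equivariantMaps ρ S) (hT : I.supp x ⊆ T) :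
    equivariantMaps.tr ρ (fst S (hull G T)) (I.present (index S T) (I.coord T S x)) = x := by
  classical
  apply Subtype.ext
  funext s
  apply I.equiv.symm.injective
  ext j
  change I.equiv.symm (∑ r : S.prod (hull G T) with fn (fst _ _) r = s,
    I.equiv (Finsupp.single (index S T r) (I.equiv.symm (x.1 (fn (fst _ _) r)) (index S T r)))) j = _
  rw [map_sum, Finsupp.finsetSum_apply]
  simp only [AddEquiv.symm_apply_apply, Finsupp.single_apply]
  by_cases hj : j ∈ T
  · rw [Finset.sum_eq_single (show (S.prod (hull G T)).carrier from
      (s, (⟨j, 1, j, hj, one_smul _ _⟩ : hull G T)))]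
    · exact if_pos rfl
    · rintro ⟨s', j'⟩ hr hne
      refine if_neg fun h => hne (Prod.ext (Finset.mem_filter.1 hr).2 (Subtype.ext h))
    · intro h
      exact (h (Finset.mem_filter.2 ⟨Finset.mem_univ _, rfl⟩)).elim
  · have h0 : I.equiv.symm (x.1 s) j = 0 := by
      by_contra h
      exact hj (hT (I.mem_supp h))
    rw [h0]
    refine Finset.sum_eq_zero fun r hr => ?_
    split_ifs with h
    · rw [(Finset.mem_filter.1 hr).2, h, h0]
    · rfl

section Extend

variable {D : ConstModule G} (v : OrbitValues J M D.toMackeyFunctor)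

/-- The extension of a family of values, in terms of the coordinates in a finite set. -/
def extendOn (T : Finset J) (S : FinGSet G) : equivariantMaps ρ S →+ D.obj S :=
  (D.tr (fst S (hull G T))).comp ((v.glue (index S T)).comp (I.coord T S))

/-- Any presentation of an element as a transfer gives the same value. The pair `(p, i)` maps `P` to
`S × F`, with `F` the hull of `T`, and `tr p` factors through it; `tr_glue` pushes the data to `S ×
F`, where the transferred function is the coordinate function of the presented element. -/
theorem tr_glue_eq_extendOn (T : Finset J) (p : P ⟶ S) (i : P.carrier →[G] J) (m : InvFun M P)
    (hi : ∀ r, i r ∈ Set.range (hullIncl (G := G) T)) :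
    D.tr p (v.glue i m) = I.extendOn v T S (equivariantMaps.tr ρ p (I.present i m)) := by
  classical
  choose k hk using hi
  let i' : P ⟶ hull G T := (⟨k, fun g r => Subtype.ext (by
    change hullIncl T _ = g • hullIncl T _
    rw [hk, hk, _root_.map_smul]) ⟩ : P.carrier →[G] (hull G T).carrier)
  have hi : i = (index S T).comp (fn (FinGSet.lift p i')) := MulActionHom.ext fun r => (hk r).symm
  change _ = D.tr _ (v.glue _ (I.coord T S _))
  conv_lhs => rw [hi, show p = FinGSet.lift p i' ≫ fst S (hull G T) from rfl]
  rw [D.tr_comp]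
  refine congrArg _ ((v.tr_glue _ _ _).trans (congrArg _ ?_))
  apply Subtype.ext
  funext q
  change ∑ r : P with (fn p r, fn i' r) = q, m.1 r = I.equiv.symm (∑ r : P with fn p r = q.1,
    I.equiv (Finsupp.single (i r) (m.1 r))) q.2.1
  rw [map_sum, Finsupp.finsetSum_apply]
  simp only [AddEquiv.symm_apply_apply, Finsupp.single_apply]
  rw [← Finset.sum_filter, Finset.filter_filter]
  refine Finset.sum_congr (Finset.filter_congr fun r _ => ?_) fun _ _ => rfl
  rw [← hk r]
  exact ⟨fun h => h ▸ ⟨rfl, rfl⟩, fun h => Prod.ext h.1 (Subtype.ext h.2)⟩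

/-- The extension of a family of values on orbits to all equivariant maps. -/
def extendFun (x : equivariantMaps ρ S) : D.obj S := I.extendOn v (I.supp x) S x

theorem extendOn_eq (T : Finset J) (x : equivariantMaps ρ S) (hT : I.supp x ⊆ T) :
    I.extendOn v T S x = I.extendFun v x := by
  have h := I.tr_glue_eq_extendOn v T (fst S (hull G (I.supp x))) (index S (I.supp x))
    (I.coord (I.supp x) S x) (by
      rintro ⟨s, j, g, t, ht, hj⟩
      exact ⟨⟨j, g, t, hT ht, hj⟩, rfl⟩)
  rw [I.tr_present_coord _ x (Finset.Subset.refl _)] at h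
  exact h.symm

theorem tr_glue_eq (p : P ⟶ S) (i : P.carrier →[G] J) (m : InvFun M P) :
    D.tr p (v.glue i m) = I.extendFun v (equivariantMaps.tr ρ p (I.present i m)) := by
  classical
  -- The finite set must contain the indices used by `i` as well as the support of the result, which
  -- can be smaller because of cancellation.
  rw [← I.extendOn_eq v (Finset.univ.image i ∪ I.supp _) _ Finset.subset_union_right]
  refine I.tr_glue_eq_extendOn v _ p i m fun r => ?_
  exact ⟨⟨i r, 1, i r, Finset.mem_union_left _ (Finset.mem_image_of_mem _ (Finset.mem_univ r)),
    one_smul _ _⟩, rfl⟩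

theorem extendFun_present (i : R.carrier →[G] J) (m : InvFun M R) :
    I.extendFun v (I.present i m) = v.glue i m := by
  have h := I.tr_glue_eq v (𝟙 R) i m
  rw [D.tr_id] at h
  rw [h]
  exact congrArg _ ((fixedPointMackey ρ).tr_id R _).symm

/-- The morphism of modules which extends a family of values on orbits. -/
def extend : fixedPointModule ρ ⟶ D :=
  GreenModule.homOfMackey
    { app := fun S => AddMonoidHom.mk' (fun x : equivariantMaps ρ S => I.extendFun v x) fun x y => by
        classical
        -- All three values are computed with one finite set, for which the extension is additive.
        have h1 : I.supp x ⊆ I.supp x ∪ I.supp y ∪ I.supp (x + y) :=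
          Finset.subset_union_left.trans Finset.subset_union_left
        have h2 : I.supp y ⊆ I.supp x ∪ I.supp y ∪ I.supp (x + y) :=
          Finset.subset_union_right.trans Finset.subset_union_left
        have h3 : I.supp (x + y) ⊆ I.supp x ∪ I.supp y ∪ I.supp (x + y) :=
          Finset.subset_union_right
        rw [← I.extendOn_eq v _ _ h1, ← I.extendOn_eq v _ _ h2, ← I.extendOn_eq v _ _ h3]
        exact map_add (I.extendOn v _ S) x y
      app_res := fun {S T} f x => by
        change I.extendFun v (equivariantMaps.res ρ f x) =
          D.res f (D.tr (fst T _) (v.glue (index T _) (I.coord (I.supp x) T x)))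
        -- Base change for the square formed by `f` and the first projections of `S × F` and `T ×
        -- F`, with `F` the hull of the support of `x`.
        rw [← I.extendOn_eq v _ _ (I.supp_res_subset f x),
          D.baseChange (prodMap f (𝟙 (hull G (I.supp x)))) (fst S _) _ _ ⟨rfl, ?_⟩, v.res_glue]
        · rfl
        · rintro ⟨t, j⟩ s (hs : t = fn f s)
          exact ⟨(s, j), ⟨Prod.ext hs.symm rfl, rfl⟩, fun y hy =>
            Prod.ext hy.2 (show y.2 = j from congrArg Prod.snd hy.1)⟩
      app_tr := fun {S T} f x => by
        change I.extendFun v (equivariantMaps.tr ρ f x) =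
          D.tr f (D.tr (fst S _) (v.glue (index S _) (I.coord (I.supp x) S x)))
        -- The composite transfer is another presentation of `tr f x`, and the value is independent
        -- of the presentation.
        rw [← D.tr_comp, I.tr_glue_eq]
        conv_lhs => rw [← I.tr_present_coord _ x (Finset.Subset.refl _)]
        exact congrArg _ ((fixedPointMackey ρ).tr_comp _ _ _).symm }

theorem homApp_extend (x : equivariantMaps ρ S) :
    GreenModule.homApp (I.extend v) S x = I.extendFun v x := rfl

theorem homApp_extend_orbit {O : OrbitCat G} (i : O.orbit.carrier →[G] J) (m : M) :
    GreenModule.homApp (I.extend v) O.orbit (I.present i (InvFun.const _ m)) = v.val O i m := by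
  rw [homApp_extend, extendFun_present, v.glue_orbit]

end Extend

/-- Every element is a transfer of presented elements, and these are determined by their
restrictions to orbits, where the function `m` becomes constant. -/
theorem hom_ext {D : ConstModule G} {f f' : fixedPointModule ρ ⟶ D}
    (h : ∀ (O : OrbitCat G) (i : O.orbit.carrier →[G] J) (m : M),
      GreenModule.homApp f O.orbit (I.present i (InvFun.const _ m)) =
        GreenModule.homApp f' O.orbit (I.present i (InvFun.const _ m))) : f = f' := by
  have key : ∀ (R : FinGSet G) (i : R.carrier →[G] J) (m : InvFun M R),
      GreenModule.homApp f R (I.present i m) = GreenModule.homApp f' R (I.present i m) := by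
    intro R i m
    refine D.toMackeyFunctor.ext_orbit fun O k => ?_
    refine (MackeyFunctor.Hom.app_res f.toHom k _).symm.trans
      (Eq.trans ?_ (MackeyFunctor.Hom.app_res f'.toHom k _))
    have : (fixedPointModule ρ).res k (I.present i m) =
        I.present (i.comp (fn k)) (InvFun.const _ (m.1 (fn k O.base))) := by
      apply Subtype.ext
      funext s
      have hm := InvFun.apply_eq_of_orbit (equivariantMaps.res 1 k m) s
      exact congrArg (fun z => I.equiv (Finsupp.single (i (fn k s)) z)) hm
    exact (congrArg _ this).trans ((h O _ _).trans (congrArg _ this.symm))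
  refine GreenModule.hom_ext fun S x => ?_
  have hx : x = (fixedPointModule ρ).tr (fst S (hull G (I.supp x)))
    (I.present (index S (I.supp x)) (I.coord (I.supp x) S x)) :=
      (I.tr_present_coord (I.supp x) x (Finset.Subset.refl _)).symm
  rw [hx]
  exact (MackeyFunctor.Hom.app_tr _ _ _).trans ((congrArg _ (key _ _ _)).trans
    (MackeyFunctor.Hom.app_tr _ _ _).symm)

end InducedModule


/-! ### Cellular chains as induced modules -/

namespace GCWComplex

open FiltSpace

variable (G X : Type u) [Group G] [TopologicalSpace X] [T2Space X] [MulAction G X]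
  [ContinuousConstSMul G X] [GCWComplex G X] (n : ℕ)

variable {G X n} in
theorem charHom_smulHom (g : G) (j : Cells G X n) :
    charHom j ≫ smulHom G X g = charHom (g • j) :=
  FiltSpace.Hom.ext (ContinuousMap.ext fun x => (charFun_smul g j x.down.2).symm)

/-- The direct sum of the maps induced by the characteristic maps. -/
def cellSum : (Cells G X n →₀ (disc.{u} n).cellChains n) →+ (filt G X).cellChains n :=
  Finsupp.liftAddHom fun j => (cellMap (charHom j) n).hom

theorem cellSum_bijective : Function.Bijective (cellSum G X n) := by
  constructor
  · refine (injective_iff_map_eq_zero _).2 fun y hy => Finsupp.ext fun j => ?_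
    by_contra hj
    exact hj ((cellAttachment G X n).eq_zero_of_sum_cellMap_char y.support y hy
      (Finsupp.mem_support_iff.2 hj))
  · intro c
    obtain ⟨s, m, h⟩ := (cellAttachment G X n).exists_sum_cellMap_char c
    refine ⟨∑ j ∈ s, Finsupp.single j (m j), ?_⟩
    rw [map_sum, ← h]
    exact Finset.sum_congr rfl fun j _ => Finsupp.liftAddHom_apply_single _ _ _

/-- The cellular `n`-chains are the direct sum of the groups `H_n(D^n, S^{n-1})` over the cells. -/
def inducedModule :
    InducedModule (Cells G X n) ((disc.{u} n).cellChains n) (chainsAction G X n) where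
  equiv := AddEquiv.ofBijective (cellSum G X n) (cellSum_bijective G X n)
  equiv_single g j m := by
    have h1 : ∀ i, cellSum G X n (Finsupp.single i m) = (cellMap (charHom i) n).hom m :=
      fun i => Finsupp.liftAddHom_apply_single _ _ _
    change chainsAction G X n g (cellSum G X n _) = cellSum G X n _
    rw [h1, h1, ← charHom_smulHom, cellMap_comp]
    rfl

variable {G X n} [Finite G]

theorem mapCharHom_precompHom {O P : OrbitCat G} (h : O.orbit ⟶ P.orbit)
    (i : P.orbit.carrier →[G] Cells G X n) :
    mapCharHom i ≫ precompHom G X h = mapCharHom (i.comp (FinGSet.fn h)) := rfl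

/-- The values of a morphism out of the cellular chains of the fixed point spaces. -/
def orbitValues {D : ConstModule G}
    (φ : (coeffChains G X).X n ⟶ (GreenModule.toCoeff (constGreen G)).obj D) :
    OrbitValues (Cells G X n) ((disc.{u} n).cellChains n) D.toMackeyFunctor where
  val O i := (φ.app (Opposite.op O)).hom.comp (cellMap (mapCharHom i) n).hom
  val_comp {O P} h i m := by
    have h1 := ConcreteCategory.congr_hom (φ.naturality (X := Opposite.op P) (Y := Opposite.op O)
      (Quiver.Hom.op (V := OrbitCat G) (X := O) (Y := P) h)) ((cellMap (mapCharHom i) n).hom m)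
    refine Eq.trans ?_ h1
    change (φ.app (Opposite.op O)).hom ((cellMap (mapCharHom (i.comp (FinGSet.fn h))) n).hom m) = _
    rw [← mapCharHom_precompHom, cellMap_comp]
    rfl

/-- Evaluation at `s` turns the characteristic map of the equivariant cell `i` into that of `i s`.
Thus the classes of cells of fixed point spaces go exactly to the elements on which
`InducedModule.extend` is prescribed. -/
theorem unitApp_mapCharHom {O : OrbitCat G} (i : O.orbit.carrier →[G] Cells G X n)
    (m : (disc.{u} n).cellChains n) :
    unitApp G X n O.orbit ((cellMap (mapCharHom i) n).hom m) =
      (inducedModule G X n).present i (InvFun.const _ m) := by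
  apply Subtype.ext
  funext s
  have h : (inducedModule G X n).equiv (Finsupp.single (i s) m) = (cellMap (charHom (i s)) n).hom m :=
    Finsupp.liftAddHom_apply_single _ _ _
  refine Eq.trans ?_ h.symm
  rw [← mapCharHom_evalHom, cellMap_comp]
  rfl

theorem cellChains_mapFilt_hom_ext {O : OrbitCat G} {A : Type u} [AddCommGroup A]
    {f f' : (mapFilt G X O.orbit).cellChains n →+ A}
    (h : ∀ (i : O.orbit.carrier →[G] Cells G X n) (m : (disc.{u} n).cellChains n),
      f ((cellMap (mapCharHom i) n).hom m) = f' ((cellMap (mapCharHom i) n).hom m)) : f = f' := by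
  have : MulAction.IsPretransitive G O.orbit.carrier :=
    inferInstanceAs (MulAction.IsPretransitive G (G ⧸ O.sub))
  refine AddMonoidHom.ext fun c => ?_
  obtain ⟨s, m, rfl⟩ := (mapCellAttachment X n O.base).exists_sum_cellMap_char c
  rw [map_sum, map_sum]
  exact Finset.sum_congr rfl fun i _ => h i (m i)

theorem homApp_extend_unitApp {D : ConstModule G}
    (φ : (coeffChains G X).X n ⟶ (GreenModule.toCoeff (constGreen G)).obj D) {O : OrbitCat G}
    (i : O.orbit.carrier →[G] Cells G X n) (m : (disc.{u} n).cellChains n) :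
    GreenModule.homApp ((inducedModule G X n).extend (orbitValues φ)) O.orbit
      (unitApp G X n O.orbit ((cellMap (mapCharHom i) n).hom m)) =
      (φ.app (Opposite.op O)).hom ((cellMap (mapCharHom i) n).hom m) :=
  (congrArg (GreenModule.homApp ((inducedModule G X n).extend (orbitValues φ)) O.orbit)
    (unitApp_mapCharHom i m)).trans
      ((inducedModule G X n).homApp_extend_orbit (orbitValues φ) i m)

/-- The universal property in one degree. Existence: the extension of the values of `φ` on cells
agrees with `φ` on generators. Uniqueness: the images of these generators under the unit determine a
module morphism. -/
theorem existsUnique_unit_comp {D : ConstModule G}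
    (φ : (coeffChains G X).X n ⟶ (GreenModule.toCoeff (constGreen G)).obj D) :
    ∃! ψ : (constChains G X).X n ⟶ D,
      (unit G X).f n ≫ (GreenModule.toCoeff (constGreen G)).map ψ = φ := by
  refine ⟨(inducedModule G X n).extend (orbitValues φ), ?_, fun ψ hψ => ?_⟩
  · refine NatTrans.ext (funext fun O => AddCommGrpCat.hom_ext ?_)
    exact cellChains_mapFilt_hom_ext
      (f := (GreenModule.homApp ((inducedModule G X n).extend (orbitValues φ)) O.unop.orbit).comp
        (unitApp G X n O.unop.orbit)) (f' := (φ.app O).hom) fun i m => homApp_extend_unitApp φ i m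
  · refine (inducedModule G X n).hom_ext fun O i m => ?_
    refine Eq.trans ?_ ((inducedModule G X n).homApp_extend_orbit (orbitValues φ) i m).symm
    refine (congrArg (GreenModule.homApp ψ O.orbit) (unitApp_mapCharHom i m).symm).trans ?_
    exact ConcreteCategory.congr_hom (congrArg (fun z => NatTrans.app z (Opposite.op O)) hψ)
      ((cellMap (mapCharHom i) n).hom m)

end GCWComplex

end

/-! ### The universal property for complexes -/

theorem mainTheorem11 {G X : Type u} [Group G] [Finite G] [TopologicalSpace X] [T2Space X]
    [MulAction G X] [ContinuousConstSMul G X] [GCWComplex G X]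
    (D : ChainComplex (ConstModule G) ℕ)
    (φ : GCWComplex.coeffChains G X ⟶
      ((GreenModule.toCoeff (constGreen G)).mapHomologicalComplex (ComplexShape.down ℕ)).obj D) :
    ∃! ψ : GCWComplex.constChains G X ⟶ D,
      GCWComplex.unit G X ≫
        ((GreenModule.toCoeff (constGreen G)).mapHomologicalComplex (ComplexShape.down ℕ)).map ψ =
      φ := by
  choose ψ hψ hψ' using fun n => GCWComplex.existsUnique_unit_comp (φ.f n)
  refine ⟨⟨ψ, fun i j _ => ?_⟩, ?_, fun ψ' h => ?_⟩
  -- Both ways around the square of differentials extend the same morphism from degree `i` of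
  -- `C_G(X)` to `D_j`, so they agree by uniqueness in degree `i`.
  · refine (GCWComplex.existsUnique_unit_comp (φ.f i ≫
      (GreenModule.toCoeff (constGreen G)).map (D.d i j))).unique ?_ ?_
    · rw [Functor.map_comp]
      exact (Category.assoc _ _ _).symm.trans (congrArg (· ≫ _) (hψ i))
    · rw [Functor.map_comp]
      refine (Category.assoc _ _ _).symm.trans
        ((congrArg (· ≫ _) ((GCWComplex.unit G X).comm i j)).trans ?_)
      exact (Category.assoc _ _ _).trans
        ((congrArg (_ ≫ ·) (hψ j)).trans (φ.comm i j).symm)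
  · ext1 n
    exact hψ n
  · ext1 n
    exact hψ' n _ (congrArg (fun z => z.f n) h)
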